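/- Let $\mathbb K\in\{\mathbb R,\mathbb C\}$. Let $M,N$ be smooth real manifolds of positive finite dimensions $m,n$ which are Hausdorff, paracompact and connected. Let $\mathfrak k\neq 0$ and $\mathfrak g$ be Lie algebras over $\mathbb K$ of finite dimensions $d$ and $e$. Write $\mathfrak z(\mathfrak g)$ for the center of $\mathfrak g$, $\operatorname{Cent}(\mathfrak g)=\{f\in\operatorname{End}_{\mathbb K}(\mathfrak g) : f[x,y]=[x,f(y)]\ \forall x,y\}$ for its centroid, and $\operatorname{N}(\mathfrak g)$, respectively $\operatorname{S}(\mathfrak g)$, for the set of nilpotent, respectively semisimple, endomorphisms in $\operatorname{Cent}(\mathfrak g)$; similarly for $\mathfrak k$. Assume $$\operatorname{Hom}(\mathfrak k/[\mathfrak k,\mathfrak k],\mathfrak z(\mathfrak k))=0,\quad \operatorname{Hom}(\mathfrak g/[\mathfrak g,\mathfrak g],\mathfrak z(\mathfrak g))=0,\quad \operatorname{S}(\mathfrak k)=\mathbb K\cdot\mathbf 1,\quad \operatorname{S}(\mathfrak g)=\mathbb K\cdot\mathbf 1 .$$ Let $\pi:\mathbb L\to M$ and $\varpi:\mathbb E\to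 N$ be bundles of Lie algebras with fibers $\mathfrak k$ and $\mathfrak g$, i.e. smooth vector bundles with a bundle atlas whose cocycle takes values in $\operatorname{Aut}(\mathfrak k)$, respectively $\operatorname{Aut}(\mathfrak g)$, so that every fiber is a Lie algebra and the bundle charts are Lie algebra isomorphisms on fibers. For $k\in\mathbb N\cup\{\infty\}$ let $\Gamma^k(\mathbb L)$ be the $\mathbb K$-Lie algebra of $C^k$-sections of $\mathbb L$ with the pointwise bracket. For a bundle chart $(U,\varphi)$ (where $\varphi:\pi^{-1}(U)\to\mathfrak k$) write $A^\varphi=\varphi\circ A:U\to\mathfrak k$ for the local form of a section $A$; use the same notation for $\mathbb E$. For a chart $\xi$ of $M$, $\partial_\xi^\alpha=\partial_{\xi_1}^{\alpha_1}\cdots\partial_{\xi_m}^{\alpha_m}$ denotes the iterated partial derivatives in the coordinates $\xi$. Suppose that $\mu:\Gamma^k(\mathbb L)\to\Gamma^\ell(\mathbb E)$ is an isomorphism of $\mathbb K$-Lie algebras, where $k,\ell\in(\mathbb N\cup\{\infty\})\setminus\{0\}$. Then $k=\ell$, and: (a) If $k=\ell$ is finite, there is a $C^k$-isomorphism of vector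 bundles $\kappa:\mathbb L\to\mathbb E$, covering a $C^k$-diffeomorphism $\kappa':M\to N$, such that $\mu(X)=\kappa\circ X\circ(\kappa')^{-1}$ for all $X\in\Gamma^k(\mathbb L)$. In particular, $M$ and $N$ are $C^k$-diffeomorphic, and $\mathfrak k$ and $\mathfrak g$ are isomorphic Lie algebras. (b) If $k=\ell=\infty$, then $\mathfrak k\cong\mathfrak g$ as Lie algebras and there is a smooth diffeomorphism $\lambda:M\to N$ such that, after identifying $M$ with $N$ by $\lambda$, $\mu$ is a linear differential operator of order at most $e-1$. Moreover, for every Lie algebra isomorphism $\iota:\mathfrak k\to\mathfrak g$, every bundle chart $\varphi$ of $\mathbb L$, every bundle chart $\psi$ of $\mathbb E$ and every chart $\xi$ of $M$, the following holds on the intersection $U\subseteq M$ of the domains of $\varphi$, of $\xi$ and of $\psi$ (pulled back by $\lambda$): there are smooth functions $\mu_0:U\to\operatorname{Aut}(\mathfrak g)$ and $N_1,\dots,N_m:U\to\operatorname{N}(\mathfrak g)$ such that for all $A\in\Gamma^\infty(\mathbb L)$ and $x\in U$ $$(\mu A)^{\psi}(\lambda(x))=\sum_{\alpha\in\mathbb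 N^m,\ |\alpha|<d}\frac1{\alpha!}\,N(x)^\alpha\Bigl(\mu_0(x)\bigl(\iota\,(\partial_\xi^\alpha A^\varphi)(x)\bigr)\Bigr),\qquad N^\alpha=N_1^{\alpha_1}\circ\cdots\circ N_m^{\alpha_m}.$$ -/

import Mathlib

open Bundle Set
open scoped Manifold ContDiff

/-! ### Lie algebras: centroid, nilpotent and semisimple parts -/

/-- A Lie ring whose additive group carries a norm. No compatibility between norm and bracket is
asked for: on a finite-dimensional real vector space the norm only serves to provide the standard
topology and the standard smooth structure. -/
class NormedLieRing (V : Type*) extends NormedAddCommGroup V, LieRing V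

section LieAlgebra

variable (K : Type*) (V : Type*) [Field K] [LieRing V] [LieAlgebra K V]

/-- The centroid `Cent(V)`: endomorphisms `f` with `f ⁅x, y⁆ = ⁅x, f y⁆`. -/
def lieCentroid : Subalgebra K (Module.End K V) where
  carrier := {f | ∀ x y : V, f ⁅x, y⁆ = ⁅x, f y⁆}
  mul_mem' := by
    intro f g hf hg x y
    simp only [mem_ofPred_eq] at hf hg
    simp [Module.End.mul_apply, hf, hg]
  add_mem' := by
    intro f g hf hg x y
    simp only [mem_ofPred_eq] at hf hg
    simp [hf, hg]
  algebraMap_mem' := by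
    intro c x y
    simp [Module.algebraMap_end_apply]

/-- `N(V)`: the nilpotent elements of the centroid. -/
def nilpotentCentroid : Set (Module.End K V) := {f | f ∈ lieCentroid K V ∧ IsNilpotent f}

/-- `S(V)`: the semisimple elements of the centroid. -/
def semisimpleCentroid : Set (Module.End K V) := {f | f ∈ lieCentroid K V ∧ f.IsSemisimple}

/-- `Hom(V / [V, V], z(V)) = 0`. -/
def HomAbelianizationCenterTrivial : Prop :=
  ∀ φ : (V ⧸ (⁅(⊤ : LieIdeal K V), (⊤ : LieIdeal K V)⁆ : LieIdeal K V)) →ₗ⁅K⁆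
    LieAlgebra.center K V, φ = 0

end LieAlgebra

/-! ### Multi-indices and partial derivatives in a chart -/

/-- The multi-indices `α ∈ ℕ^m` with `|α| < d`. -/
def multiIndices (m d : ℕ) : Finset (Fin m → ℕ) :=
  (Finset.range d).biUnion fun j => Finset.univ.piAntidiag j

theorem mem_multiIndices {m d : ℕ} {α : Fin m → ℕ} : α ∈ multiIndices m d ↔ ∑ i, α i < d := by
  simp [multiIndices]

/-- `α! = α₁! ⋯ α_m!`. -/
def multiFactorial {m : ℕ} (α : Fin m → ℕ) : ℕ := ∏ i, (α i).factorial

/-- `N^α = N₁^α₁ ∘ ⋯ ∘ N_m^α_m`. -/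
def multiPow {R : Type*} [Monoid R] {m : ℕ} (N : Fin m → R) (α : Fin m → ℕ) : R :=
  (List.ofFn fun i => N i ^ α i).prod

section Partial

variable {m : ℕ} {M : Type*} [TopologicalSpace M]
  {V : Type*} [NormedAddCommGroup V] [NormedSpace ℝ V]

/-- `∂_{ξ_i} f (x) = d/dt|_{t=0} f (ξ⁻¹ (ξ x + t e_i))`, meaningful for `x` in the domain of the
chart `ξ`. -/
noncomputable def chartPartial (ξ : OpenPartialHomeomorph M (EuclideanSpace ℝ (Fin m)))
    (i : Fin m) (f : M → V) : M → V :=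
  fun x => lineDeriv ℝ (fun p => f (ξ.symm p)) (ξ x) (EuclideanSpace.single i (1 : ℝ))

/-- `∂_ξ^α f = ∂_{ξ_1}^{α_1} ⋯ ∂_{ξ_m}^{α_m} f`. -/
noncomputable def chartMultiPartial (ξ : OpenPartialHomeomorph M (EuclideanSpace ℝ (Fin m)))
    (α : Fin m → ℕ) (f : M → V) : M → V :=
  (List.ofFn fun i => (chartPartial (V := V) ξ i)^[α i]).foldr (fun D g => D g) f

/-- A family, parametrized by `x ∈ U`, of maps `T x : W → V` is smooth on `U`: all its evaluations
are. For linear maps between finite-dimensional spaces this is smoothness as a map from `U` to the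
(finite-dimensional) space of linear maps. -/
def SmoothFamilyOn (m : ℕ) {M : Type*} [TopologicalSpace M]
    {V : Type*} [NormedAddCommGroup V] [NormedSpace ℝ V]
    [ChartedSpace (EuclideanSpace ℝ (Fin m)) M] {W : Type*}
    (U : Set M) (T : M → W → V) : Prop :=
  ∀ w : W, ContMDiffOn (𝓡 m) 𝓘(ℝ, V) ∞ (fun x => T x w) U

end Partial

/-! ### Bundles of Lie algebras and their Lie algebras of sections -/

/-- A smooth real vector bundle with typical fiber the `K`-Lie algebra `F` and with a `K`-Lie
algebra structure on each fiber is a bundle of Lie algebras if every chart of its bundle atlas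
restricts to isomorphisms of `K`-Lie algebras from the fibers to `F` (so that the cocycle of the
atlas takes its values in `Aut(F)`). -/
class IsLieAlgebraBundle (K : Type*) [RCLike K] {M : Type*} [TopologicalSpace M]
    (F : Type*) [NormedLieRing F] [NormedSpace ℝ F] [LieAlgebra K F]
    (L : M → Type*) [∀ x, LieRing (L x)] [∀ x, LieAlgebra K (L x)] [∀ x, Module ℝ (L x)]
    [∀ x, TopologicalSpace (L x)] [TopologicalSpace (TotalSpace F L)]
    [FiberBundle F L] [VectorBundle ℝ F L] : Prop where
  chart_smul : ∀ e ∈ FiberBundle.trivializationAtlas F L, ∀ x ∈ e.baseSet, ∀ (c : K) (v : L x),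
    (e ⟨x, c • v⟩).2 = c • (e ⟨x, v⟩).2
  chart_lie : ∀ e ∈ FiberBundle.trivializationAtlas F L, ∀ x ∈ e.baseSet, ∀ v w : L x,
    (e ⟨x, ⁅v, w⁆⟩).2 = ⁅(e ⟨x, v⟩).2, (e ⟨x, w⟩).2⁆

section Sections

/-- The local form `A^φ : x ↦ φ (A x)` of a section in a bundle chart `φ`. -/
def localForm {M : Type*} [TopologicalSpace M] {F : Type*} [TopologicalSpace F] {L : M → Type*}
    [TopologicalSpace (TotalSpace F L)]
    (e : Trivialization F (TotalSpace.proj : TotalSpace F L → M)) (A : ∀ x, L x) : M → F :=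
  fun x => (e ⟨x, A x⟩).2

theorem contMDiffAt_lie (K : Type*) [RCLike K] {m : ℕ} {M : Type*} [TopologicalSpace M]
    [ChartedSpace (EuclideanSpace ℝ (Fin m)) M]
    (F : Type*) [NormedLieRing F] [NormedSpace ℝ F] [LieAlgebra K F] [IsScalarTower ℝ K F]
    [FiniteDimensional K F]
    (k : ℕ∞) {f g : M → F} {x : M}
    (hf : ContMDiffAt (𝓡 m) 𝓘(ℝ, F) k f x) (hg : ContMDiffAt (𝓡 m) 𝓘(ℝ, F) k g x) :
    ContMDiffAt (𝓡 m) 𝓘(ℝ, F) k (fun y => ⁅f y, g y⁆) x := by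
  have : FiniteDimensional ℝ F := FiniteDimensional.trans ℝ K F
  let B : F →ₗ[ℝ] F →ₗ[ℝ] F := LinearMap.mk₂ ℝ (fun a b => ⁅a, b⁆)
    (fun a b c => add_lie a b c)
    (fun r a b => by
      rw [← algebraMap_smul K r a, smul_lie, algebraMap_smul])
    (fun a b c => lie_add a b c)
    (fun r a b => by
      rw [← algebraMap_smul K r b, lie_smul, algebraMap_smul])
  have hB : ContDiff ℝ k (fun p : F × F => B p.1 p.2) := by
    let B' : F →L[ℝ] F →L[ℝ] F :=
      LinearMap.toContinuousLinearMap
        ((LinearMap.toContinuousLinearMap : (F →ₗ[ℝ] F) ≃ₗ[ℝ] (F →L[ℝ] F)).toLinearMap ∘ₗ B)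
    exact B'.isBoundedBilinearMap.contDiff
  exact hB.contDiffAt.contMDiffAt.comp x (hf.prodMk_space hg)

theorem contMDiffAt_K_smul (K : Type*) [RCLike K] {m : ℕ} {M : Type*} [TopologicalSpace M]
    [ChartedSpace (EuclideanSpace ℝ (Fin m)) M]
    (F : Type*) [NormedLieRing F] [NormedSpace ℝ F] [LieAlgebra K F] [IsScalarTower ℝ K F]
    [FiniteDimensional K F]
    (k : ℕ∞) (c : K) {f : M → F} {x : M}
    (hf : ContMDiffAt (𝓡 m) 𝓘(ℝ, F) k f x) :
    ContMDiffAt (𝓡 m) 𝓘(ℝ, F) k (fun y => c • f y) x := by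
  have : FiniteDimensional ℝ F := FiniteDimensional.trans ℝ K F
  let S : F →ₗ[ℝ] F :=
    { toFun := fun v => c • v
      map_add' := fun v w => smul_add c v w
      map_smul' := fun r v => by
        simp only [RingHom.id_apply]
        rw [← algebraMap_smul K r v, ← algebraMap_smul K r (c • v), smul_comm] }
  have hS : ContDiff ℝ k (fun v : F => S v) := (LinearMap.toContinuousLinearMap S).contDiff
  exact hS.contDiffAt.contMDiffAt.comp x hf

variable (K : Type*) [RCLike K] (m : ℕ) {M : Type*} [TopologicalSpace M]
  [ChartedSpace (EuclideanSpace ℝ (Fin m)) M]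
  (F : Type*) [NormedLieRing F] [NormedSpace ℝ F] [LieAlgebra K F] [IsScalarTower ℝ K F]
  [FiniteDimensional K F]
  (L : M → Type*) [∀ x, LieRing (L x)] [∀ x, LieAlgebra K (L x)] [∀ x, Module ℝ (L x)]
  [∀ x, IsScalarTower ℝ K (L x)]
  [∀ x, TopologicalSpace (L x)] [TopologicalSpace (TotalSpace F L)]
  [FiberBundle F L] [VectorBundle ℝ F L] [ContMDiffVectorBundle ∞ F L (𝓡 m)]
  [IsLieAlgebraBundle K F L]

/-- `Γ^k(L)`: the `K`-vector space of `C^k` sections. -/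
def ckSections (k : ℕ∞) : Submodule K (∀ x, L x) where
  carrier := {X | ContMDiff (𝓡 m) ((𝓡 m).prod 𝓘(ℝ, F)) k fun x => TotalSpace.mk' F x (X x)}
  add_mem' := by
    intro X Y hX hY
    have : ContMDiffVectorBundle k F L (𝓡 m) := .of_le (n := ∞) (mod_cast le_top)
    exact ContMDiff.add_section hX hY
  zero_mem' := by
    have : ContMDiffVectorBundle k F L (𝓡 m) := .of_le (n := ∞) (mod_cast le_top)
    exact contMDiff_zeroSection ℝ L
  smul_mem' := by
    intro c X hX x
    have : ContMDiffVectorBundle k F L (𝓡 m) := .of_le (n := ∞) (mod_cast le_top)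
    have hx := FiberBundle.mem_baseSet_trivializationAt F L x
    refine ((trivializationAt F L x).contMDiffAt_section_iff hx).2 ?_
    refine (contMDiffAt_K_smul K F k c
      (((trivializationAt F L x).contMDiffAt_section_iff hx).1 (hX x))).congr_of_eventuallyEq ?_
    filter_upwards [(trivializationAt F L x).open_baseSet.mem_nhds hx] with y hy
    exact IsLieAlgebraBundle.chart_smul _ (FiberBundle.trivialization_mem_atlas F L x) y hy c (X y)

set_option linter.unusedSectionVars false in
theorem lie_mem_ckSections (k : ℕ∞) {X Y : ∀ x, L x}
    (hX : X ∈ ckSections K m F L k) (hY : Y ∈ ckSections K m F L k) :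
    (fun x => ⁅X x, Y x⁆) ∈ ckSections K m F L k := by
  intro x
  have : ContMDiffVectorBundle k F L (𝓡 m) := .of_le (n := ∞) (mod_cast le_top)
  have hx := FiberBundle.mem_baseSet_trivializationAt F L x
  refine ((trivializationAt F L x).contMDiffAt_section_iff hx).2 ?_
  refine (contMDiffAt_lie K F k
    (((trivializationAt F L x).contMDiffAt_section_iff hx).1 (hX x))
    (((trivializationAt F L x).contMDiffAt_section_iff hx).1 (hY x))).congr_of_eventuallyEq ?_
  filter_upwards [(trivializationAt F L x).open_baseSet.mem_nhds hx] with y hy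
  exact IsLieAlgebraBundle.chart_lie K _ (FiberBundle.trivialization_mem_atlas F L x) y hy
    (X y) (Y y)

/-- The pointwise bracket on `Γ^k(L)`. -/
instance ckSections.instLieRing (k : ℕ∞) : LieRing (ckSections K m F L k) where
  bracket X Y := ⟨fun x => ⁅X.1 x, Y.1 x⁆, lie_mem_ckSections K m F L k X.2 Y.2⟩
  add_lie X Y Z := Subtype.ext (funext fun x => add_lie (X.1 x) (Y.1 x) (Z.1 x))
  lie_add X Y Z := Subtype.ext (funext fun x => lie_add (X.1 x) (Y.1 x) (Z.1 x))
  lie_self X := Subtype.ext (funext fun x => lie_self (X.1 x))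
  leibniz_lie X Y Z := Subtype.ext (funext fun x => leibniz_lie (X.1 x) (Y.1 x) (Z.1 x))

instance ckSections.instLieAlgebra (k : ℕ∞) : LieAlgebra K (ckSections K m F L k) where
  lie_smul c X Y := Subtype.ext (funext fun x => lie_smul c (X.1 x) (Y.1 x))

end Sections

/-! ### Maps between bundles and operators between spaces of sections -/

section Operators

variable (K : Type*) [RCLike K] (m n : ℕ)
  {M : Type*} [TopologicalSpace M] [ChartedSpace (EuclideanSpace ℝ (Fin m)) M]
  {N : Type*} [TopologicalSpace N] [ChartedSpace (EuclideanSpace ℝ (Fin n)) N]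
  (F : Type*) [NormedLieRing F] [NormedSpace ℝ F] [LieAlgebra K F] [IsScalarTower ℝ K F]
  [FiniteDimensional K F]
  (L : M → Type*) [∀ x, LieRing (L x)] [∀ x, LieAlgebra K (L x)] [∀ x, Module ℝ (L x)]
  [∀ x, IsScalarTower ℝ K (L x)]
  [∀ x, TopologicalSpace (L x)] [TopologicalSpace (TotalSpace F L)]
  [FiberBundle F L] [VectorBundle ℝ F L] [ContMDiffVectorBundle ∞ F L (𝓡 m)]
  [IsLieAlgebraBundle K F L]
  (G : Type*) [NormedLieRing G] [NormedSpace ℝ G] [LieAlgebra K G] [IsScalarTower ℝ K G]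
  [FiniteDimensional K G]
  (E : N → Type*) [∀ y, LieRing (E y)] [∀ y, LieAlgebra K (E y)] [∀ y, Module ℝ (E y)]
  [∀ y, IsScalarTower ℝ K (E y)]
  [∀ y, TopologicalSpace (E y)] [TopologicalSpace (TotalSpace G E)]
  [FiberBundle G E] [VectorBundle ℝ G E] [ContMDiffVectorBundle ∞ G E (𝓡 n)]
  [IsLieAlgebraBundle K G E]

/-- A `C^k` isomorphism of `K`-vector bundles `κ : L → E`, covering the `C^k` diffeomorphism `base`
of the base manifolds: a `C^k` diffeomorphism of total spaces that maps each fiber `L x`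
`K`-linearly and bijectively to the fiber `E (base x)`. -/
structure CkVectorBundleIso (k : ℕ∞) where
  base : Diffeomorph (𝓡 m) (𝓡 n) M N k
  total : Diffeomorph ((𝓡 m).prod 𝓘(ℝ, F)) ((𝓡 n).prod 𝓘(ℝ, G)) (TotalSpace F L)
    (TotalSpace G E) k
  fiber : ∀ x, L x ≃ₗ[K] E (base x)
  total_mk : ∀ x (v : L x), total (TotalSpace.mk' F x v) = TotalSpace.mk' G (base x) (fiber x v)

variable {m n F L G E}

/-- After identifying `M` with `N` through the diffeomorphism `lam`, the operator `T` is a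
differential operator of order at most `r`: around each point there are bundle charts `φ` of `L`
and `ψ` of `E`, a chart `ξ` of `M` and smooth coefficients `c α` with
`(T A)^ψ = ∑_{|α| ≤ r} c α · ∂_ξ^α A^φ`. -/
def IsDiffOpAlong {k l : ℕ∞} (lam : Diffeomorph (𝓡 m) (𝓡 n) M N ∞)
    (T : ckSections K m F L k → ckSections K n G E l) (r : ℕ) : Prop :=
  ∀ x₀ : M, ∃ U : Set M, IsOpen U ∧ x₀ ∈ U ∧
    ∃ φ ∈ FiberBundle.trivializationAtlas F L, ∃ ψ ∈ FiberBundle.trivializationAtlas G E,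
    ∃ ξ ∈ IsManifold.maximalAtlas (𝓡 m) ∞ M,
      U ⊆ φ.baseSet ∧ U ⊆ lam ⁻¹' ψ.baseSet ∧ U ⊆ ξ.source ∧
      ∃ c : (Fin m → ℕ) → M → (F →ₗ[K] G),
        (∀ α, SmoothFamilyOn m U fun x => (c α x : F → G)) ∧
        ∀ (A : ckSections K m F L k), ∀ x ∈ U,
          localForm ψ (T A).1 (lam x) =
            ∑ α ∈ multiIndices m (r + 1), c α x (chartMultiPartial ξ α (localForm φ A.1) x)

end Operators

/-!
An isomorphism `μ : Γ^k(L) ≃ Γ^l(E)` of Lie algebras also transports the centroids, and the centroid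
of `Γ^k(L)` contains the multiplications by functions. The proof recovers the base map from this
and then measures how far `μ` is from being linear over the functions.

The hypotheses on the fibers say that these are perfect or centerless, and, by the Jordan–Chevalley
decomposition, that each element of their centroid is a scalar, its residue, plus a nilpotent
element (`HasLocalCentroid.of_hom_trivial`). The centroid is thus a commutative local algebra, and
the powers of its maximal ideal `J` give a finite filtration of the fiber by the subspaces `J^r V`,
which vanish for `r ≥ dim V` (`HasLocalCentroid.nilFiltration_eq_bot`).

Each element of the centroid of `Γ^k(L)` acts pointwise (`HasLocalCentroid.section_apply_eq_zero`).
This is immediate for centerless fibers. For perfect fibers one uses that finitely many sections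
`sⱼ` span all fibers (`exists_sections_span_eq_top`, by a dimension count and the Baire category
theorem), so that a section `X` vanishing at a point is a sum `∑ⱼ [sⱼ, Zⱼ]` with all `Zⱼ` vanishing
there (`exists_sum_lie_eq`). Hence such an element has a residue at each point, and the residue at
`q ∈ N` of a function on `M`, transported by `μ`, is a character of the algebra of functions. Such a
character is the evaluation at a point `σ q` (`exists_forall_eq_apply`), which defines the base map
`σ` (`exists_covers`). The map `σ` is invertible (`Covers.comp_eq`) and of class `C^l`
(`Covers.contMDiff`), and the value of `μ X` at `q` depends only on the germ of `X` at `σ q`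
(`Covers.apply_eq_zero`). Since `|t| t^k` is of class `C^k` but not `C^{k+1}`, pulling it back along
`σ` in a coordinate gives `k = l` (`Covers.le_of_ne_zero`).

A function `f` on `M` now acts through `μ` on the fiber over `q` as `f (σ q)` plus a nilpotent
endomorphism, its `symbolDefect`. For finite `k`, this is a derivation in `f` modulo a deeper step of
the filtration; as the algebra of `C^k` functions has no nonzero derivations (`derivation_eq_zero`),
the nilpotent part vanishes (`Covers.transportedSmul_eq`). So `μ` is linear over the functions, acts
pointwise, and comes from an isomorphism of bundles (`Covers.exists_bundleIso`).

For `k = ∞`, let `Nᵢ` be the nilpotent part of the `i`-th coordinate of a chart, and let `ν v` be the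
value of `μ` on a section that is constantly `v` near `σ q`. The Lie algebra homomorphism `ν` is
surjective on the graded pieces of the filtration, hence an isomorphism by a count of dimensions
(`Covers.constMap_surjective`, `Covers.exists_constEquiv`). Both `μ` and the truncated exponential
series `∑ N^α ν(∂^α A) / α!` agree on locally constant sections, and both turn multiplication by
`xᵢ - xᵢ(σ q)` into `Nᵢ` (`expJet_coordMul`). By Hadamard's lemma, their difference lies in every step
of the filtration, so it vanishes (`Covers.localForm_eq_expJet`). This gives the normal form
(`Covers.exists_normalForm`), for `μ₀ = ν ∘ ι⁻¹`.
-/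

set_option linter.unusedSectionVars false

/-! ### Lie algebras with local centroid -/

section CentroidAlgebra

variable {K V W : Type*} [Field K] [LieRing V] [LieAlgebra K V] [LieRing W] [LieAlgebra K W]

theorem mem_lieCentroid {f : Module.End K V} :
    f ∈ lieCentroid K V ↔ ∀ x y : V, f ⁅x, y⁆ = ⁅x, f y⁆ := Iff.rfl

theorem lieCentroid_apply_lie_left {f : Module.End K V} (hf : f ∈ lieCentroid K V) (x y : V) :
    f ⁅x, y⁆ = ⁅f x, y⁆ := by
  rw [← lie_skew, map_neg, mem_lieCentroid.1 hf, lie_skew]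

theorem conj_mem_lieCentroid (e : V ≃ₗ⁅K⁆ W) {f : Module.End K V} (hf : f ∈ lieCentroid K V) :
    e.toLinearEquiv.conj f ∈ lieCentroid K W := by
  intro x y
  have h := mem_lieCentroid.1 hf (e.symm x) (e.symm y)
  rw [← LieEquiv.map_lie] at h
  have h' := congrArg e h
  rw [LieEquiv.map_lie e, e.apply_symm_apply] at h'
  exact h'

theorem isNilpotent_conj (e : V ≃ₗ[K] W) {f : Module.End K V} (hf : IsNilpotent f) :
    IsNilpotent (e.conj f) := by
  obtain ⟨n, hn⟩ := hf
  have h : ∀ j : ℕ, e.conj f ^ j = e.conj (f ^ j) := by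
    intro j
    induction j with
    | zero => ext w; simp
    | succ j ih => rw [pow_succ, pow_succ, ih]; ext w; simp [LinearEquiv.conj_apply_apply]
  exact ⟨n, by rw [h, hn, map_zero]⟩

theorem conj_mem_nilpotentCentroid (e : V ≃ₗ⁅K⁆ W) {f : Module.End K V}
    (hf : f ∈ nilpotentCentroid K V) : e.toLinearEquiv.conj f ∈ nilpotentCentroid K W :=
  ⟨conj_mem_lieCentroid e hf.1, isNilpotent_conj e.toLinearEquiv hf.2⟩

variable (K V) in
/-- A Lie algebra that is perfect or has trivial center, and whose centroid consists of the sums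
of a scalar and a nilpotent endomorphism. The first condition makes the centroid commutative, so
the second one says that the centroid is a local algebra with residue field `K`. -/
structure HasLocalCentroid : Prop where
  perfect_or_centerless : Submodule.span K {v : V | ∃ x y : V, ⁅x, y⁆ = v} = ⊤ ∨
    ∀ z : V, (∀ x : V, ⁅x, z⁆ = 0) → z = 0
  exists_scalar : ∀ T ∈ lieCentroid K V, ∃ c : K, IsNilpotent (T - c • (1 : Module.End K V))

/-- If a linear form `f ≠ 0` vanishes on all brackets and `z ≠ 0` is central, then `x ↦ f x • z` is a
nonzero homomorphism from the abelianization to the center. -/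
theorem perfect_or_centerless_of_hom_trivial (h : HomAbelianizationCenterTrivial K V) :
    Submodule.span K {v : V | ∃ x y : V, ⁅x, y⁆ = v} = ⊤ ∨
      ∀ z : V, (∀ x : V, ⁅x, z⁆ = 0) → z = 0 := by
  by_contra! hcon
  obtain ⟨h1, z, hz, hz0⟩ := hcon
  have hspan : (⁅(⊤ : LieIdeal K V), (⊤ : LieIdeal K V)⁆ : LieIdeal K V).toSubmodule =
      Submodule.span K {v : V | ∃ x y : V, ⁅x, y⁆ = v} := by
    rw [LieSubmodule.lieIdeal_oper_eq_linear_span']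
    simp
  obtain ⟨v, hv⟩ : ∃ v, v ∉ Submodule.span K {v : V | ∃ x y : V, ⁅x, y⁆ = v} := by
    by_contra! hall
    exact h1 (eq_top_iff.2 fun v _ => hall v)
  obtain ⟨f, hfv, hf⟩ := Submodule.exists_le_ker_of_notMem hv
  let g : (V ⧸ (⁅(⊤ : LieIdeal K V), (⊤ : LieIdeal K V)⁆ : LieIdeal K V)) →ₗ[K] K :=
    Submodule.liftQ _ f (by rw [hspan]; exact hf)
  have hz' : z ∈ LieAlgebra.center K V :=
    (LieModule.mem_maxTrivSubmodule K V V z).2 hz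
  let φ : (V ⧸ (⁅(⊤ : LieIdeal K V), (⊤ : LieIdeal K V)⁆ : LieIdeal K V)) →ₗ⁅K⁆
      LieAlgebra.center K V :=
    { toLinearMap := g.smulRight ⟨z, hz'⟩
      map_lie' := by
        intro x y
        obtain ⟨a, rfl⟩ := Submodule.Quotient.mk_surjective _ x
        obtain ⟨b, rfl⟩ := Submodule.Quotient.mk_surjective _ y
        have h0 : f ⁅a, b⁆ = 0 := hf (Submodule.subset_span ⟨a, b, rfl⟩)
        apply Subtype.ext
        simp only [AddHom.toFun_eq_coe, LinearMap.coe_toAddHom,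
          LinearMap.smulRight_apply, trivial_lie_zero, ZeroMemClass.coe_zero,
          SetLike.val_smul, smul_eq_zero]
        exact Or.inl h0 }
  have h2 := LieHom.congr_fun (h φ) (Submodule.Quotient.mk v)
  have h3 : f v • z = 0 := congrArg Subtype.val h2
  rcases smul_eq_zero.1 h3 with h4 | h4
  · exact hfv h4
  · exact hz0 h4

/-- The hypotheses on the fibers give a local centroid: by the Jordan–Chevalley decomposition an
element of the centroid is the sum of a semisimple and a nilpotent polynomial in it. -/
theorem HasLocalCentroid.of_hom_trivial [PerfectField K] [FiniteDimensional K V]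
    (h : HomAbelianizationCenterTrivial K V)
    (hS : semisimpleCentroid K V = range fun c : K => c • (1 : Module.End K V)) :
    HasLocalCentroid K V where
  perfect_or_centerless := perfect_or_centerless_of_hom_trivial h
  exists_scalar := by
    intro T hT
    obtain ⟨n, -, s, hs, hn, hss, hTns⟩ := Module.End.exists_isNilpotent_isSemisimple (f := T)
    have hle : Algebra.adjoin K {T} ≤ lieCentroid K V :=
      Algebra.adjoin_le (by simpa using hT)
    have hsS : s ∈ semisimpleCentroid K V := ⟨hle hs, hss⟩
    rw [hS] at hsS
    obtain ⟨c, rfl⟩ := hsS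
    exact ⟨c, by rw [hTns]; simpa using hn⟩

theorem HasLocalCentroid.of_equiv (hV : HasLocalCentroid K V) (e : V ≃ₗ⁅K⁆ W) :
    HasLocalCentroid K W where
  perfect_or_centerless := by
    rcases hV.perfect_or_centerless with h | h
    · left
      rw [eq_top_iff]
      intro w _
      have hw : e.symm w ∈ Submodule.span K {v : V | ∃ x y : V, ⁅x, y⁆ = v} := by
        rw [h]; trivial
      have h2 : Submodule.map (e.toLinearEquiv : V →ₗ[K] W)
          (Submodule.span K {v : V | ∃ x y : V, ⁅x, y⁆ = v}) ≤
          Submodule.span K {v : W | ∃ x y : W, ⁅x, y⁆ = v} := by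
        rw [Submodule.map_span_le]
        rintro _ ⟨x, y, rfl⟩
        exact Submodule.subset_span ⟨e x, e y, (LieEquiv.map_lie e x y).symm⟩
      have h3 := h2 (Submodule.mem_map_of_mem hw)
      simpa using h3
    · right
      intro z hz
      have h0 : e.symm z = 0 := by
        apply h
        intro x
        have := congrArg e.symm (hz (e x))
        rwa [LieEquiv.map_lie, LieEquiv.symm_apply_apply, map_zero] at this
      have := congrArg e h0
      rwa [LieEquiv.apply_symm_apply, map_zero] at this
  exists_scalar := by
    intro T hT
    obtain ⟨c, hc⟩ := hV.exists_scalar _ (conj_mem_lieCentroid e.symm hT)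
    refine ⟨c, ?_⟩
    have h := isNilpotent_conj e.toLinearEquiv hc
    have h2 : e.toLinearEquiv.conj (e.symm.toLinearEquiv.conj T - c • (1 : Module.End K V)) =
        T - c • (1 : Module.End K W) := by
      ext w
      change e (e.symm (T (e (e.symm w))) - c • e.symm w) = T w - c • w
      rw [map_sub, map_smul, LieEquiv.apply_symm_apply, LieEquiv.apply_symm_apply]
    rwa [h2] at h

/-- Any two elements of a centroid commute on brackets, which suffices in a perfect Lie algebra, and
their commutator has central values, which suffices if the center is trivial. -/
theorem HasLocalCentroid.commute (hV : HasLocalCentroid K V) {S T : Module.End K V}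
    (hS : S ∈ lieCentroid K V) (hT : T ∈ lieCentroid K V) : Commute S T := by
  have hbr : ∀ x y : V, S (T ⁅x, y⁆) = T (S ⁅x, y⁆) := by
    intro x y
    rw [mem_lieCentroid.1 hT, lieCentroid_apply_lie_left hS, lieCentroid_apply_lie_left hS,
      mem_lieCentroid.1 hT]
  rcases hV.perfect_or_centerless with h | h
  · have : S * T = T * S := by
      refine LinearMap.ext_on h ?_
      rintro _ ⟨x, y, rfl⟩
      exact hbr x y
    exact this
  · refine LinearMap.ext fun y => ?_
    rw [← sub_eq_zero]
    apply h
    intro x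
    change ⁅x, S (T y) - T (S y)⁆ = 0
    rw [lie_sub, ← mem_lieCentroid.1 hS, ← mem_lieCentroid.1 hT, ← mem_lieCentroid.1 hT,
      ← mem_lieCentroid.1 hS, hbr, sub_self]

theorem HasLocalCentroid.mul_mem_nilpotentCentroid (hV : HasLocalCentroid K V)
    {S T : Module.End K V} (hS : S ∈ lieCentroid K V) (hT : T ∈ nilpotentCentroid K V) :
    S * T ∈ nilpotentCentroid K V :=
  ⟨mul_mem hS hT.1, (hV.commute hS hT.1).isNilpotent_mul_left hT.2⟩

theorem HasLocalCentroid.add_mem_nilpotentCentroid (hV : HasLocalCentroid K V)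
    {S T : Module.End K V} (hS : S ∈ nilpotentCentroid K V) (hT : T ∈ nilpotentCentroid K V) :
    S + T ∈ nilpotentCentroid K V :=
  ⟨add_mem hS.1 hT.1, (hV.commute hS.1 hT.1).isNilpotent_add hS.2 hT.2⟩

theorem smul_mem_nilpotentCentroid (c : K) {T : Module.End K V}
    (hT : T ∈ nilpotentCentroid K V) : c • T ∈ nilpotentCentroid K V :=
  ⟨Subalgebra.smul_mem _ hT.1 c, hT.2.smul c⟩

variable (K V) in
theorem zero_mem_nilpotentCentroid : (0 : Module.End K V) ∈ nilpotentCentroid K V :=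
  ⟨zero_mem _, IsNilpotent.zero⟩

/-- The residue of a centroid element, computed as a normalized trace. -/
noncomputable def centroidResidue (T : Module.End K V) : K :=
  (Module.finrank K V : K)⁻¹ * LinearMap.trace K V T

variable [FiniteDimensional K V] [Nontrivial V] [CharZero K]

/-- The trace of a nilpotent endomorphism vanishes. -/
theorem centroidResidue_eq_of_isNilpotent {T : Module.End K V} {c : K}
    (h : IsNilpotent (T - c • (1 : Module.End K V))) : centroidResidue T = c := by
  have h1 := (LinearMap.isNilpotent_trace_of_isNilpotent h).eq_zero
  rw [map_sub, map_smul, LinearMap.trace_one, sub_eq_zero] at h1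
  have h2 : (Module.finrank K V : K) ≠ 0 := by
    exact_mod_cast (Module.finrank_pos (R := K) (M := V)).ne'
  rw [centroidResidue, h1, smul_eq_mul]
  field_simp

theorem HasLocalCentroid.sub_residue_mem (hV : HasLocalCentroid K V) {T : Module.End K V}
    (hT : T ∈ lieCentroid K V) :
    T - centroidResidue T • (1 : Module.End K V) ∈ nilpotentCentroid K V := by
  obtain ⟨c, hc⟩ := hV.exists_scalar T hT
  rw [centroidResidue_eq_of_isNilpotent hc]
  exact ⟨sub_mem hT (Subalgebra.smul_mem _ (one_mem _) c), hc⟩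

theorem HasLocalCentroid.residue_mul (hV : HasLocalCentroid K V) {S T : Module.End K V}
    (hS : S ∈ lieCentroid K V) (hT : T ∈ lieCentroid K V) :
    centroidResidue (S * T) = centroidResidue S * centroidResidue T := by
  apply centroidResidue_eq_of_isNilpotent
  have h1 := hV.mul_mem_nilpotentCentroid hS (hV.sub_residue_mem hT)
  have h2 := smul_mem_nilpotentCentroid (centroidResidue T) (hV.sub_residue_mem hS)
  have h3 := (hV.add_mem_nilpotentCentroid h1 h2).2
  convert h3 using 1
  rw [mul_sub, smul_sub, mul_smul_comm, mul_one, smul_smul, mul_comm (centroidResidue T)]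
  abel

end CentroidAlgebra

/-! ### The filtration by the nilpotent part of the centroid -/

section NilFiltration

variable (K V : Type*) [Field K] [LieRing V] [LieAlgebra K V]

/-- `J^r V`, where `J` is the set of nilpotent elements of the centroid: the span of the vectors
`T₁ (⋯ (T_r v))` with all `T_i` in `J`. -/
def nilFiltration : ℕ → Submodule K V
  | 0 => ⊤
  | r + 1 => Submodule.span K {w | ∃ T ∈ nilpotentCentroid K V, ∃ v ∈ nilFiltration r, T v = w}

variable {K V} {W : Type*} [LieRing W] [LieAlgebra K W]

theorem apply_mem_nilFiltration_succ {T : Module.End K V} (hT : T ∈ nilpotentCentroid K V) {r : ℕ}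
    {v : V} (hv : v ∈ nilFiltration K V r) : T v ∈ nilFiltration K V (r + 1) :=
  Submodule.subset_span ⟨T, hT, v, hv, rfl⟩

/-- Morphisms between the filtrations: it suffices to intertwine each nilpotent centroid element
with one of the target. -/
theorem map_mem_nilFiltration (f : V →ₗ[K] W)
    (h : ∀ T ∈ nilpotentCentroid K V, ∃ T' ∈ nilpotentCentroid K W, ∀ v : V, f (T v) = T' (f v))
    (r : ℕ) : ∀ v : V, v ∈ nilFiltration K V r → f v ∈ nilFiltration K W r := by
  induction r with
  | zero => intro v _; trivial
  | succ r ih =>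
    have : nilFiltration K V (r + 1) ≤ (nilFiltration K W (r + 1)).comap f := by
      refine Submodule.span_le.2 ?_
      rintro _ ⟨T, hT, v, hv, rfl⟩
      obtain ⟨T', hT', hTT'⟩ := h T hT
      change f (T v) ∈ nilFiltration K W (r + 1)
      rw [hTT']
      exact apply_mem_nilFiltration_succ hT' (ih v hv)
    exact this

theorem equiv_mem_nilFiltration (e : V ≃ₗ⁅K⁆ W) {r : ℕ} {v : V} (hv : v ∈ nilFiltration K V r) :
    e v ∈ nilFiltration K W r :=
  map_mem_nilFiltration (e.toLinearEquiv : V →ₗ[K] W)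
    (fun T hT => ⟨_, conj_mem_nilpotentCentroid e hT, fun v => by
      change e (T v) = e (T (e.symm (e v)))
      rw [LieEquiv.symm_apply_apply]⟩) r v hv

theorem nilFiltration_succ_le (r : ℕ) : nilFiltration K V (r + 1) ≤ nilFiltration K V r := by
  induction r with
  | zero => exact le_top
  | succ r ih =>
    refine Submodule.span_le.2 ?_
    rintro _ ⟨T, hT, v, hv, rfl⟩
    exact apply_mem_nilFiltration_succ hT (ih hv)

theorem nilFiltration_antitone : Antitone (nilFiltration K V) :=
  antitone_nat_of_succ_le nilFiltration_succ_le

/-- The centroid is a commutative Artinian ring, so its nilradical is nilpotent. -/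
theorem HasLocalCentroid.exists_nilFiltration_eq_bot [FiniteDimensional K V]
    (hV : HasLocalCentroid K V) : ∃ s, nilFiltration K V s = ⊥ := by
  let _ : CommRing (lieCentroid K V) :=
    { (inferInstance : Ring (lieCentroid K V)) with
      mul_comm := fun a b => Subtype.ext (hV.commute a.2 b.2) }
  let _ : Algebra K (lieCentroid K V) := (lieCentroid K V).algebra
  have : FiniteDimensional K (lieCentroid K V) :=
    FiniteDimensional.finiteDimensional_submodule (Subalgebra.toSubmodule (lieCentroid K V))
  have : IsArtinianRing (lieCentroid K V) := isArtinian_of_tower K inferInstance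
  obtain ⟨s, hs⟩ := IsArtinianRing.isNilpotent_nilradical (R := lieCentroid K V)
  have key : ∀ r, nilFiltration K V r ≤ Submodule.span K
      {w | ∃ T ∈ nilradical (lieCentroid K V) ^ r, ∃ v, (T : Module.End K V) v = w} := by
    intro r
    induction r with
    | zero =>
      intro v _
      exact Submodule.subset_span ⟨1, by simp, v, rfl⟩
    | succ r ih =>
      refine Submodule.span_le.2 ?_
      rintro _ ⟨T, hT, v, hv, rfl⟩
      have hv' := ih hv
      refine Submodule.span_induction (p := fun v _ => T v ∈ Submodule.span K
        {w | ∃ T ∈ nilradical (lieCentroid K V) ^ (r + 1), ∃ v, (T : Module.End K V) v = w})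
        ?_ ?_ ?_ ?_ hv'
      · rintro _ ⟨S, hS, u, rfl⟩
        refine Submodule.subset_span ⟨⟨T, hT.1⟩ * S, ?_, u, rfl⟩
        rw [pow_succ']
        refine Ideal.mul_mem_mul ?_ hS
        obtain ⟨n, hn⟩ := hT.2
        exact ⟨n, Subtype.ext hn⟩
      · simp
      · intro x y _ _ hx hy
        rw [map_add]; exact add_mem hx hy
      · intro c x _ hx
        rw [map_smul]; exact Submodule.smul_mem _ c hx
  refine ⟨s, eq_bot_iff.2 ((key s).trans (Submodule.span_le.2 ?_))⟩
  rintro _ ⟨T, hT, v, rfl⟩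
  rw [hs] at hT
  have hT0 : T = 0 := by simpa using hT
  simp [hT0]

/-- The filtration decreases strictly until it reaches zero. This bound is the reason why the order of
the differential operator in the normal form is less than the dimension of the fibers. -/
theorem HasLocalCentroid.nilFiltration_eq_bot [FiniteDimensional K V]
    (hV : HasLocalCentroid K V) {r : ℕ} (hr : Module.finrank K V ≤ r) :
    nilFiltration K V r = ⊥ := by
  obtain ⟨s, hs⟩ := hV.exists_nilFiltration_eq_bot
  -- as long as the filtration has not reached zero, it is strictly decreasing
  have hstab : ∀ r, nilFiltration K V (r + 1) = nilFiltration K V r → nilFiltration K V r = ⊥ := by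
    intro r hr
    have : ∀ j, nilFiltration K V (r + j) = nilFiltration K V r := by
      intro j
      induction j with
      | zero => rfl
      | succ j ih => rw [← add_assoc, nilFiltration, ih, ← nilFiltration, hr]
    rw [← this s, eq_bot_iff, ← hs]
    exact nilFiltration_antitone (Nat.le_add_left s r)
  have hdim : ∀ r, nilFiltration K V r = ⊥ ∨
      Module.finrank K (nilFiltration K V r) + r ≤ Module.finrank K V := by
    intro r
    induction r with
    | zero => right; exact (add_zero _).le.trans (Submodule.finrank_le _)
    | succ r ih =>
      by_cases h0 : nilFiltration K V r = ⊥
      · left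
        exact eq_bot_iff.2 (h0 ▸ nilFiltration_succ_le r)
      · right
        have hlt : nilFiltration K V (r + 1) < nilFiltration K V r :=
          lt_of_le_of_ne (nilFiltration_succ_le r) fun h => h0 (hstab r h)
        have := Submodule.finrank_lt_finrank_of_lt hlt
        have := ih.resolve_left h0
        omega
  rcases hdim r with h | h
  · exact h
  · exact Submodule.finrank_eq_zero.1 (by omega)

end NilFiltration

/-! ### Topology and calculus -/

section SigmaCompact

open Topology Filter

/-- A connected paracompact locally compact Hausdorff space is `σ`-compact: starting from a point,
keep adding the members of a locally finite cover by relatively compact open sets that meet the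
compact set reached so far; the union of these compact sets is open and closed. -/
theorem sigmaCompactSpace_of_connected_paracompact (X : Type*) [TopologicalSpace X] [T2Space X]
    [ParacompactSpace X] [ConnectedSpace X] [LocallyCompactSpace X] : SigmaCompactSpace X := by
  choose C hC hCx using fun x : X => exists_compact_mem_nhds x
  obtain ⟨U, hUo, hUcov, hUfin, hUC⟩ := precise_refinement (fun x => interior (C x))
    (fun x => isOpen_interior)
    (eq_univ_of_forall fun x => mem_iUnion.2 ⟨x, mem_interior_iff_mem_nhds.2 (hCx x)⟩)
  have hUcl : ∀ i, IsCompact (closure (U i)) := fun i =>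
    (hC i).of_isClosed_subset isClosed_closure
      (closure_minimal ((hUC i).trans interior_subset) (hC i).isClosed)
  let step : Set X → Set X := fun S => ⋃ i ∈ {i | (U i ∩ S).Nonempty}, closure (U i)
  let x₀ : X := Classical.arbitrary X
  let S : ℕ → Set X := fun n => step^[n] {x₀}
  have hS_succ : ∀ n, S (n + 1) = step (S n) := fun n => Function.iterate_succ_apply' step n _
  have hScomp : ∀ n, IsCompact (S n) := by
    intro n
    induction n with
    | zero => exact isCompact_singleton
    | succ n ih =>
      rw [hS_succ]
      exact (hUfin.finite_nonempty_inter_compact ih).isCompact_biUnion fun i _ => hUcl i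
  have hU_sub : ∀ n i, (U i ∩ S n).Nonempty → U i ⊆ S (n + 1) := by
    intro n i hi
    rw [hS_succ]
    exact subset_closure.trans (subset_biUnion_of_mem (u := fun i => closure (U i)) hi)
  have hcov : ∀ x, ∃ i, x ∈ U i := fun x => mem_iUnion.1 (hUcov ▸ mem_univ x)
  have hclopen : IsClopen (⋃ n, S n) := by
    constructor
    · rw [← closure_subset_iff_isClosed]
      intro y hy
      obtain ⟨i, hi⟩ := hcov y
      obtain ⟨z, hzU, hzS⟩ := mem_closure_iff.1 hy (U i) (hUo i) hi
      obtain ⟨n, hn⟩ := mem_iUnion.1 hzS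
      exact mem_iUnion.2 ⟨n + 1, hU_sub n i ⟨z, hzU, hn⟩ hi⟩
    · rw [isOpen_iff_mem_nhds]
      intro y hy
      obtain ⟨n, hn⟩ := mem_iUnion.1 hy
      obtain ⟨i, hi⟩ := hcov y
      filter_upwards [(hUo i).mem_nhds hi] with z hz
      exact mem_iUnion.2 ⟨n + 1, hU_sub n i ⟨y, hi, hn⟩ hz⟩
  refine ⟨⟨S, hScomp, hclopen.eq_univ ⟨x₀, mem_iUnion.2 ⟨0, mem_singleton x₀⟩⟩⟩⟩

end SigmaCompact

section SignedPower

open Topology Filter Asymptotics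

theorem hasDerivAt_abs_mul_pow_succ (k : ℕ) (t : ℝ) :
    HasDerivAt (fun t : ℝ => |t| * t ^ (k + 1)) ((k + 2) * (|t| * t ^ k)) t := by
  rcases eq_or_ne t 0 with rfl | ht
  · rw [hasDerivAt_iff_isLittleO_nhds_zero]
    simp only [zero_add, abs_zero, zero_mul, sub_zero, mul_zero, smul_zero]
    have h1 : (fun t : ℝ => |t| * t ^ (k + 1)) = fun t => (|t| * t ^ k) * t := by
      ext t; ring
    rw [h1]
    have h2 : (fun t : ℝ => |t| * t ^ k) =o[𝓝 0] (fun _ => (1 : ℝ)) := by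
      rw [isLittleO_one_iff]
      have : Continuous fun t : ℝ => |t| * t ^ k := by fun_prop
      simpa using this.tendsto 0
    simpa using h2.mul_isBigO (isBigO_refl (fun t : ℝ => t) (𝓝 0))
  · have h := (hasDerivAt_abs ht).mul (hasDerivAt_pow (k + 1) t)
    refine HasDerivAt.congr_deriv (f := fun t : ℝ => |t| * t ^ (k + 1)) h ?_
    rcases lt_or_gt_of_ne ht with h0 | h0
    · rw [abs_of_neg h0, sign_neg h0]; push_cast; simp; ring
    · rw [abs_of_pos h0, sign_pos h0]; push_cast; simp; ring

/-- The derivative of `|t| t^{k+1}` is `(k + 2) |t| t^k`, so the class of differentiability goes up by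
one with each step; it is exactly `C^k`, by `not_contDiffAt_abs_mul_pow`. -/
theorem contDiff_abs_mul_pow (k : ℕ) : ContDiff ℝ k fun t : ℝ => |t| * t ^ k := by
  induction k with
  | zero => exact contDiff_zero.2 (by fun_prop)
  | succ k ih =>
    push_cast
    rw [contDiff_succ_iff_deriv]
    refine ⟨fun t => (hasDerivAt_abs_mul_pow_succ k t).differentiableAt, by simp, ?_⟩
    have : deriv (fun t : ℝ => |t| * t ^ (k + 1)) = fun t : ℝ => ((k : ℝ) + 2) * (|t| * t ^ k) :=
      funext fun t => (hasDerivAt_abs_mul_pow_succ k t).deriv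
    rw [this]
    exact contDiff_const.mul ih

theorem contDiffAt_deriv_of_succ {j : ℕ} {g : ℝ → ℝ} {t : ℝ}
    (hg : ContDiffAt ℝ ((j + 1 : ℕ) + 1) g t) : ContDiffAt ℝ (j + 1) (deriv g) t := by
  have h : ContDiffAt ℝ (j + 1) (fderiv ℝ g) t := hg.fderiv_right (by push_cast; exact le_rfl)
  exact h.clm_apply contDiffAt_const

/-- A function of the form `|g| g^j` is not of class `C^{j+1}` at a simple zero of `g`. -/
theorem not_contDiffAt_abs_mul_pow (j : ℕ) : ∀ {g h : ℝ → ℝ}, ContDiffAt ℝ (j + 1) g 0 →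
    ContDiffAt ℝ (j + 1) h 0 → g 0 = 0 → deriv g 0 ≠ 0 →
    (∀ᶠ t in 𝓝[≠] 0, h t = |g t| * g t ^ j) → False := by
  induction j with
  | zero =>
    intro g h hg hh hg0 hg' heq
    have hgc := hg.continuousAt
    have hhc := hh.continuousAt
    have hgd : HasDerivAt g (deriv g 0) 0 := (hg.differentiableAt (by simp)).hasDerivAt
    have hhd : HasDerivAt h (deriv h 0) 0 := (hh.differentiableAt (by simp)).hasDerivAt
    have h0 : h 0 = 0 := by
      have h1 : Tendsto h (𝓝[≠] 0) (𝓝 (h 0)) := hhc.tendsto.mono_left nhdsWithin_le_nhds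
      have h2 : Tendsto (fun t => |g t| * g t ^ 0) (𝓝[≠] 0) (𝓝 (|g 0| * g 0 ^ 0)) :=
        ((hgc.abs.mul (hgc.pow 0)).tendsto).mono_left nhdsWithin_le_nhds
      have h3 := tendsto_nhds_unique (h1.congr' heq) h2
      simpa [hg0] using h3
    have heq' : ∀ᶠ t in 𝓝 0, h t = |g t| := by
      rw [eventually_nhdsWithin_iff] at heq
      filter_upwards [heq] with t ht
      rcases eq_or_ne t 0 with rfl | hne
      · simp [h0, hg0]
      · simpa using ht hne
    -- `h = |g|` has a minimum at `0`, so that `h'(0) = 0` and `g = o(t)`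
    have hmin : IsLocalMin h 0 := by
      filter_upwards [heq'] with t ht
      rw [h0, ht]; exact abs_nonneg _
    rw [hmin.deriv_eq_zero, hasDerivAt_iff_isLittleO_nhds_zero] at hhd
    have hgd0 : HasDerivAt g 0 0 := by
      rw [hasDerivAt_iff_isLittleO_nhds_zero]
      simp only [zero_add, hg0, sub_zero, smul_zero, h0] at hhd ⊢
      have h1 : (fun t => ‖g t‖) =o[𝓝 0] fun t => t :=
        (isLittleO_congr heq' (EventuallyEq.refl _ _)).1 hhd
      exact h1.of_norm_left
    exact hg' (hgd.unique hgd0)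
  | succ j ih =>
    intro g h hg hh hg0 hg' heq
    have hgd : HasDerivAt g (deriv g 0) 0 := (hg.differentiableAt (by simp)).hasDerivAt
    have hg1 : ContDiffAt ℝ (j + 1) (deriv g) 0 :=
      contDiffAt_deriv_of_succ hg
    have hh1 : ContDiffAt ℝ (j + 1) (deriv h) 0 :=
      contDiffAt_deriv_of_succ hh
    refine ih (g := g) (h := fun t => deriv h t / ((j + 2) * deriv g t))
      (hg.of_le (by push_cast; exact_mod_cast Nat.le_succ _))
      (hh1.div (contDiffAt_const.mul hg1) ?_) hg0 hg' ?_
    · exact mul_ne_zero (by positivity) hg'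
    have hne : ∀ᶠ t in 𝓝[≠] 0, g t ≠ 0 := by
      simpa [hg0] using hgd.eventually_ne hg'
    have hgdiff : ∀ᶠ t in 𝓝[≠] (0 : ℝ), DifferentiableAt ℝ g t :=
      ((hg.eventually (by simp)).mono
        fun t ht => ht.differentiableAt (by simp)).filter_mono nhdsWithin_le_nhds
    have hg'ne : ∀ᶠ t in 𝓝[≠] (0 : ℝ), deriv g t ≠ 0 :=
      (hg1.continuousAt.eventually_ne hg').filter_mono nhdsWithin_le_nhds
    have heq2 : ∀ᶠ t in 𝓝[≠] (0 : ℝ), ∀ᶠ s in 𝓝 t, h s = |g s| * g s ^ (j + 1) := by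
      rw [eventually_nhdsWithin_iff] at heq ⊢
      filter_upwards [eventually_eventually_nhds.2 heq] with t ht hne
      filter_upwards [ht, isOpen_ne.mem_nhds hne] with s hs hs0
      exact hs hs0
    filter_upwards [hne, hgdiff, hg'ne, heq2] with t h1 h2 h3 h4
    have h5 : HasDerivAt h ((j + 2) * (|g t| * g t ^ j) * deriv g t) t :=
      ((hasDerivAt_abs_mul_pow_succ j (g t)).comp t h2.hasDerivAt).congr_of_eventuallyEq h4
    have h6 : ((j : ℝ) + 2) ≠ 0 := by positivity
    rw [h5.deriv]
    field_simp

end SignedPower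

section Hadamard

open Topology Filter MeasureTheory

universe u

/-- Differentiation under the integral sign over `[0, 1]`, iterated. -/
theorem contDiff_nat_intervalIntegral {D : Type} [NormedAddCommGroup D] [NormedSpace ℝ D]
    [FiniteDimensional ℝ D] (n : ℕ) : ∀ {F : Type u} [NormedAddCommGroup F] [NormedSpace ℝ F]
    [CompleteSpace F] {G : D × ℝ → F}, ContDiff ℝ ∞ G →
    ContDiff ℝ n fun y => ∫ t in (0 : ℝ)..1, G (y, t) := by
  induction n with
  | zero =>
    intro F _ _ _ G hG
    exact contDiff_zero.2
      (intervalIntegral.continuous_parametric_intervalIntegral_of_continuous'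
        (f := fun y t => G (y, t)) hG.continuous 0 1)
  | succ n ih =>
    intro F _ _ _ G hG
    let G' : D × ℝ → (D →L[ℝ] F) := fun p => (fderiv ℝ G p).comp (ContinuousLinearMap.inl ℝ D ℝ)
    have hG' : ContDiff ℝ ∞ G' := (hG.fderiv_right (by simp)).clm_comp contDiff_const
    have hder : ∀ y t, HasFDerivAt (fun y => G (y, t)) (G' (y, t)) y := by
      intro y t
      have h1 : HasFDerivAt G (fderiv ℝ G (y, t)) (y, t) :=
        (hG.differentiable (by simp) _).hasFDerivAt
      exact h1.comp y (hasFDerivAt_prodMk_left y t)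
    have : SecondCountableTopologyEither ℝ (D →L[ℝ] F) := secondCountableTopologyEither_of_left ℝ _
    have key : ∀ y, HasFDerivAt (fun y => ∫ t in (0 : ℝ)..1, G (y, t))
        (∫ t in (0 : ℝ)..1, G' (y, t)) y := by
      intro y
      obtain ⟨C, hC⟩ := ((isCompact_closedBall y 1).prod (isCompact_Icc (a := (0 : ℝ)) (b := 1))
        ).exists_bound_of_continuousOn hG'.continuous.continuousOn
      refine intervalIntegral.hasFDerivAt_integral_of_dominated_of_fderiv_le
        (F := fun y t => G (y, t)) (F' := fun y t => G' (y, t)) (bound := fun _ => C)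
        (Metric.closedBall_mem_nhds y one_pos) ?_ ?_ ?_ ?_ ?_ ?_
      · refine Eventually.of_forall fun z => Continuous.aestronglyMeasurable ?_
        exact hG.continuous.comp (by fun_prop)
      · refine Continuous.intervalIntegrable ?_ 0 1
        exact hG.continuous.comp (by fun_prop)
      · refine Continuous.aestronglyMeasurable ?_
        exact hG'.continuous.comp (by fun_prop)
      · refine Eventually.of_forall fun t ht x hx => hC (x, t) ⟨hx, ?_⟩
        rw [uIoc_of_le zero_le_one] at ht
        exact Ioc_subset_Icc_self ht
      · exact continuous_const.intervalIntegrable 0 1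
      · exact Eventually.of_forall fun t _ x _ => hder x t
    push_cast
    rw [contDiff_succ_iff_hasFDerivAt]
    exact ⟨_, ih hG', key⟩

/-- Hadamard's lemma: a smooth function that vanishes at a point is a combination of the
coordinates at this point, with smooth coefficients. -/
theorem exists_eq_add_sum_sub_smul {m : ℕ} {F : Type u} [NormedAddCommGroup F] [NormedSpace ℝ F]
    [CompleteSpace F] {f : EuclideanSpace ℝ (Fin m) → F} (hf : ContDiff ℝ ∞ f)
    (a : EuclideanSpace ℝ (Fin m)) : ∃ g : Fin m → EuclideanSpace ℝ (Fin m) → F,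
      (∀ i, ContDiff ℝ ∞ (g i)) ∧ ∀ y, f y = f a + ∑ i, (y i - a i) • g i y := by
  let G : Fin m → EuclideanSpace ℝ (Fin m) × ℝ → F := fun i p =>
    fderiv ℝ f (a + p.2 • (p.1 - a)) (EuclideanSpace.single i 1)
  have hG : ∀ i, ContDiff ℝ ∞ (G i) := by
    intro i
    refine ContDiff.clm_apply ?_ contDiff_const
    exact (hf.fderiv_right (by simp)).comp (by fun_prop)
  refine ⟨fun i y => ∫ t in (0 : ℝ)..1, G i (y, t),
    fun i => contDiff_infty.2 fun n => contDiff_nat_intervalIntegral n (hG i), fun y => ?_⟩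
  have hline : ∀ t : ℝ, HasDerivAt (fun t : ℝ => f (a + t • (y - a)))
      (∑ i, (y i - a i) • G i (y, t)) t := by
    intro t
    have h1 : HasDerivAt (fun t : ℝ => a + t • (y - a)) (y - a) t := by
      simpa using ((hasDerivAt_id t).smul_const (y - a)).const_add a
    have h2 := ((hf.differentiable (by simp) (a + t • (y - a))).hasFDerivAt).comp_hasDerivAt t h1
    refine HasDerivAt.congr_deriv (f := fun t : ℝ => f (a + t • (y - a))) h2 ?_
    have h3 : y - a = ∑ i, (y i - a i) • EuclideanSpace.single i (1 : ℝ) := by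
      ext j
      simp [Finset.sum_apply, Pi.single_apply]
    conv_lhs => rw [h3, map_sum]
    simp only [map_smul, G, ← h3]
  have hint := intervalIntegral.integral_eq_sub_of_hasDerivAt (a := 0) (b := 1)
    (fun t _ => hline t) (Continuous.intervalIntegrable (by
      refine continuous_finsetSum _ fun i _ => continuous_const.smul ?_
      exact (hG i).continuous.comp (by fun_prop)) 0 1)
  rw [intervalIntegral.integral_finsetSum fun i _ => Continuous.intervalIntegrable
    (show Continuous fun t : ℝ => (y i - a i) • G i (y, t) from
      continuous_const.smul ((hG i).continuous.comp (by fun_prop))) 0 1] at hint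
  simp only [intervalIntegral.integral_smul, one_smul, zero_smul, add_zero] at hint
  rw [hint]
  simp

end Hadamard

/-! ### Functions and sections of class `C^k` -/

section Bilinear

variable {m : ℕ} {M : Type*} [TopologicalSpace M] [ChartedSpace (EuclideanSpace ℝ (Fin m)) M]
  {V₁ V₂ V₃ : Type*} [NormedAddCommGroup V₁] [NormedSpace ℝ V₁] [FiniteDimensional ℝ V₁]
  [NormedAddCommGroup V₂] [NormedSpace ℝ V₂] [FiniteDimensional ℝ V₂]
  [NormedAddCommGroup V₃] [NormedSpace ℝ V₃]

theorem contMDiffWithinAt_linear (T : V₁ →ₗ[ℝ] V₂) {k : ℕ∞ω} {f : M → V₁} {s : Set M} {x : M}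
    (hf : ContMDiffWithinAt (𝓡 m) 𝓘(ℝ, V₁) k f s x) :
    ContMDiffWithinAt (𝓡 m) 𝓘(ℝ, V₂) k (fun y => T (f y)) s x :=
  (LinearMap.toContinuousLinearMap T).contDiff.contDiffAt.contMDiffAt.comp_contMDiffWithinAt x hf

theorem contMDiffWithinAt_bilinear (B : V₁ →ₗ[ℝ] V₂ →ₗ[ℝ] V₃) {k : ℕ∞ω} {f : M → V₁}
    {g : M → V₂} {s : Set M} {x : M} (hf : ContMDiffWithinAt (𝓡 m) 𝓘(ℝ, V₁) k f s x)
    (hg : ContMDiffWithinAt (𝓡 m) 𝓘(ℝ, V₂) k g s x) :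
    ContMDiffWithinAt (𝓡 m) 𝓘(ℝ, V₃) k (fun y => B (f y) (g y)) s x := by
  have hB : ContDiff ℝ k (fun p : V₁ × V₂ => B p.1 p.2) := by
    let B' : V₁ →L[ℝ] V₂ →L[ℝ] V₃ :=
      LinearMap.toContinuousLinearMap
        ((LinearMap.toContinuousLinearMap : (V₂ →ₗ[ℝ] V₃) ≃ₗ[ℝ] (V₂ →L[ℝ] V₃)).toLinearMap ∘ₗ B)
    exact B'.isBoundedBilinearMap.contDiff
  exact hB.contDiffAt.contMDiffAt.comp_contMDiffWithinAt x (hf.prodMk_space hg)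

end Bilinear

section Functions

variable (K : Type*) [RCLike K] (m : ℕ) (M : Type*) [TopologicalSpace M]
  [ChartedSpace (EuclideanSpace ℝ (Fin m)) M]

/-- The `K`-algebra of `K`-valued functions of class `C^k`. -/
def ckFunctions (k : ℕ∞) : Subalgebra K (M → K) where
  carrier := {f | ContMDiff (𝓡 m) 𝓘(ℝ, K) k f}
  mul_mem' hf hg x := contMDiffWithinAt_bilinear (LinearMap.mul ℝ K) (hf x) (hg x)
  add_mem' hf hg := ContMDiff.add hf hg
  algebraMap_mem' _ := contMDiff_const

variable {K m M}

theorem mem_ckFunctions {k : ℕ∞} {f : M → K} :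
    f ∈ ckFunctions K m M k ↔ ContMDiff (𝓡 m) 𝓘(ℝ, K) k f := Iff.rfl

theorem ofReal_comp_mem_ckFunctions {k : ℕ∞} {f : M → ℝ} (hf : ContMDiff (𝓡 m) 𝓘(ℝ, ℝ) k f) :
    (fun x => (f x : K)) ∈ ckFunctions K m M k := fun x =>
  contMDiffWithinAt_linear (Algebra.linearMap ℝ K) (hf x)

variable [IsManifold (𝓡 m) ∞ M] [T2Space M]

open Topology

/-- Smooth bump functions, as real-valued functions. -/
theorem exists_bump (x : M) {V : Set M} (hV : V ∈ 𝓝 x) : ∃ b : M → ℝ,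
    ContMDiff (𝓡 m) 𝓘(ℝ, ℝ) ∞ b ∧ (∀ᶠ y in 𝓝 x, b y = 1) ∧ tsupport b ⊆ V := by
  obtain ⟨f, hf, -⟩ := (SmoothBumpFunction.nhds_basis_support (I := 𝓡 m) hV).mem_iff.1 hV
  exact ⟨f, f.contMDiff, f.eventuallyEq_one, hf⟩

theorem exists_ckFunctions_bump (k : ℕ∞) (x : M) {V : Set M} (hV : V ∈ 𝓝 x) :
    ∃ b : ckFunctions K m M k, (∀ᶠ y in 𝓝 x, b.1 y = 1) ∧ ∀ y ∉ V, b.1 y = 0 := by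
  obtain ⟨b, hb, hb1, hbV⟩ := exists_bump (m := m) x hV
  refine ⟨⟨_, ofReal_comp_mem_ckFunctions (hb.of_le (mod_cast le_top))⟩, ?_, ?_⟩
  · filter_upwards [hb1] with y hy
    simp [hy]
  · intro y hy
    simp [image_eq_zero_of_notMem_tsupport fun h => hy (hbV h)]

/-- Germs of functions of class `C^k` extend to the whole manifold. -/
theorem exists_contMDiff_eventuallyEq {G : Type*} [NormedAddCommGroup G] [NormedSpace ℝ G]
    {k : ℕ∞} {x : M} {f : M → G} {V : Set M} (hV : V ∈ 𝓝 x)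
    (hf : ContMDiffOn (𝓡 m) 𝓘(ℝ, G) k f V) :
    ∃ g : M → G, ContMDiff (𝓡 m) 𝓘(ℝ, G) k g ∧ ∀ᶠ y in 𝓝 x, g y = f y := by
  obtain ⟨b, hb, hb1, hbV⟩ := exists_bump (m := m) x (interior_mem_nhds.2 hV)
  refine ⟨fun y => b y • f y, contMDiff_of_tsupport fun y hy => ?_, ?_⟩
  · have hyV : V ∈ 𝓝 y := mem_interior_iff_mem_nhds.1
      (hbV (tsupport_smul_subset_left b f hy))
    exact ((hb.of_le (mod_cast le_top)) y).smul ((hf y (mem_of_mem_nhds hyV)).contMDiffAt hyV)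
  · filter_upwards [hb1] with y hy
    simp [hy]

theorem exists_ckFunctions_eventuallyEq {k : ℕ∞} {x : M} {f : M → K} {V : Set M} (hV : V ∈ 𝓝 x)
    (hf : ContMDiffOn (𝓡 m) 𝓘(ℝ, K) k f V) :
    ∃ g : ckFunctions K m M k, ∀ᶠ y in 𝓝 x, g.1 y = f y :=
  let ⟨g, hg, hgf⟩ := exists_contMDiff_eventuallyEq hV hf
  ⟨⟨g, hg⟩, hgf⟩

end Functions

section Sections

open Topology

variable {K : Type*} [RCLike K] {m : ℕ} {M : Type*} [TopologicalSpace M]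
  [ChartedSpace (EuclideanSpace ℝ (Fin m)) M]
  {F : Type*} [NormedLieRing F] [NormedSpace ℝ F] [LieAlgebra K F] [IsScalarTower ℝ K F]
  [FiniteDimensional K F]
  {L : M → Type*} [∀ x, LieRing (L x)] [∀ x, LieAlgebra K (L x)] [∀ x, Module ℝ (L x)]
  [∀ x, IsScalarTower ℝ K (L x)]
  [∀ x, TopologicalSpace (L x)] [TopologicalSpace (TotalSpace F L)]
  [FiberBundle F L] [VectorBundle ℝ F L] [ContMDiffVectorBundle ∞ F L (𝓡 m)]
  [IsLieAlgebraBundle K F L]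

variable (K F) in
/-- Multiplication by scalars of `K`, as a real bilinear map. -/
noncomputable def realSMul : K →ₗ[ℝ] F →ₗ[ℝ] F :=
  LinearMap.mk₂ ℝ (fun c v => c • v) (fun a b v => add_smul a b v) (fun r c v => smul_assoc r c v)
    (fun c v w => smul_add c v w) (fun r c v => by
      rw [← algebraMap_smul K r v, ← algebraMap_smul K r (c • v), smul_comm])

theorem finiteDimensional_real (K : Type*) [RCLike K] (F : Type*) [NormedLieRing F]
    [NormedSpace ℝ F] [LieAlgebra K F] [IsScalarTower ℝ K F] [FiniteDimensional K F] :
    FiniteDimensional ℝ F :=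
  FiniteDimensional.trans ℝ K F

theorem contMDiffWithinAt_real_smul {k : ℕ∞ω} {f : M → K} {g : M → F} {s : Set M} {x : M}
    (hf : ContMDiffWithinAt (𝓡 m) 𝓘(ℝ, K) k f s x)
    (hg : ContMDiffWithinAt (𝓡 m) 𝓘(ℝ, F) k g s x) :
    ContMDiffWithinAt (𝓡 m) 𝓘(ℝ, F) k (fun y => f y • g y) s x :=
  have : FiniteDimensional ℝ F := finiteDimensional_real K F
  contMDiffWithinAt_bilinear (realSMul K F) hf hg

variable (K) in
/-- A chart of a bundle of Lie algebras, as an isomorphism of a fiber with the typical fiber. -/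
noncomputable def chartLieEquiv (e : Trivialization F (TotalSpace.proj : TotalSpace F L → M))
    (he : e ∈ FiberBundle.trivializationAtlas F L) {x : M} (hx : x ∈ e.baseSet) :
    L x ≃ₗ⁅K⁆ F :=
  haveI : MemTrivializationAtlas e := ⟨he⟩
  let E := e.linearEquivAt ℝ x hx
  { toFun := fun v => (e ⟨x, v⟩).2
    map_add' := E.map_add
    map_smul' := fun c v => IsLieAlgebraBundle.chart_smul e he x hx c v
    map_lie' := fun {v w} => IsLieAlgebraBundle.chart_lie K e he x hx v w
    invFun := E.symm
    left_inv := E.left_inv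
    right_inv := E.right_inv }

theorem localForm_eq {e : Trivialization F (TotalSpace.proj : TotalSpace F L → M)}
    (he : e ∈ FiberBundle.trivializationAtlas F L) {x : M} (hx : x ∈ e.baseSet) (A : ∀ x, L x) :
    localForm e A x = chartLieEquiv K e he hx (A x) := rfl

theorem contMDiffAt_section_iff_localForm {k : ℕ∞}
    {e : Trivialization F (TotalSpace.proj : TotalSpace F L → M)}
    (he : e ∈ FiberBundle.trivializationAtlas F L) {x : M} (hx : x ∈ e.baseSet) {X : ∀ x, L x} :
    ContMDiffAt (𝓡 m) ((𝓡 m).prod 𝓘(ℝ, F)) k (fun x => TotalSpace.mk' F x (X x)) x ↔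
      ContMDiffAt (𝓡 m) 𝓘(ℝ, F) k (localForm e X) x := by
  have : MemTrivializationAtlas e := ⟨he⟩
  have : ContMDiffVectorBundle k F L (𝓡 m) := .of_le (n := ∞) (mod_cast le_top)
  exact e.contMDiffAt_section_iff hx

theorem contMDiffOn_localForm {k : ℕ∞} (X : ckSections K m F L k)
    {e : Trivialization F (TotalSpace.proj : TotalSpace F L → M)}
    (he : e ∈ FiberBundle.trivializationAtlas F L) :
    ContMDiffOn (𝓡 m) 𝓘(ℝ, F) k (localForm e X.1) e.baseSet := fun x hx =>
  ((contMDiffAt_section_iff_localForm he hx).1 (X.2 x)).contMDiffWithinAt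

theorem smul_mem_ckSections {k : ℕ∞} {f : M → K} (hf : f ∈ ckFunctions K m M k) {X : ∀ x, L x}
    (hX : X ∈ ckSections K m F L k) : (fun x => f x • X x) ∈ ckSections K m F L k := by
  intro x
  have hx := FiberBundle.mem_baseSet_trivializationAt F L x
  have he := FiberBundle.trivialization_mem_atlas F L x
  refine (contMDiffAt_section_iff_localForm he hx).2 ?_
  refine ContMDiffAt.congr_of_eventuallyEq
    (f := fun y => f y • localForm (trivializationAt F L x) X y) ?_ ?_
  · exact contMDiffWithinAt_real_smul (hf x) ((contMDiffAt_section_iff_localForm he hx).1 (hX x))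
  · filter_upwards [(trivializationAt F L x).open_baseSet.mem_nhds hx] with y hy
    exact IsLieAlgebraBundle.chart_smul _ he y hy (f y) (X y)

variable (F L) in
/-- The multiplication of sections by functions. -/
def smulOp (k : ℕ∞) : ckFunctions K m M k →ₐ[K] Module.End K (ckSections K m F L k) where
  toFun f :=
    { toFun := fun X => ⟨fun x => f.1 x • X.1 x, smul_mem_ckSections f.2 X.2⟩
      map_add' := fun _ _ => Subtype.ext (funext fun _ => smul_add _ _ _)
      map_smul' := fun _ _ => Subtype.ext (funext fun _ => smul_comm _ _ _) }
  map_one' := LinearMap.ext fun _ => Subtype.ext (funext fun _ => one_smul _ _)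
  map_mul' _ _ := LinearMap.ext fun _ => Subtype.ext (funext fun _ => mul_smul _ _ _)
  map_zero' := LinearMap.ext fun _ => Subtype.ext (funext fun _ => zero_smul _ _)
  map_add' _ _ := LinearMap.ext fun _ => Subtype.ext (funext fun _ => add_smul _ _ _)
  commutes' _ := LinearMap.ext fun _ => Subtype.ext (funext fun _ => rfl)

theorem smulOp_apply {k : ℕ∞} (f : ckFunctions K m M k) (X : ckSections K m F L k) (x : M) :
    (smulOp F L k f X).1 x = f.1 x • X.1 x := rfl

theorem lie_apply_section {k : ℕ∞} (X Y : ckSections K m F L k) (x : M) :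
    ⁅X, Y⁆.1 x = ⁅X.1 x, Y.1 x⁆ := rfl

theorem smulOp_mem_lieCentroid {k : ℕ∞} (f : ckFunctions K m M k) :
    smulOp F L k f ∈ lieCentroid K (ckSections K m F L k) := fun X Y =>
  Subtype.ext (funext fun x => (lie_smul (f.1 x) (X.1 x) (Y.1 x)).symm)

variable [IsManifold (𝓡 m) ∞ M] [T2Space M]

/-- A local section given in a bundle chart agrees near each point with a global section. -/
theorem exists_section_eventuallyEq {k : ℕ∞}
    {e : Trivialization F (TotalSpace.proj : TotalSpace F L → M)}
    (he : e ∈ FiberBundle.trivializationAtlas F L) {x : M} (hx : x ∈ e.baseSet) {u : M → F}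
    {V : Set M} (hV : V ∈ 𝓝 x) (hu : ContMDiffOn (𝓡 m) 𝓘(ℝ, F) k u V) :
    ∃ X : ckSections K m F L k, ∀ᶠ y in 𝓝 x, localForm e X.1 y = u y := by
  have : MemTrivializationAtlas e := ⟨he⟩
  have : ContMDiffVectorBundle k F L (𝓡 m) := .of_le (n := ∞) (mod_cast le_top)
  have hW : interior V ∩ e.baseSet ∈ 𝓝 x :=
    Filter.inter_mem (interior_mem_nhds.2 hV) (e.open_baseSet.mem_nhds hx)
  obtain ⟨b, hb, hb1, hbV⟩ := exists_bump (m := m) x hW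
  let s : ∀ y, L y := fun y => e.symm y (u y)
  have hloc : ∀ y ∈ e.baseSet, localForm e s y = u y := fun y hy =>
    congrArg Prod.snd (e.apply_mk_symm hy (u y))
  have hs : ContMDiffOn (𝓡 m) ((𝓡 m).prod 𝓘(ℝ, F)) k (fun y => TotalSpace.mk' F y (s y))
      (interior V ∩ e.baseSet) := by
    rintro y ⟨hyV, hye⟩
    have hyV' := mem_interior_iff_mem_nhds.1 hyV
    refine ContMDiffAt.contMDiffWithinAt ((contMDiffAt_section_iff_localForm he hye).2 ?_)
    refine ((hu y (mem_of_mem_nhds hyV')).contMDiffAt hyV').congr_of_eventuallyEq ?_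
    filter_upwards [e.open_baseSet.mem_nhds hye] with z hz using hloc z hz
  refine ⟨⟨_, ContMDiffOn.smul_section_of_tsupport
    (hb.of_le (mod_cast le_top)).contMDiffOn (isOpen_interior.inter e.open_baseSet) hbV hs⟩, ?_⟩
  filter_upwards [hb1, e.open_baseSet.mem_nhds hx] with y hy hye
  have h1 : (b • s) y = s y := by simp [hy]
  change (e ⟨y, (b • s) y⟩).2 = u y
  rw [h1]
  exact hloc y hye

theorem exists_section_eventuallyEq_const (k : ℕ∞)
    {e : Trivialization F (TotalSpace.proj : TotalSpace F L → M)}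
    (he : e ∈ FiberBundle.trivializationAtlas F L) {x : M} (hx : x ∈ e.baseSet) (v : F) :
    ∃ X : ckSections K m F L k, ∀ᶠ y in 𝓝 x, localForm e X.1 y = v :=
  exists_section_eventuallyEq he hx Filter.univ_mem contMDiffOn_const

theorem eventually_eq_iff_localForm {e : Trivialization F (TotalSpace.proj : TotalSpace F L → M)}
    (he : e ∈ FiberBundle.trivializationAtlas F L) {x : M} (hx : x ∈ e.baseSet)
    {X Y : ∀ x, L x} : (∀ᶠ y in 𝓝 x, X y = Y y) ↔ ∀ᶠ y in 𝓝 x, localForm e X y = localForm e Y y := by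
  have : MemTrivializationAtlas e := ⟨he⟩
  refine Filter.eventually_congr ?_
  filter_upwards [e.open_baseSet.mem_nhds hx] with y hy
  exact (e.linearEquivAt ℝ y hy).injective.eq_iff.symm

variable (m F) in
/-- The evaluation of sections at a point. -/
def evalAt (k : ℕ∞) (x : M) : ckSections K m F L k →ₗ[K] L x where
  toFun X := X.1 x
  map_add' _ _ := rfl
  map_smul' _ _ := rfl

theorem evalAt_apply {k : ℕ∞} (x : M) (X : ckSections K m F L k) :
    evalAt m F k x X = X.1 x := rfl

variable (K m F) in
theorem exists_section_apply_eq (k : ℕ∞) (x : M) (v : L x) :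
    ∃ X : ckSections K m F L k, X.1 x = v := by
  have hx := FiberBundle.mem_baseSet_trivializationAt F L x
  have he := FiberBundle.trivialization_mem_atlas F L x
  obtain ⟨X, hX⟩ := exists_section_eventuallyEq_const (K := K) (m := m) k he hx
    (chartLieEquiv K _ he hx v)
  exact ⟨X, (chartLieEquiv K _ he hx).injective hX.self_of_nhds⟩

theorem range_evalAt (k : ℕ∞) (x : M) :
    LinearMap.range (evalAt m F k x : ckSections K m F L k →ₗ[K] L x) = ⊤ :=
  LinearMap.range_eq_top.2 fun v => exists_section_apply_eq K m F k x v

end Sections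

/-! ### Finitely many sections spanning all fibers -/

section SpanningTuples

open Topology

variable {F : Type*} [NormedAddCommGroup F] [NormedSpace ℝ F] [FiniteDimensional ℝ F]

/-- A tuple spans iff some square subfamily is linearly independent, which is an open condition. -/
theorem isOpen_setOf_span_eq_top (r : ℕ) :
    IsOpen {w : Fin r → F | Submodule.span ℝ (range w) = ⊤} := by
  have h : {w : Fin r → F | Submodule.span ℝ (range w) = ⊤} =
      ⋃ a : Fin (Module.finrank ℝ F) → Fin r, {w | LinearIndependent ℝ (w ∘ a)} := by
    ext w
    simp only [mem_ofPred_eq, mem_iUnion]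
    constructor
    · intro hw
      obtain ⟨κ, a, ha, hspan, hli⟩ := exists_linearIndependent' ℝ w
      rw [hw] at hspan
      have : Fintype κ := Fintype.ofInjective a ha
      have hcard : Fintype.card κ = Module.finrank ℝ F := by
        rw [Module.finrank_eq_card_basis (Module.Basis.mk hli hspan.ge)]
      let c : Fin (Module.finrank ℝ F) ≃ κ := (Fintype.equivFinOfCardEq hcard).symm
      exact ⟨a ∘ c, hli.comp c c.injective⟩
    · rintro ⟨a, ha⟩
      have h1 := ha.span_eq_top_of_card_eq_finrank' (by simp)
      rw [eq_top_iff, ← h1]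
      exact Submodule.span_mono (range_comp_subset_range a w)
  rw [h]
  refine isOpen_iUnion fun a => ?_
  exact isOpen_setOfPred_linearIndependent.preimage (by fun_prop : Continuous fun w : Fin r → F => w ∘ a)

/-- Tuples that do not span are parametrized by the tuples of vectors in a hyperplane. -/
theorem exists_eq_sum_of_span_ne_top {r : ℕ} {w : Fin r → F}
    (hw : Submodule.span ℝ (range w) ≠ ⊤) :
    ∃ (P : Fin (Module.finrank ℝ F - 1) → F) (Q : Fin r → Fin (Module.finrank ℝ F - 1) → ℝ),
      ∀ j, w j = ∑ a, Q j a • P a := by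
  obtain ⟨v, hv⟩ : ∃ v, v ∉ Submodule.span ℝ (range w) := by
    by_contra! h
    exact hw (eq_top_iff.2 fun v _ => h v)
  obtain ⟨f, hfv, hf⟩ := Submodule.exists_le_ker_of_notMem hv
  have hf0 : f ≠ 0 := fun h => hfv (by rw [h]; rfl)
  have hk : Module.finrank ℝ (LinearMap.ker f) = Module.finrank ℝ F - 1 := by
    have := Module.Dual.finrank_ker_add_one_of_ne_zero hf0
    omega
  let b := Module.finBasisOfFinrankEq ℝ (LinearMap.ker f) hk
  have hwk : ∀ j, w j ∈ LinearMap.ker f := fun j => hf (Submodule.subset_span ⟨j, rfl⟩)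
  refine ⟨fun a => b a, fun j a => b.repr ⟨w j, hwk j⟩ a, fun j => ?_⟩
  have h := congrArg Subtype.val (b.sum_repr ⟨w j, hwk j⟩)
  rw [AddSubmonoidClass.coe_finsetSum] at h
  exact h.symm

/-- Translating a smooth family of tuples, depending on fewer parameters than their length allows,
by a generic tuple makes them all spanning. -/
theorem dense_setOf_forall_span_eq_top [Nontrivial F] {m r : ℕ}
    (hr : m + Module.finrank ℝ F * Module.finrank ℝ F < r)
    {B : Set (EuclideanSpace ℝ (Fin m))} (hB : Convex ℝ B)
    {R : EuclideanSpace ℝ (Fin m) → Fin r → F} (hR : ContDiffOn ℝ 1 R B) :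
    Dense {w : Fin r → F | ∀ y ∈ B, Submodule.span ℝ (range (w + R y)) = ⊤} := by
  set d := Module.finrank ℝ F with hd
  have hd0 : 0 < d := Module.finrank_pos
  let D := EuclideanSpace ℝ (Fin m) × (Fin (d - 1) → F) × (Fin r → Fin (d - 1) → ℝ)
  let Ψ : D → Fin r → F := fun p j => (∑ a, p.2.2 j a • p.2.1 a) - R p.1 j
  have hΨ : ContDiffOn ℝ 1 Ψ (B ×ˢ univ) := by
    rw [contDiffOn_pi]
    intro j
    refine ContDiffOn.sub ?_ ?_
    · refine ContDiff.contDiffOn ?_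
      refine ContDiff.sum fun a _ => ?_
      fun_prop
    · exact (contDiffOn_pi.1 hR j).comp contDiff_fst.contDiffOn fun p hp => hp.1
  have hdim : dimH (B ×ˢ (univ : Set ((Fin (d - 1) → F) × (Fin r → Fin (d - 1) → ℝ)))) <
      Module.finrank ℝ (Fin r → F) := by
    refine (dimH_mono (subset_univ _)).trans_lt ?_
    rw [Real.dimH_univ_eq_finrank]
    have h1 : Module.finrank ℝ D = m + ((d - 1) * d + r * (d - 1)) := by
      simp [D, Module.finrank_pi_fintype, ← hd]
    have h2 : Module.finrank ℝ (Fin r → F) = r * d := by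
      simp [Module.finrank_pi_fintype, ← hd]
    have h3 : m + ((d - 1) * d + r * (d - 1)) < r * d := by
      obtain ⟨c, hc⟩ : ∃ c, d = c + 1 := ⟨d - 1, by omega⟩
      rw [hc] at hr ⊢
      simp only [Nat.add_sub_cancel]
      nlinarith
    rw [h1, h2]
    exact_mod_cast h3
  refine (hΨ.dense_compl_image_of_dimH_lt_finrank (hB.prod convex_univ) subset_rfl hdim).mono ?_
  intro w hw y hy
  by_contra hspan
  obtain ⟨P, Q, hPQ⟩ := exists_eq_sum_of_span_ne_top hspan
  refine hw ⟨(y, P, Q), ⟨hy, trivial⟩, funext fun j => ?_⟩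
  change (∑ a, Q j a • P a) - R y j = w j
  rw [← hPQ]
  simp

end SpanningTuples

section Generating

open Topology Filter

variable {m : ℕ} {M : Type*} [TopologicalSpace M] [ChartedSpace (EuclideanSpace ℝ (Fin m)) M]
  [IsManifold (𝓡 m) ∞ M] [T2Space M] [SigmaCompactSpace M]

/-- A smooth vector bundle over a `σ`-compact manifold has finitely many smooth sections that span
every fiber. The sections are generic combinations of a locally finite family of bumped constant
sections; genericity is expressed by the Baire category theorem in the space of coefficients. -/
theorem exists_sections_span_eq_top (F : Type*) [NormedAddCommGroup F] [NormedSpace ℝ F]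
    [FiniteDimensional ℝ F] [Nontrivial F]
    (L : M → Type*) [∀ x, AddCommGroup (L x)] [∀ x, Module ℝ (L x)] [∀ x, TopologicalSpace (L x)]
    [TopologicalSpace (TotalSpace F L)] [FiberBundle F L] [VectorBundle ℝ F L]
    [ContMDiffVectorBundle ∞ F L (𝓡 m)] :
    ∃ (r : ℕ) (s : Fin r → ∀ x, L x),
      (∀ j, ContMDiff (𝓡 m) ((𝓡 m).prod 𝓘(ℝ, F)) ∞ fun x => TotalSpace.mk' F x (s j x)) ∧
      ∀ x, Submodule.span ℝ (range fun j => s j x) = ⊤ := by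
  obtain ⟨ι, fs, hfs⟩ := SmoothBumpCovering.exists_isSubordinate (𝓡 m) (isClosed_univ (X := M))
    (U := fun x => (trivializationAt F L x).baseSet)
    fun x _ => (trivializationAt F L x).open_baseSet.mem_nhds
      (FiberBundle.mem_baseSet_trivializationAt F L x)
  have hι : Countable ι := countable_univ_iff.1
    (fs.locallyFinite.countable_univ fun i => (fs i).nonempty_support)
  let e : ι → Trivialization F (TotalSpace.proj : TotalSpace F L → M) :=
    fun i => trivializationAt F L (fs.c i)
  -- the bumped constant sections
  let T : ι → F → ∀ x, L x := fun i v x => fs i x • (e i).symmₗ ℝ x v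
  have hsymm : ∀ i x, x ∈ (e i).baseSet → ∀ v, (e i ⟨x, (e i).symmₗ ℝ x v⟩).2 = v := by
    intro i x hx v
    rw [(e i).symmₗ_apply (R := ℝ) hx]
    exact congrArg Prod.snd ((e i).apply_mk_symm hx v)
  have hT : ∀ i v, ContMDiff (𝓡 m) ((𝓡 m).prod 𝓘(ℝ, F)) ∞
      fun x => TotalSpace.mk' F x (T i v x) := by
    intro i v
    refine ContMDiffOn.smul_section_of_tsupport (u := (e i).baseSet) (fs i).contMDiff.contMDiffOn
      (e i).open_baseSet (hfs i) ?_
    rw [(e i).contMDiffOn_section_baseSet_iff]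
    exact (contMDiffOn_const (c := v)).congr fun x hx => hsymm i x hx v
  have hTadd : ∀ i v w x, T i (v + w) x = T i v x + T i w x := by
    intro i v w x
    simp only [T, map_add, smul_add]
  have hTsmul : ∀ i (c : ℝ) v x, T i (c • v) x = c • T i v x := by
    intro i c v x
    simp only [T, map_smul]
    rw [smul_comm]
  have hTsupp : ∀ i v, {x | T i v x ≠ 0} ⊆ Function.support (fs i) := by
    intro i v x hx h0
    exact hx (by simp only [T, h0, zero_smul])
  let r := m + Module.finrank ℝ F * Module.finrank ℝ F + 1
  let s : (ι → Fin r → F) → Fin r → ∀ x, L x := fun v j x => ∑ᶠ i, T i (v i j) x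
  have hs : ∀ v j, ContMDiff (𝓡 m) ((𝓡 m).prod 𝓘(ℝ, F)) ∞
      fun x => TotalSpace.mk' F x (s v j x) := by
    intro v j
    exact ContMDiff.finsum_section_of_locallyFinite
      (fs.locallyFinite.subset fun i => hTsupp i _) fun i => hT i _
  let B : ι → Set M := fun i => {x | fs i x = 1}
  have hBsupp : ∀ i, B i ⊆ Function.support (fs i) := by
    intro i x hx
    have : fs i x = 1 := hx
    simp [this]
  have hBbase : ∀ i, Function.support (fs i) ⊆ (e i).baseSet := fun i =>
    hfs.support_subset i
  have hBcomp : ∀ i, IsCompact (B i) := fun i =>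
    (fs i).hasCompactSupport.isCompact.of_isClosed_subset
      (isClosed_eq (fs i).continuous continuous_const) ((hBsupp i).trans subset_closure)
  let good : ι → Set (ι → Fin r → F) := fun i =>
    {v | ∀ x ∈ B i, Submodule.span ℝ (range fun j => ((e i) ⟨x, s v j x⟩).2) = ⊤}
  have hfin : ∀ (v : ι → Fin r → F) j x, (Function.support fun i => T i (v i j) x).Finite := fun v j x =>
    (fs.point_finite x).subset fun i hi => hTsupp i _ hi
  -- linearity of the charts
  have hlin : ∀ i x, x ∈ (e i).baseSet → ∃ Λ : L x →ₗ[ℝ] F, ∀ u, (e i ⟨x, u⟩).2 = Λ u :=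
    fun i x hx => ⟨(e i).linearEquivAt ℝ x hx, fun u => rfl⟩
  have hopen : ∀ i, IsOpen (good i) := by
    intro i
    rw [isOpen_iff_mem_nhds]
    intro v hv
    refine (hBcomp i).eventually_forall_of_forall_eventually
      (P := fun (v : ι → Fin r → F) x => Submodule.span ℝ (range fun j => ((e i) ⟨x, s v j x⟩).2) = ⊤) fun x hx => ?_
    have hxe : x ∈ (e i).baseSet := hBbase i (hBsupp i hx)
    -- near `x` only finitely many of the bumped sections are nonzero
    obtain ⟨W, hW, hWfin⟩ := fs.locallyFinite x
    let I : Finset ι := hWfin.toFinset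
    let b := Module.finBasis ℝ F
    let Φ : (ι → Fin r → F) × M → Fin r → F := fun p j =>
      ∑ i' ∈ I, ∑ a, (b.repr (p.1 i' j) a) • (e i ⟨p.2, T i' (b a) p.2⟩).2
    have hΦc : ContinuousAt Φ (v, x) := by
      rw [continuousAt_pi]
      intro j
      refine tendsto_finsetSum _ fun i' _ => tendsto_finsetSum _ fun a _ => ?_
      refine Filter.Tendsto.smul ?_ ?_
      · have h1 : Continuous fun p : (ι → Fin r → F) × M => b.repr (p.1 i' j) a := by
          have h2 : Continuous fun w : F => b.repr w a :=
            (LinearMap.continuous_of_finiteDimensional (b.coord a))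
          exact h2.comp (by fun_prop)
        exact h1.continuousAt
      · have h1 : ContinuousAt (fun y => (e i ⟨y, T i' (b a) y⟩).2) x :=
          (((e i).contMDiffAt_section_iff hxe).1 (hT i' (b a) x)).continuousAt
        exact ContinuousAt.comp (f := fun p : (ι → Fin r → F) × M => p.2)
          (g := fun y => (e i ⟨y, T i' (b a) y⟩).2) (x := (v, x)) h1 continuousAt_snd
    have hΦeq : ∀ᶠ p in 𝓝 (v, x), (fun j => ((e i) ⟨p.2, s p.1 j p.2⟩).2) = Φ p := by
      have h1 : ∀ᶠ y in 𝓝 x, y ∈ W ∩ (e i).baseSet :=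
        inter_mem hW ((e i).open_baseSet.mem_nhds hxe)
      filter_upwards [continuousAt_snd.eventually (p := fun y => y ∈ W ∩ (e i).baseSet) h1]
        with p hp
      funext j
      obtain ⟨Λ, hΛ⟩ := hlin i p.2 hp.2
      have h2 : s p.1 j p.2 = ∑ i' ∈ I, T i' (p.1 i' j) p.2 := by
        refine finsum_eq_sum_of_support_subset _ fun i' hi' => ?_
        exact hWfin.mem_toFinset.2 ⟨p.2, hTsupp _ _ hi', hp.1⟩
      rw [hΛ, h2, map_sum]
      refine Finset.sum_congr rfl fun i' _ => ?_
      have h3 : T i' (p.1 i' j) p.2 = ∑ a, b.repr (p.1 i' j) a • T i' (b a) p.2 := by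
        let Tl : F →ₗ[ℝ] L p.2 := ⟨⟨fun w => T i' w p.2, fun w w' => hTadd _ _ _ _⟩,
          fun c w => hTsmul _ _ _ _⟩
        change Tl _ = ∑ a, _ • Tl (b a)
        conv_lhs => rw [← b.sum_repr (p.1 i' j), map_sum]
        exact Finset.sum_congr rfl fun a _ => map_smul _ _ _
      rw [h3, map_sum]
      refine Finset.sum_congr rfl fun a _ => ?_
      rw [map_smul, hΛ]
    have hmem : Φ (v, x) ∈ {w : Fin r → F | Submodule.span ℝ (range w) = ⊤} := by
      have := hv x hx
      rw [mem_ofPred_eq, ← hΦeq.self_of_nhds]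
      exact this
    filter_upwards [hΦeq, hΦc.eventually ((isOpen_setOf_span_eq_top r).mem_nhds hmem)]
      with p hp1 hp2
    rw [hp1]
    exact hp2
  have hdense : ∀ i, Dense (good i) := by
    classical
    intro i v
    rw [mem_closure_iff_nhds]
    intro O hO
    -- only the coefficients of index `i` are changed
    have hcont : Continuous fun w : Fin r → F => Function.update v i w :=
      continuous_const.update i continuous_id
    have hO' : (fun w : Fin r → F => Function.update v i w) ⁻¹' O ∈ 𝓝 (v i) := by
      refine hcont.continuousAt.preimage_mem_nhds ?_
      simpa using hO
    let χ := extChartAt (𝓡 m) (fs.c i)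
    let ball := Metric.ball (χ (fs.c i)) (fs i).rOut
    have hball : ball ⊆ χ.target := by
      intro y hy
      exact (fs i).ball_subset ⟨hy, by simp⟩
    have hballe : ∀ y ∈ ball, χ.symm y ∈ (e i).baseSet := by
      intro y hy
      refine hBbase i ?_
      rw [(fs i).support_eq_symm_image]
      exact ⟨y, ⟨hy, by simp⟩, rfl⟩
    let R : EuclideanSpace ℝ (Fin m) → Fin r → F := fun y j =>
      ((e i) ⟨χ.symm y, s (Function.update v i 0) j (χ.symm y)⟩).2
    have hR : ContDiffOn ℝ 1 R ball := by
      rw [contDiffOn_pi]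
      intro j
      have h1 : ContMDiffOn (𝓡 m) 𝓘(ℝ, F) ∞
          (fun x => ((e i) ⟨x, s (Function.update v i 0) j x⟩).2) (e i).baseSet :=
        (e i).contMDiffOn_section_baseSet_iff.1 (hs _ j).contMDiffOn
      have h2 : ContMDiffOn 𝓘(ℝ, EuclideanSpace ℝ (Fin m)) (𝓡 m) ∞ χ.symm ball :=
        (contMDiffOn_extChartAt_symm (fs.c i)).mono hball
      exact ((h1.comp h2 hballe).contDiffOn).of_le (by exact_mod_cast le_top)
    obtain ⟨w, hwO, hw⟩ := mem_closure_iff_nhds.1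
      (dense_setOf_forall_span_eq_top (Nat.lt_succ_self _) (convex_ball _ _) hR (v i)) _ hO'
    refine ⟨Function.update v i w, hwO, fun x hx => ?_⟩
    have hxs := hBsupp i hx
    have hxs' := hxs
    rw [(fs i).support_eq_inter_preimage] at hxs'
    have hχx : χ.symm (χ x) = x := χ.left_inv (by simpa [χ] using hxs'.1)
    have key : (fun j => ((e i) ⟨x, s (Function.update v i w) j x⟩).2) = w + R (χ x) := by
      funext j
      obtain ⟨Λ, hΛ⟩ := hlin i x (hBbase i hxs)
      have h1 : s (Function.update v i w) j x =
          T i (w j) x + s (Function.update v i 0) j x := by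
        have hz : ∀ u : Fin r → F, s (Function.update v i u) j x =
            T i (u j) x + ∑ i' ∈ (fs.point_finite x).toFinset.erase i, T i' (v i' j) x := by
          intro u
          have hsub : (Function.support fun i' => T i' (Function.update v i u i' j) x) ⊆
              ((fs.point_finite x).toFinset : Set ι) := fun i' hi' =>
            (fs.point_finite x).mem_toFinset.2 (hTsupp _ _ hi')
          change ∑ᶠ i', T i' (Function.update v i u i' j) x = _
          rw [finsum_eq_sum_of_support_subset _ hsub, ← Finset.add_sum_erase _ _
            ((fs.point_finite x).mem_toFinset.2 hxs)]
          congr 1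
          · simp
          · refine Finset.sum_congr rfl fun i' hi' => ?_
            rw [Function.update_of_ne (Finset.ne_of_mem_erase hi')]
        have hz0 : T i ((0 : Fin r → F) j) x = 0 := by
          have := hTsmul i 0 0 x
          simpa using this
        rw [hz w, hz 0, hz0, zero_add]
      have h2 : (e i ⟨x, T i (w j) x⟩).2 = w j := by
        have hx1 : fs i x = 1 := hx
        simp only [T, hx1, one_smul]
        exact hsymm i x (hBbase i hxs) (w j)
      rw [hΛ, h1, map_add, ← hΛ, ← hΛ, h2, Pi.add_apply]
      have h3 : R (χ x) j = (e i ⟨x, s (Function.update v i 0) j x⟩).2 := by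
        change (fun z => (e i ⟨z, s (Function.update v i 0) j z⟩).2) (χ.symm (χ x)) = _
        rw [hχx]
      rw [h3]
    rw [key]
    exact hw (χ x) hxs'.2
  obtain ⟨v, hv⟩ := (dense_iInter_of_isOpen hopen hdense).nonempty
  refine ⟨r, s v, hs v, fun x => ?_⟩
  let i := fs.ind x (mem_univ x)
  have hx1 : x ∈ B i := fs.apply_ind x (mem_univ x)
  have hxe := hBbase i (hBsupp i hx1)
  have h1 := mem_iInter.1 hv i x hx1
  let Λ := (e i).linearEquivAt ℝ x hxe
  have h2 : Submodule.map (Λ : L x →ₗ[ℝ] F) (Submodule.span ℝ (range fun j => s v j x)) = ⊤ := by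
    rw [Submodule.map_span, ← range_comp]
    exact h1
  rw [eq_top_iff]
  intro u _
  have h3 : Λ u ∈ Submodule.map (Λ : L x →ₗ[ℝ] F)
      (Submodule.span ℝ (range fun j => s v j x)) := by rw [h2]; trivial
  obtain ⟨u', hu', hu'u⟩ := h3
  rwa [← Λ.injective hu'u]

end Generating

/-! ### The centroid of the Lie algebra of sections -/

section Perfect

open Topology Filter

variable {K : Type*} [RCLike K] {m : ℕ} {M : Type*} [TopologicalSpace M]
  [ChartedSpace (EuclideanSpace ℝ (Fin m)) M]
  {F : Type*} [NormedLieRing F] [NormedSpace ℝ F] [LieAlgebra K F] [IsScalarTower ℝ K F]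
  [FiniteDimensional K F]
  {L : M → Type*} [∀ x, LieRing (L x)] [∀ x, LieAlgebra K (L x)] [∀ x, Module ℝ (L x)]
  [∀ x, IsScalarTower ℝ K (L x)]
  [∀ x, TopologicalSpace (L x)] [TopologicalSpace (TotalSpace F L)]
  [FiberBundle F L] [VectorBundle ℝ F L] [ContMDiffVectorBundle ∞ F L (𝓡 m)]
  [IsLieAlgebraBundle K F L]
  [IsManifold (𝓡 m) ∞ M] [T2Space M]

/-- A smooth family of linear endomorphisms that is the identity at `x₀` is inverted near `x₀`. -/
theorem exists_contMDiffOn_preimage {G : Type*} [NormedAddCommGroup G] [NormedSpace ℝ G]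
    [FiniteDimensional ℝ G] {k : ℕ∞} {x₀ : M} {V : Set M} (hV : IsOpen V) (hx₀ : x₀ ∈ V)
    {T : M → G →L[ℝ] G} (hT : ContMDiffOn (𝓡 m) 𝓘(ℝ, G →L[ℝ] G) k T V) (hT₀ : T x₀ = 1)
    {X : M → G} (hX : ContMDiffOn (𝓡 m) 𝓘(ℝ, G) k X V) :
    ∃ (W : Set M) (u : M → G), IsOpen W ∧ x₀ ∈ W ∧ W ⊆ V ∧ ContMDiffOn (𝓡 m) 𝓘(ℝ, G) k u W ∧
      ∀ x ∈ W, T x (u x) = X x ∧ (X x = 0 → u x = 0) := by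
  have : CompleteSpace G := FiniteDimensional.complete ℝ G
  let W := V ∩ T ⁻¹' {S | IsUnit S}
  have hWo : IsOpen W := hT.continuousOn.isOpen_inter_preimage hV Units.isOpen
  refine ⟨W, fun x => Ring.inverse (T x) (X x), hWo, ⟨hx₀, ?_⟩, inter_subset_left, ?_, ?_⟩
  · change IsUnit (T x₀)
    rw [hT₀]; exact isUnit_one
  · intro x hx
    obtain ⟨S, hS⟩ : IsUnit (T x) := hx.2
    have hVx := hV.mem_nhds hx.1
    have h1 : ContMDiffAt (𝓡 m) 𝓘(ℝ, G →L[ℝ] G) k (fun y => Ring.inverse (T y)) x := by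
      have h2 : ContDiffAt ℝ k Ring.inverse (T x) := hS ▸ contDiffAt_ringInverse ℝ S
      exact h2.contMDiffAt.comp x ((hT x hx.1).contMDiffAt hVx)
    exact (h1.clm_apply ((hX x hx.1).contMDiffAt hVx)).contMDiffWithinAt
  · intro x hx
    have h1 : T x * Ring.inverse (T x) = 1 := Ring.mul_inverse_cancel _ hx.2
    exact ⟨congrArg (fun S : G →L[ℝ] G => S (X x)) h1, fun h => by simp only [h, map_zero]⟩

theorem real_smul_lie_right {V : Type*} [LieRing V] [LieAlgebra K V] [Module ℝ V]
    [IsScalarTower ℝ K V] (x y : V) (c : ℝ) : ⁅x, c • y⁆ = c • ⁅x, y⁆ := by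
  rw [← algebraMap_smul K c y, lie_smul, algebraMap_smul]

/-- Local solution of `X = ∑ⱼ ⁅sⱼ, Zⱼ⁆` for sections `sⱼ` that span the fibers, when the fibers are
perfect. -/
theorem exists_local_sum_lie_eq
    (hF : Submodule.span K {v : F | ∃ x y : F, ⁅x, y⁆ = v} = ⊤) {r : ℕ} {k : ℕ∞}
    {s : Fin r → ckSections K m F L k}
    (hs : ∀ x, Submodule.span ℝ (range fun j => (s j).1 x) = ⊤)
    (X : ckSections K m F L k) (x₀ : M) : ∃ Z : Fin r → ckSections K m F L k,
      ∀ᶠ x in 𝓝 x₀, ∑ j, ⁅(s j).1 x, (Z j).1 x⁆ = X.1 x ∧ (X.1 x = 0 → ∀ j, (Z j).1 x = 0) := by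
  have : FiniteDimensional ℝ F := finiteDimensional_real K F
  set e := trivializationAt F L x₀ with he_def
  have hx₀ : x₀ ∈ e.baseSet := FiberBundle.mem_baseSet_trivializationAt F L x₀
  have he : e ∈ FiberBundle.trivializationAtlas F L := FiberBundle.trivialization_mem_atlas F L x₀
  let g : Fin r → M → F := fun j => localForm e (s j).1
  have hg : ∀ j, ContMDiffOn (𝓡 m) 𝓘(ℝ, F) k (g j) e.baseSet := fun j =>
    contMDiffOn_localForm (s j) he
  -- the brackets with the values at `x₀` span the typical fiber
  have hspan : Submodule.span K (range fun p : Fin r × F => ⁅g p.1 x₀, p.2⁆) = ⊤ := by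
    rw [eq_top_iff, ← hF, Submodule.span_le]
    rintro _ ⟨a, c, rfl⟩
    have ha : (chartLieEquiv K e he hx₀).symm a ∈
        Submodule.span ℝ (range fun j => (s j).1 x₀) := by rw [hs]; trivial
    have : ∀ v ∈ Submodule.span ℝ (range fun j => (s j).1 x₀),
        ⁅chartLieEquiv K e he hx₀ v, c⁆ ∈
          Submodule.span K (range fun p : Fin r × F => ⁅g p.1 x₀, p.2⁆) := by
      intro v hv
      induction hv using Submodule.span_induction with
      | mem v hv =>
        obtain ⟨j, rfl⟩ := hv
        exact Submodule.subset_span ⟨(j, c), rfl⟩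
      | zero => simp
      | add v w _ _ hv hw => rw [map_add, add_lie]; exact add_mem hv hw
      | smul t v _ hv =>
        rw [← algebraMap_smul K t v, map_smul, smul_lie]
        exact Submodule.smul_mem _ _ hv
    have h2 := this _ ha
    rwa [LieEquiv.apply_symm_apply] at h2
  obtain ⟨κ, a, ha, hspan', hli⟩ := exists_linearIndependent' K
    (fun p : Fin r × F => ⁅g p.1 x₀, p.2⁆)
  rw [hspan] at hspan'
  let b : Module.Basis κ K F := Module.Basis.mk hli hspan'.ge
  have hb : ∀ i, b i = ⁅g (a i).1 x₀, (a i).2⁆ := fun i => by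
    rw [Module.Basis.mk_apply]; rfl
  have : Fintype κ := FiniteDimensional.fintypeBasisIndex b
  -- the family of endomorphisms `v ↦ ∑ᵢ vᵢ ⁅s_{j i} x, cᵢ⁆`
  let Λ : κ → F →ₗ[ℝ] (F →L[ℝ] F) := fun i =>
    { toFun := fun w => LinearMap.toContinuousLinearMap
        (((b.coord i).smulRight ⁅w, (a i).2⁆).restrictScalars ℝ)
      map_add' := fun w w' => by
        ext v
        simp [add_lie]
      map_smul' := fun t w => by
        ext v
        simp only [LinearMap.coe_toContinuousLinearMap', LinearMap.coe_restrictScalars,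
          LinearMap.smulRight_apply, RingHom.id_apply, smul_apply]
        rw [← algebraMap_smul K t w, smul_lie, smul_comm, algebraMap_smul] }
  have hΛ : ∀ i w v, Λ i w v = b.coord i v • ⁅w, (a i).2⁆ := fun i w v => rfl
  let T : M → F →L[ℝ] F := fun x => ∑ i, Λ i (g (a i).1 x)
  have hT : ContMDiffOn (𝓡 m) 𝓘(ℝ, F →L[ℝ] F) k T e.baseSet := fun x hx =>
    contMDiffWithinAt_finsetSum fun i _ => contMDiffWithinAt_linear (Λ i) (hg _ x hx)
  have hTapp : ∀ x v, T x v = ∑ i, b.coord i v • ⁅g (a i).1 x, (a i).2⁆ := fun x v => by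
    simp only [T, sum_apply, hΛ]
  have hT₀ : T x₀ = 1 := by
    ext v
    rw [hTapp]
    simp only [← hb]
    exact b.sum_repr v
  obtain ⟨W, u, hWo, hx₀W, hWe, hu, huW⟩ := exists_contMDiffOn_preimage e.open_baseSet hx₀ hT hT₀
    (contMDiffOn_localForm X he)
  classical
  let z : Fin r → M → F := fun j x => ∑ i with (a i).1 = j, b.coord i (u x) • (a i).2
  have hz : ∀ j, ContMDiffOn (𝓡 m) 𝓘(ℝ, F) k (z j) W := by
    intro j x hx
    refine contMDiffWithinAt_finsetSum fun i _ => ?_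
    exact contMDiffWithinAt_linear (((b.coord i).smulRight (a i).2).restrictScalars ℝ) (hu x hx)
  choose Z hZ using fun j => exists_section_eventuallyEq (K := K) he hx₀ (hWo.mem_nhds hx₀W) (hz j)
  refine ⟨Z, ?_⟩
  filter_upwards [eventually_all.2 hZ, hWo.mem_nhds hx₀W] with x hx hxW
  have hxe := hWe hxW
  obtain ⟨h1, h2⟩ := huW x hxW
  constructor
  · apply (chartLieEquiv K e he hxe).injective
    change chartLieEquiv K e he hxe _ = chartLieEquiv K e he hxe _
    rw [map_sum]
    rw [localForm_eq he hxe (K := K), hTapp] at h1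
    rw [← h1, ← Finset.sum_fiberwise _ (fun i => (a i).1)]
    refine Finset.sum_congr rfl fun j _ => ?_
    rw [LieEquiv.map_lie, ← localForm_eq he hxe, ← localForm_eq he hxe, hx j]
    change ⁅g j x, z j x⁆ = _
    simp only [z]
    rw [lie_sum]
    refine Finset.sum_congr rfl fun i hi => ?_
    rw [lie_smul, ← (Finset.mem_filter.1 hi).2]
  · intro hX0 j
    have hu0 : u x = 0 := h2 (by rw [localForm_eq he hxe (K := K), hX0, map_zero])
    apply (chartLieEquiv K e he hxe).injective
    change chartLieEquiv K e he hxe _ = chartLieEquiv K e he hxe _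
    rw [← localForm_eq he hxe, hx j, map_zero]
    simp only [z, hu0, map_zero, zero_smul, Finset.sum_const_zero]

variable [SigmaCompactSpace M]

/-- If the fibers are perfect, then the brackets with finitely many sections generate all sections,
by local solutions patched with a partition of unity. -/
theorem exists_sum_lie_eq (hF : Submodule.span K {v : F | ∃ x y : F, ⁅x, y⁆ = v} = ⊤) {r : ℕ}
    {k : ℕ∞} {s : Fin r → ckSections K m F L k}
    (hs : ∀ x, Submodule.span ℝ (range fun j => (s j).1 x) = ⊤)
    (X : ckSections K m F L k) : ∃ Z : Fin r → ckSections K m F L k,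
      X = ∑ j, ⁅s j, Z j⁆ ∧ ∀ x, X.1 x = 0 → ∀ j, (Z j).1 x = 0 := by
  have hcls : ContMDiffVectorBundle k F L (𝓡 m) := .of_le (n := ∞) (mod_cast le_top)
  choose Z hZ using fun x₀ => exists_local_sum_lie_eq hF hs X x₀
  choose U hU hUo hUx using fun x₀ => eventually_nhds_iff.1 (hZ x₀)
  obtain ⟨ρ, hρ⟩ := SmoothPartitionOfUnity.exists_isSubordinate (𝓡 m) isClosed_univ U hUo
    (fun x _ => mem_iUnion.2 ⟨x, hUx x⟩)
  have hρU : ∀ i x, ρ i x ≠ 0 → x ∈ U i := fun i x hx => hρ i (subset_closure hx)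
  let Y : Fin r → ∀ x, L x := fun j x => ∑ᶠ i, ρ i x • (Z i j).1 x
  have hY : ∀ j, Y j ∈ ckSections K m F L k := by
    intro j
    refine ContMDiff.finsum_section_of_locallyFinite
      (ρ.locallyFinite.subset fun i x hx h0 => hx ?_) fun i => ?_
    · change ρ i x = 0 at h0
      rw [h0, zero_smul]
    · exact ContMDiff.smul_section (((ρ i).contMDiff).of_le (mod_cast le_top)) (Z i j).2
  have hYsum : ∀ j x, Y j x = ∑ i ∈ ρ.finsupport x, ρ i x • (Z i j).1 x := by
    intro j x
    refine finsum_eq_sum_of_support_subset _ fun i hi => ?_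
    rw [ρ.coe_finsupport]
    intro h0
    exact hi (by change ρ i x = 0 at h0; change ρ i x • (Z i j).1 x = 0; rw [h0, zero_smul])
  have hmem : ∀ x, ∀ i ∈ ρ.finsupport x, x ∈ U i := fun x i hi =>
    hρU i x ((ρ.mem_finsupport x).1 hi)
  refine ⟨fun j => ⟨Y j, hY j⟩, ?_, ?_⟩
  · refine Subtype.ext (funext fun x => ?_)
    have h1 : (∑ j, ⁅s j, (⟨Y j, hY j⟩ : ckSections K m F L k)⁆).1 x =
        ∑ j, ⁅(s j).1 x, Y j x⁆ := by
      change evalAt m F k x _ = _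
      rw [map_sum]
      rfl
    rw [h1]
    simp only [hYsum, lie_sum, real_smul_lie_right (K := K)]
    rw [Finset.sum_comm]
    simp only [← Finset.smul_sum]
    have h2 : ∀ i ∈ ρ.finsupport x, ρ i x • ∑ j, ⁅(s j).1 x, (Z i j).1 x⁆ = ρ i x • X.1 x :=
      fun i hi => by rw [(hU i x (hmem x i hi)).1]
    rw [Finset.sum_congr rfl h2, ← Finset.sum_smul, ρ.sum_finsupport x (mem_univ x), one_smul]
  · intro x hx j
    change Y j x = 0
    rw [hYsum]
    exact Finset.sum_eq_zero fun i hi => by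
      rw [(hU i x (hmem x i hi)).2 hx j, smul_zero]

theorem HasLocalCentroid.fiber (hF : HasLocalCentroid K F) (x : M) : HasLocalCentroid K (L x) :=
  hF.of_equiv (chartLieEquiv K _ (FiberBundle.trivialization_mem_atlas F L x)
    (FiberBundle.mem_baseSet_trivializationAt F L x)).symm

/-- The elements of the centroid of the Lie algebra of sections act pointwise. -/
theorem HasLocalCentroid.section_apply_eq_zero [Nontrivial F] (hF : HasLocalCentroid K F) {k : ℕ∞}
    {S : Module.End K (ckSections K m F L k)} (hS : S ∈ lieCentroid K (ckSections K m F L k))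
    {X : ckSections K m F L k} {x : M} (hX : X.1 x = 0) : (S X).1 x = 0 := by
  rcases hF.perfect_or_centerless with hperf | hcent
  · have : FiniteDimensional ℝ F := finiteDimensional_real K F
    obtain ⟨r, s, hs, hspan⟩ := exists_sections_span_eq_top (m := m) F L
    let s' : Fin r → ckSections K m F L k := fun j => ⟨s j, (hs j).of_le (mod_cast le_top)⟩
    obtain ⟨Z, hZ, hZ0⟩ := exists_sum_lie_eq hperf (s := s') hspan X
    have h1 : S X = ∑ j, ⁅S (s' j), Z j⁆ := by
      conv_lhs => rw [hZ, map_sum]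
      exact Finset.sum_congr rfl fun j _ => lieCentroid_apply_lie_left hS _ _
    rw [h1]
    change evalAt m F k x _ = 0
    rw [map_sum]
    refine Finset.sum_eq_zero fun j _ => ?_
    change ⁅(S (s' j)).1 x, (Z j).1 x⁆ = 0
    rw [hZ0 x hX j, lie_zero]
  · have hcent' : ∀ u : L x, (∀ v : L x, ⁅v, u⁆ = 0) → u = 0 := by
      intro u hu
      let φ := chartLieEquiv K _ (FiberBundle.trivialization_mem_atlas F L x)
        (FiberBundle.mem_baseSet_trivializationAt F L x)
      have h1 : φ u = 0 := hcent _ fun w => by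
        rw [← φ.apply_symm_apply w, ← LieEquiv.map_lie, hu, map_zero]
      rw [← φ.symm_apply_apply u, h1, map_zero]
    apply hcent'
    intro v
    obtain ⟨Y, rfl⟩ := exists_section_apply_eq K m F k x v
    have h1 : ⁅Y, S X⁆ = ⁅S Y, X⁆ := by
      rw [← mem_lieCentroid.1 hS, lieCentroid_apply_lie_left hS]
    have h2 := congrArg (fun Z : ckSections K m F L k => Z.1 x) h1
    change ⁅Y.1 x, (S X).1 x⁆ = ⁅(S Y).1 x, X.1 x⁆ at h2
    rw [h2, hX, lie_zero]

end Perfect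

/-! ### Characters of the algebra of functions -/

section Characters

open Topology Filter

variable {K : Type*} [RCLike K] {m : ℕ} {M : Type*} [TopologicalSpace M]
  [ChartedSpace (EuclideanSpace ℝ (Fin m)) M]

theorem ckFunctions_isUnit {k : ℕ∞} {f : ckFunctions K m M k} (hf : ∀ x, f.1 x ≠ 0) :
    IsUnit f := by
  have hinv : (fun x => (f.1 x)⁻¹) ∈ ckFunctions K m M k := fun x =>
    ((contDiffAt_inv ℝ (hf x)).contMDiffAt).comp x (f.2 x)
  exact IsUnit.of_mul_eq_one ⟨_, hinv⟩ (Subtype.ext (funext fun x => mul_inv_cancel₀ (hf x)))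

theorem star_mem_ckFunctions {k : ℕ∞} {f : M → K} (hf : f ∈ ckFunctions K m M k) :
    (fun x => star (f x)) ∈ ckFunctions K m M k := fun x =>
  contMDiffWithinAt_linear (starLinearEquiv ℝ (A := K)).toLinearMap (hf x)

variable [IsManifold (𝓡 m) ∞ M] [T2Space M]

theorem eq_of_forall_ckFunctions_eq (k : ℕ∞) {x y : M}
    (h : ∀ f : ckFunctions K m M k, f.1 x = f.1 y) : x = y := by
  by_contra hne
  obtain ⟨b, hb1, hb0⟩ := exists_ckFunctions_bump (K := K) (m := m) k x
    (isOpen_compl_singleton.mem_nhds (show x ∈ ({y} : Set M)ᶜ from hne))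
  have h1 := h b
  rw [hb1.self_of_nhds, hb0 y (by simp)] at h1
  exact one_ne_zero h1

variable [SigmaCompactSpace M]

variable (m M) in
/-- A smooth function with compact sublevel sets, glued by a partition of unity from local upper bounds
of the index of a compact exhaustion. -/
theorem exists_contMDiff_exhaustion : ∃ h : M → ℝ, ContMDiff (𝓡 m) 𝓘(ℝ, ℝ) ∞ h ∧
    ∀ c : ℝ, IsCompact {x | h x ≤ c} := by
  have : LocallyCompactSpace M := ChartedSpace.locallyCompactSpace (EuclideanSpace ℝ (Fin m)) M
  let C : CompactExhaustion M := CompactExhaustion.choice M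
  obtain ⟨h, hh⟩ := exists_contMDiffMap_forall_mem_convex_of_local_const (𝓡 m) (n := ⊤)
    (t := fun x => Ici (C.find x : ℝ)) (fun x => convex_Ici _) (fun x => by
      refine ⟨(C.find x + 1 : ℕ), ?_⟩
      have hx : x ∈ interior (C (C.find x + 1)) :=
        C.subset_interior (Nat.lt_succ_self _) (C.mem_find x)
      filter_upwards [mem_interior_iff_mem_nhds.1 hx] with y hy
      exact Set.mem_Ici.2 (Nat.cast_le.2 (C.mem_iff_find_le.1 hy)))
  refine ⟨h, h.contMDiff, fun c => ?_⟩
  refine (C.isCompact ⌊c⌋₊).of_isClosed_subset (isClosed_le h.contMDiff.continuous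
    continuous_const) fun x hx => ?_
  exact C.mem_iff_find_le.2 (Nat.le_floor ((hh x).trans hx))

/-- Every character of the algebra of `C^k` functions is the evaluation at a point: otherwise
finitely many functions in its kernel have no common zero on a compact level set of an exhaustion
function, and a sum of squares in the kernel is invertible. -/
theorem exists_forall_eq_apply {k : ℕ∞} (χ : ckFunctions K m M k →ₐ[K] K) :
    ∃ p : M, ∀ f : ckFunctions K m M k, χ f = f.1 p := by
  by_contra! hcon
  choose f hf using hcon
  let g : M → ckFunctions K m M k := fun p => f p - algebraMap K _ (χ (f p))
  have hgχ : ∀ p, χ (g p) = 0 := fun p => by simp [g]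
  have hgp : ∀ p, (g p).1 p ≠ 0 := fun p h => hf p (by
    have : (f p).1 p - χ (f p) = 0 := h
    exact (sub_eq_zero.1 this).symm)
  obtain ⟨h, hh, hc⟩ := exists_contMDiff_exhaustion m M
  let h' : ckFunctions K m M k :=
    ⟨fun x => (h x : K), ofReal_comp_mem_ckFunctions (hh.of_le (mod_cast le_top))⟩
  let g₀ : ckFunctions K m M k := h' - algebraMap K _ (χ h')
  have hg₀ : χ g₀ = 0 := by simp [g₀]
  have hg₀x : ∀ x, g₀.1 x = (h x : K) - χ h' := fun x => rfl
  -- the common zeros are sought in the compact set where `h ≤ re (χ h)`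
  obtain ⟨t, ht⟩ := (hc (RCLike.re (χ h'))).elim_finite_subcover (fun p => {x | (g p).1 x ≠ 0})
    (fun p => isOpen_ne_fun (g p).2.continuous continuous_const)
    (fun x _ => mem_iUnion.2 ⟨x, hgp x⟩)
  let s : ckFunctions K m M k → ckFunctions K m M k := fun u =>
    ⟨fun x => star (u.1 x), star_mem_ckFunctions u.2⟩
  let G : ckFunctions K m M k := s g₀ * g₀ + ∑ p ∈ t, s (g p) * g p
  have hGχ : χ G = 0 := by simp [G, hg₀, hgχ]
  have hss : ∀ (u : ckFunctions K m M k) x, (s u * u).1 x = ((‖u.1 x‖ ^ 2 : ℝ) : K) :=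
    fun u x => by
      change star (u.1 x) * u.1 x = _
      rw [RCLike.star_def, RCLike.conj_mul]; push_cast; rfl
  have hGx : ∀ x, G.1 x = ((‖g₀.1 x‖ ^ 2 + ∑ p ∈ t, ‖(g p).1 x‖ ^ 2 : ℝ) : K) := fun x => by
    have : G.1 x = (s g₀ * g₀).1 x + ∑ p ∈ t, (s (g p) * g p).1 x := by
      change (s g₀ * g₀).1 x + (∑ p ∈ t, s (g p) * g p : ckFunctions K m M k).1 x = _
      congr 1
      rw [AddSubmonoidClass.coe_finsetSum, Finset.sum_apply]
    rw [this]
    simp only [hss]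
    push_cast
    rfl
  have hG : IsUnit G := by
    refine ckFunctions_isUnit fun x hx => ?_
    rw [hGx, RCLike.ofReal_eq_zero] at hx
    have hsum : 0 ≤ ∑ p ∈ t, ‖(g p).1 x‖ ^ 2 := Finset.sum_nonneg fun p _ => sq_nonneg _
    have h1 : ‖g₀.1 x‖ ^ 2 = 0 := by nlinarith [sq_nonneg ‖g₀.1 x‖]
    have h2 : ∑ p ∈ t, ‖(g p).1 x‖ ^ 2 = 0 := by nlinarith
    have h3 : (h x : K) = χ h' := by
      have := norm_eq_zero.1 (pow_eq_zero_iff two_ne_zero |>.1 h1)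
      rwa [hg₀x, sub_eq_zero] at this
    have hx' : x ∈ {x | h x ≤ RCLike.re (χ h')} := by
      rw [mem_ofPred_eq, ← h3, RCLike.ofReal_re]
    obtain ⟨p, hp, hpx⟩ := mem_iUnion₂.1 (ht hx')
    rw [Finset.sum_eq_zero_iff_of_nonneg fun p _ => sq_nonneg _] at h2
    exact hpx (norm_eq_zero.1 (pow_eq_zero_iff two_ne_zero |>.1 (h2 p hp)))
  have := hG.map χ
  rw [hGχ] at this
  exact not_isUnit_zero this

end Characters

/-! ### Residues of the centroid of the Lie algebra of sections -/

section FiberHom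

open Topology Filter

variable {K : Type*} [RCLike K] {m : ℕ} {M : Type*} [TopologicalSpace M]
  [ChartedSpace (EuclideanSpace ℝ (Fin m)) M]
  {F : Type*} [NormedLieRing F] [NormedSpace ℝ F] [LieAlgebra K F] [IsScalarTower ℝ K F]
  [FiniteDimensional K F]
  {L : M → Type*} [∀ x, LieRing (L x)] [∀ x, LieAlgebra K (L x)] [∀ x, Module ℝ (L x)]
  [∀ x, IsScalarTower ℝ K (L x)]
  [∀ x, TopologicalSpace (L x)] [TopologicalSpace (TotalSpace F L)]
  [FiberBundle F L] [VectorBundle ℝ F L] [ContMDiffVectorBundle ∞ F L (𝓡 m)]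
  [IsLieAlgebraBundle K F L]
  [IsManifold (𝓡 m) ∞ M] [T2Space M] [SigmaCompactSpace M] [Nontrivial F]

/-- The linear map of the fiber over `x` induced by an endomorphism of the space of sections; it is
meaningful if the endomorphism acts pointwise. -/
noncomputable def fiberMap {k : ℕ∞} (x : M) :
    Module.End K (ckSections K m F L k) →ₗ[K] Module.End K (L x) where
  toFun S := evalAt m F k x ∘ₗ S ∘ₗ
    Classical.choose (LinearMap.exists_rightInverse_of_surjective (evalAt m F k x)
      (range_evalAt (K := K) (L := L) k x))
  map_add' _ _ := by ext; rfl
  map_smul' _ _ := by ext; rfl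

theorem HasLocalCentroid.fiberMap_apply (hF : HasLocalCentroid K F) {k : ℕ∞}
    {S : Module.End K (ckSections K m F L k)} (hS : S ∈ lieCentroid K (ckSections K m F L k))
    (X : ckSections K m F L k) (x : M) : fiberMap x S (X.1 x) = (S X).1 x := by
  have hr := Classical.choose_spec (LinearMap.exists_rightInverse_of_surjective (evalAt m F k x)
      (range_evalAt (K := K) (L := L) k x))
  set R := Classical.choose (LinearMap.exists_rightInverse_of_surjective (evalAt m F k x)
      (range_evalAt (K := K) (L := L) k x)) with hR
  change (S (R (X.1 x))).1 x = (S X).1 x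
  have h1 : (R (X.1 x) - X).1 x = 0 := sub_eq_zero.2 (LinearMap.congr_fun hr (X.1 x))
  have h2 := hF.section_apply_eq_zero hS h1
  rw [map_sub] at h2
  exact sub_eq_zero.1 h2

/-- The action of the centroid of the Lie algebra of sections on the fiber over `x`. -/
noncomputable def HasLocalCentroid.fiberHom (hF : HasLocalCentroid K F) (k : ℕ∞) (x : M) :
    lieCentroid K (ckSections K m F L k) →ₐ[K] Module.End K (L x) :=
  AlgHom.ofLinearMap (fiberMap x ∘ₗ (lieCentroid K (ckSections K m F L k)).val.toLinearMap)
    (LinearMap.ext fun v => by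
      obtain ⟨X, rfl⟩ := exists_section_apply_eq K m F k x v
      exact hF.fiberMap_apply (one_mem _) X x)
    (fun S T => LinearMap.ext fun v => by
      obtain ⟨X, rfl⟩ := exists_section_apply_eq K m F k x v
      refine (hF.fiberMap_apply (S * T).2 X x).trans ?_
      change _ = fiberMap x S.1 (fiberMap x T.1 (X.1 x))
      rw [hF.fiberMap_apply T.2, hF.fiberMap_apply S.2]
      rfl)

variable {k : ℕ∞}

theorem HasLocalCentroid.fiberHom_apply (hF : HasLocalCentroid K F) (x : M)
    (S : lieCentroid K (ckSections K m F L k)) (X : ckSections K m F L k) :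
    hF.fiberHom k x S (X.1 x) = (S.1 X).1 x :=
  hF.fiberMap_apply S.2 X x

theorem HasLocalCentroid.fiberHom_mem_lieCentroid (hF : HasLocalCentroid K F) (x : M)
    (S : lieCentroid K (ckSections K m F L k)) : hF.fiberHom k x S ∈ lieCentroid K (L x) := by
  intro v w
  obtain ⟨X, rfl⟩ := exists_section_apply_eq K m F k x v
  obtain ⟨Y, rfl⟩ := exists_section_apply_eq K m F k x w
  rw [← lie_apply_section, fiberHom_apply, fiberHom_apply, mem_lieCentroid.1 S.2]
  rfl

theorem fiber_finiteDimensional (K : Type*) [RCLike K] (F : Type*) [NormedLieRing F]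
    [NormedSpace ℝ F] [LieAlgebra K F] [FiniteDimensional K F] {L : M → Type*}
    [∀ x, LieRing (L x)] [∀ x, LieAlgebra K (L x)]
    [∀ x, Module ℝ (L x)] [∀ x, TopologicalSpace (L x)] [TopologicalSpace (TotalSpace F L)]
    [FiberBundle F L] [VectorBundle ℝ F L] [IsLieAlgebraBundle K F L] (x : M) :
    FiniteDimensional K (L x) :=
  (chartLieEquiv K _ (FiberBundle.trivialization_mem_atlas F L x)
    (FiberBundle.mem_baseSet_trivializationAt F L x)).toLinearEquiv.symm.finiteDimensional

theorem finrank_fiber (K : Type*) [RCLike K] (F : Type*) [NormedLieRing F] [NormedSpace ℝ F]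
    [LieAlgebra K F] {L : M → Type*} [∀ x, LieRing (L x)] [∀ x, LieAlgebra K (L x)]
    [∀ x, Module ℝ (L x)] [∀ x, TopologicalSpace (L x)] [TopologicalSpace (TotalSpace F L)]
    [FiberBundle F L] [VectorBundle ℝ F L] [IsLieAlgebraBundle K F L] (x : M) :
    Module.finrank K (L x) = Module.finrank K F :=
  (chartLieEquiv K _ (FiberBundle.trivialization_mem_atlas F L x)
    (FiberBundle.mem_baseSet_trivializationAt F L x)).toLinearEquiv.finrank_eq

theorem fiber_nontrivial (K : Type*) [RCLike K] (F : Type*) [NormedLieRing F] [NormedSpace ℝ F]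
    [LieAlgebra K F] [Nontrivial F] {L : M → Type*} [∀ x, LieRing (L x)] [∀ x, LieAlgebra K (L x)]
    [∀ x, Module ℝ (L x)] [∀ x, TopologicalSpace (L x)] [TopologicalSpace (TotalSpace F L)]
    [FiberBundle F L] [VectorBundle ℝ F L] [IsLieAlgebraBundle K F L] (x : M) :
    Nontrivial (L x) :=
  (chartLieEquiv K _ (FiberBundle.trivialization_mem_atlas F L x)
    (FiberBundle.mem_baseSet_trivializationAt F L x)).toLinearEquiv.toEquiv.nontrivial

/-- The residue at `x` of a centroid element, as a character of the centroid. -/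
noncomputable def HasLocalCentroid.residueAt (hF : HasLocalCentroid K F) (k : ℕ∞) (x : M) :
    lieCentroid K (ckSections K m F L k) →ₐ[K] K :=
  haveI := fiber_nontrivial K F (L := L) x
  haveI : FiniteDimensional K (L x) := fiber_finiteDimensional K F x
  AlgHom.ofLinearMap
    (((Module.finrank K (L x) : K)⁻¹ • LinearMap.trace K (L x)) ∘ₗ (hF.fiberHom k x).toLinearMap)
    (by
      change centroidResidue (hF.fiberHom k x 1) = 1
      rw [map_one]
      exact centroidResidue_eq_of_isNilpotent (by simp))
    (fun S T => by
      change centroidResidue (hF.fiberHom k x (S * T)) =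
        centroidResidue (hF.fiberHom k x S) * centroidResidue (hF.fiberHom k x T)
      rw [map_mul]
      exact (hF.fiber x).residue_mul (hF.fiberHom_mem_lieCentroid x S)
        (hF.fiberHom_mem_lieCentroid x T))

theorem HasLocalCentroid.residueAt_eq (hF : HasLocalCentroid K F) (x : M)
    (S : lieCentroid K (ckSections K m F L k)) :
    hF.residueAt k x S = centroidResidue (hF.fiberHom k x S) := rfl

theorem HasLocalCentroid.fiberHom_sub_residue_mem (hF : HasLocalCentroid K F) (x : M)
    (S : lieCentroid K (ckSections K m F L k)) :
    hF.fiberHom k x S - hF.residueAt k x S • 1 ∈ nilpotentCentroid K (L x) := by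
  have := fiber_nontrivial K F (L := L) x
  have : FiniteDimensional K (L x) := fiber_finiteDimensional K F x
  exact (hF.fiber x).sub_residue_mem (hF.fiberHom_mem_lieCentroid x S)

theorem HasLocalCentroid.residueAt_eq_zero (hF : HasLocalCentroid K F) (x : M)
    {S : lieCentroid K (ckSections K m F L k)} (hS : IsNilpotent S) : hF.residueAt k x S = 0 :=
  (hS.map (hF.residueAt k x)).eq_zero

/-- The residue depends on the point in a `C^k` way, being the normalized trace of a `C^k` family of
endomorphisms. -/
theorem HasLocalCentroid.residueAt_mem_ckFunctions (hF : HasLocalCentroid K F)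
    (S : lieCentroid K (ckSections K m F L k)) :
    (fun x => hF.residueAt k x S) ∈ ckFunctions K m M k := by
  have : FiniteDimensional ℝ F := finiteDimensional_real K F
  intro x₀
  set e := trivializationAt F L x₀ with he_def
  have hx₀ : x₀ ∈ e.baseSet := FiberBundle.mem_baseSet_trivializationAt F L x₀
  have he : e ∈ FiberBundle.trivializationAtlas F L := FiberBundle.trivialization_mem_atlas F L x₀
  let b := Module.finBasis K F
  choose C hC using fun i => exists_section_eventuallyEq_const (K := K) (m := m) k he hx₀ (b i)
  have h1 : ContMDiffAt (𝓡 m) 𝓘(ℝ, K) k (fun x => (Module.finrank K F : K)⁻¹ •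
      ∑ i, b.coord i (localForm e (S.1 (C i)).1 x)) x₀ := by
    refine contMDiffWithinAt_linear
      ((LinearMap.lsmul K K (Module.finrank K F : K)⁻¹).restrictScalars ℝ) ?_
    refine contMDiffWithinAt_finsetSum fun i _ => ?_
    exact contMDiffWithinAt_linear ((b.coord i).restrictScalars ℝ)
      ((contMDiffAt_section_iff_localForm he hx₀).1 ((S.1 (C i)).2 x₀))
  refine h1.congr_of_eventuallyEq ?_
  filter_upwards [eventually_all.2 hC, e.open_baseSet.mem_nhds hx₀] with x hx hxe
  rw [residueAt_eq, centroidResidue, finrank_fiber K F, smul_eq_mul]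
  congr 1
  let φ := (chartLieEquiv K e he hxe).toLinearEquiv
  rw [← LinearMap.trace_conj' _ φ, LinearMap.trace_eq_matrix_trace K b, Matrix.trace]
  refine Finset.sum_congr rfl fun i _ => ?_
  rw [Matrix.diag_apply, LinearMap.toMatrix_apply, localForm_eq he hxe (K := K),
    ← hF.fiberHom_apply]
  change b.coord i (φ (hF.fiberHom k x S (φ.symm (b i)))) = _
  have h2 : φ.symm (b i) = (C i).1 x := by
    rw [LinearEquiv.symm_apply_eq, ← hx i]; rfl
  rw [h2]
  rfl

/-- A centroid element is, up to a nilpotent one, the multiplication with its residue. -/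
theorem HasLocalCentroid.isNilpotent_sub_smulOp (hF : HasLocalCentroid K F)
    (S : lieCentroid K (ckSections K m F L k)) :
    IsNilpotent (S - ⟨smulOp F L k ⟨_, hF.residueAt_mem_ckFunctions S⟩,
      smulOp_mem_lieCentroid _⟩) := by
  set f : ckFunctions K m M k := ⟨_, hF.residueAt_mem_ckFunctions S⟩ with hf
  set T : lieCentroid K (ckSections K m F L k) := ⟨smulOp F L k f, smulOp_mem_lieCentroid _⟩
  have hT : ∀ x, hF.fiberHom k x T = hF.residueAt k x S • 1 := fun x => LinearMap.ext fun v => by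
    obtain ⟨X, rfl⟩ := exists_section_apply_eq K m F k x v
    exact hF.fiberHom_apply x T X
  refine ⟨Module.finrank K F, Subtype.ext (LinearMap.ext fun X => Subtype.ext (funext fun x => ?_))⟩
  have h1 := hF.fiberHom_apply x ((S - T) ^ Module.finrank K F) X
  have : FiniteDimensional K (L x) := fiber_finiteDimensional K F x
  have h2 : hF.fiberHom k x (S - T) ^ Module.finrank K (L x) = 0 := by
    rw [map_sub, hT]
    have h := LinearMap.aeval_self_charpoly (hF.fiberHom k x S - hF.residueAt k x S • 1)
    rw [IsNilpotent.charpoly_eq_X_pow_finrank (hF.fiberHom_sub_residue_mem x S).2] at h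
    simpa using h
  rw [map_pow, ← finrank_fiber K F (L := L) x, h2] at h1
  rw [← finrank_fiber K F (L := L) x]
  exact h1.symm

end FiberHom

/-! ### The map of base points under an isomorphism of Lie algebras of sections -/

section CentroidEquiv

variable {K V W : Type*} [Field K] [LieRing V] [LieAlgebra K V] [LieRing W] [LieAlgebra K W]

/-- The isomorphism of centroids induced by an isomorphism of Lie algebras. -/
def lieCentroidEquiv (e : V ≃ₗ⁅K⁆ W) : lieCentroid K V ≃ₐ[K] lieCentroid K W where
  toFun S := ⟨e.toLinearEquiv.conj S.1, conj_mem_lieCentroid e S.2⟩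
  invFun S := ⟨e.symm.toLinearEquiv.conj S.1, conj_mem_lieCentroid e.symm S.2⟩
  left_inv S := Subtype.ext (LinearMap.ext fun v => by
    change e.symm (e (S.1 (e.symm (e v)))) = S.1 v
    rw [e.symm_apply_apply, e.symm_apply_apply])
  right_inv S := Subtype.ext (LinearMap.ext fun v => by
    change e (e.symm (S.1 (e (e.symm v)))) = S.1 v
    rw [e.apply_symm_apply, e.apply_symm_apply])
  map_mul' S T := Subtype.ext (LinearMap.ext fun v => by
    change e (S.1 (T.1 (e.symm v))) = e (S.1 (e.symm (e (T.1 (e.symm v)))))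
    rw [e.symm_apply_apply])
  map_add' S T := Subtype.ext (map_add _ _ _)
  commutes' c := Subtype.ext (LinearMap.ext fun v => by
    change e (c • e.symm v) = c • v
    rw [map_smul, e.apply_symm_apply])

theorem lieCentroidEquiv_apply_apply (e : V ≃ₗ⁅K⁆ W) (S : lieCentroid K V) (v : V) :
    (lieCentroidEquiv e S).1 (e v) = e (S.1 v) := by
  change e (S.1 (e.symm (e v))) = _
  rw [e.symm_apply_apply]

theorem lieCentroidEquiv_symm_apply (e : V ≃ₗ⁅K⁆ W) (S : lieCentroid K W) :
    lieCentroidEquiv e (lieCentroidEquiv e.symm S) = S :=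
  (lieCentroidEquiv e).apply_symm_apply S

end CentroidEquiv

section Coordinates

variable {m : ℕ} {M : Type*} [TopologicalSpace M] [ChartedSpace (EuclideanSpace ℝ (Fin m)) M]
  {n : ℕ} {N : Type*} [TopologicalSpace N] [ChartedSpace (EuclideanSpace ℝ (Fin n)) N]

theorem contMDiffAt_euclidean_of_forall_apply {k : ℕ∞ω} {f : N → EuclideanSpace ℝ (Fin m)} {q : N}
    (hf : ∀ i, ContMDiffAt (𝓡 n) 𝓘(ℝ, ℝ) k (fun y => f y i) q) :
    ContMDiffAt (𝓡 n) 𝓘(ℝ, EuclideanSpace ℝ (Fin m)) k f q := by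
  have h1 : ContMDiffAt (𝓡 n) 𝓘(ℝ, Fin m → ℝ) k (fun y i => f y i) q :=
    contMDiffAt_pi_space.2 hf
  exact ((EuclideanSpace.equiv (Fin m) ℝ).symm.contDiff.contDiffAt.contMDiffAt).comp q h1

theorem contMDiffOn_coord [IsManifold (𝓡 m) ∞ M]
    {ξ : OpenPartialHomeomorph M (EuclideanSpace ℝ (Fin m))}
    (hξ : ξ ∈ IsManifold.maximalAtlas (𝓡 m) ∞ M) (i : Fin m) :
    ContMDiffOn (𝓡 m) 𝓘(ℝ, ℝ) ∞ (fun x => ξ x i) ξ.source := fun x hx =>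
  ((EuclideanSpace.proj i : EuclideanSpace ℝ (Fin m) →L[ℝ] ℝ).contDiff.contDiffAt.contMDiffAt
    ).comp_contMDiffWithinAt x (contMDiffOn_of_mem_maximalAtlas hξ x hx)

end Coordinates

section Covers

open Topology Filter

variable {K : Type*} [RCLike K] {m n : ℕ}
  {M : Type*} [TopologicalSpace M] [ChartedSpace (EuclideanSpace ℝ (Fin m)) M]
  {N : Type*} [TopologicalSpace N] [ChartedSpace (EuclideanSpace ℝ (Fin n)) N]
  {F : Type*} [NormedLieRing F] [NormedSpace ℝ F] [LieAlgebra K F] [IsScalarTower ℝ K F]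
  [FiniteDimensional K F]
  {L : M → Type*} [∀ x, LieRing (L x)] [∀ x, LieAlgebra K (L x)] [∀ x, Module ℝ (L x)]
  [∀ x, IsScalarTower ℝ K (L x)]
  [∀ x, TopologicalSpace (L x)] [TopologicalSpace (TotalSpace F L)]
  [FiberBundle F L] [VectorBundle ℝ F L] [ContMDiffVectorBundle ∞ F L (𝓡 m)]
  [IsLieAlgebraBundle K F L]
  {G : Type*} [NormedLieRing G] [NormedSpace ℝ G] [LieAlgebra K G] [IsScalarTower ℝ K G]
  [FiniteDimensional K G]
  {E : N → Type*} [∀ y, LieRing (E y)] [∀ y, LieAlgebra K (E y)] [∀ y, Module ℝ (E y)]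
  [∀ y, IsScalarTower ℝ K (E y)]
  [∀ y, TopologicalSpace (E y)] [TopologicalSpace (TotalSpace G E)]
  [FiberBundle G E] [VectorBundle ℝ G E] [ContMDiffVectorBundle ∞ G E (𝓡 n)]
  [IsLieAlgebraBundle K G E]
  [IsManifold (𝓡 m) ∞ M] [T2Space M] [SigmaCompactSpace M] [Nontrivial F]
  [IsManifold (𝓡 n) ∞ N] [T2Space N] [SigmaCompactSpace N]
  {k l : ℕ∞}

/-- If the sections of `L` form a nonzero Lie algebra, then so do the fibers of any bundle with an
isomorphic Lie algebra of sections. -/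
theorem nontrivial_of_section_equiv [Nonempty M]
    (μ : ckSections K m F L k ≃ₗ⁅K⁆ ckSections K n G E l) : Nontrivial G := by
  by_contra hG
  rw [not_nontrivial_iff_subsingleton] at hG
  have hB : Subsingleton (ckSections K n G E l) := ⟨fun X Y => Subtype.ext (funext fun y =>
    (chartLieEquiv K _ (FiberBundle.trivialization_mem_atlas G E y)
      (FiberBundle.mem_baseSet_trivializationAt G E y)).injective (Subsingleton.elim _ _))⟩
  obtain ⟨x⟩ := ‹Nonempty M›
  have := fiber_nontrivial K F (L := L) x
  obtain ⟨v, hv⟩ := exists_ne (0 : L x)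
  obtain ⟨X, rfl⟩ := exists_section_apply_eq K m F k x v
  refine hv ?_
  have h1 : X = 0 := μ.injective (Subsingleton.elim _ _)
  rw [h1]
  rfl

variable (F L) in
/-- The action of functions on sections, as a map to the centroid. -/
def smulCentroid (k : ℕ∞) : ckFunctions K m M k →ₐ[K] lieCentroid K (ckSections K m F L k) :=
  (smulOp F L k).codRestrict _ smulOp_mem_lieCentroid

theorem HasLocalCentroid.fiberHom_smulCentroid (hF : HasLocalCentroid K F) (x : M)
    (f : ckFunctions K m M k) : hF.fiberHom k x (smulCentroid F L k f) = f.1 x • 1 :=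
  LinearMap.ext fun v => by
    obtain ⟨X, rfl⟩ := exists_section_apply_eq K m F k x v
    exact hF.fiberHom_apply x _ X

theorem HasLocalCentroid.residueAt_smulCentroid (hF : HasLocalCentroid K F) (x : M)
    (f : ckFunctions K m M k) : hF.residueAt k x (smulCentroid F L k f) = f.1 x := by
  have := fiber_nontrivial K F (L := L) x
  have : FiniteDimensional K (L x) := fiber_finiteDimensional K F x
  rw [residueAt_eq, fiberHom_smulCentroid]
  exact centroidResidue_eq_of_isNilpotent (by simp)

variable [Nontrivial G]

/-- The isomorphism `μ` covers the map `σ` of base points if it takes the residues at `σ q` to the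
residues at `q`. -/
def Covers (hF : HasLocalCentroid K F) (hG : HasLocalCentroid K G)
    (μ : ckSections K m F L k ≃ₗ⁅K⁆ ckSections K n G E l) (σ : N → M) : Prop :=
  ∀ (q : N) (S : lieCentroid K (ckSections K m F L k)),
    hG.residueAt l q (lieCentroidEquiv μ S) = hF.residueAt k (σ q) S

variable {hF : HasLocalCentroid K F} {hG : HasLocalCentroid K G}
    {μ : ckSections K m F L k ≃ₗ⁅K⁆ ckSections K n G E l} {σ : N → M}

variable (hF hG μ) in
/-- The residue at `q` of multiplication by functions on `M`, transported by `μ`, is a character of the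
algebra of functions on `M`, hence the evaluation at a point. Since every centroid element differs
from multiplication by its residue by a nilpotent one, this point determines all residues at `q`. -/
theorem exists_covers : ∃ σ : N → M, Covers hF hG μ σ := by
  have h : ∀ q : N, ∃ p : M, ∀ S, hG.residueAt l q (lieCentroidEquiv μ S) = hF.residueAt k p S := by
    intro q
    obtain ⟨p, hp⟩ := exists_forall_eq_apply
      (((hG.residueAt l q).comp (lieCentroidEquiv μ).toAlgHom).comp (smulCentroid F L k))
    refine ⟨p, fun S => ?_⟩
    have h1 := (hF.isNilpotent_sub_smulOp S).map (lieCentroidEquiv μ)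
    have h2 := hG.residueAt_eq_zero q h1
    rw [map_sub, map_sub, sub_eq_zero] at h2
    exact h2.trans (hp _)
  choose σ hσ using h
  exact ⟨σ, hσ⟩

theorem Covers.comp_eq {τ : M → N} (hσ : Covers hF hG μ σ) (hτ : Covers hG hF μ.symm τ) (q : N) :
    τ (σ q) = q := by
  refine (eq_of_forall_ckFunctions_eq (K := K) (m := n) l fun g => ?_).symm
  rw [← hG.residueAt_smulCentroid (L := E) q g, ← hG.residueAt_smulCentroid (L := E) (τ (σ q)) g,
    ← hτ, ← hσ, lieCentroidEquiv_symm_apply]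

/-- The function `f` on `M`, acting on the fiber of `E` over `q` through `μ`. -/
noncomputable def transportedSmul (hG : HasLocalCentroid K G)
    (μ : ckSections K m F L k ≃ₗ⁅K⁆ ckSections K n G E l) (q : N) :
    ckFunctions K m M k →ₐ[K] Module.End K (E q) :=
  ((hG.fiberHom l q).comp (lieCentroidEquiv μ).toAlgHom).comp (smulCentroid F L k)

theorem transportedSmul_apply (q : N) (f : ckFunctions K m M k) (X : ckSections K m F L k) :
    transportedSmul hG μ q f ((μ X).1 q) = (μ (smulOp F L k f X)).1 q := by
  refine (hG.fiberHom_apply q _ (μ X)).trans ?_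
  exact congrArg (fun Y : ckSections K n G E l => Y.1 q)
    (lieCentroidEquiv_apply_apply μ (smulCentroid F L k f) X)

theorem Covers.transportedSmul_sub_mem (hσ : Covers hF hG μ σ) (q : N) (f : ckFunctions K m M k) :
    transportedSmul hG μ q f - f.1 (σ q) • 1 ∈ nilpotentCentroid K (E q) := by
  rw [← hF.residueAt_smulCentroid (L := L), ← hσ]
  exact hG.fiberHom_sub_residue_mem q _

/-- A nonzero scalar plus a nilpotent endomorphism is invertible. -/
theorem Covers.isUnit_transportedSmul (hσ : Covers hF hG μ σ) {q : N} {f : ckFunctions K m M k}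
    (hf : f.1 (σ q) ≠ 0) : IsUnit (transportedSmul hG μ q f) := by
  have h1 := (hσ.transportedSmul_sub_mem q f).2
  have h2 : IsUnit (f.1 (σ q) • (1 : Module.End K (E q))) := by
    rw [← Algebra.algebraMap_eq_smul_one]
    exact (IsUnit.mk0 _ hf).map _
  have h3 := h1.isUnit_add_left_of_commute h2 (by
    rw [← Algebra.algebraMap_eq_smul_one]
    exact Algebra.commute_algebraMap_right _ _)
  simpa using h3

/-- Functions that vanish near `σ q` act trivially on the fiber over `q`. -/
theorem Covers.transportedSmul_eq_zero (hσ : Covers hF hG μ σ) {q : N} {f : ckFunctions K m M k}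
    (hf : ∀ᶠ x in 𝓝 (σ q), f.1 x = 0) : transportedSmul hG μ q f = 0 := by
  obtain ⟨b, hb1, hb0⟩ := exists_ckFunctions_bump (K := K) (m := m) k (σ q) hf
  have h1 : b * f = 0 := Subtype.ext (funext fun x => by
    change b.1 x * f.1 x = 0
    by_cases hx : f.1 x = 0
    · rw [hx, mul_zero]
    · rw [hb0 x hx, zero_mul])
  have h2 := congrArg (transportedSmul hG μ q) h1
  rw [map_mul, map_zero] at h2
  exact ((hσ.isUnit_transportedSmul (by rw [hb1.self_of_nhds]; exact one_ne_zero)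
    ).mul_right_eq_zero).1 h2

theorem Covers.transportedSmul_congr (hσ : Covers hF hG μ σ) {q : N} {f g : ckFunctions K m M k}
    (hfg : ∀ᶠ x in 𝓝 (σ q), f.1 x = g.1 x) :
    transportedSmul hG μ q f = transportedSmul hG μ q g := by
  have h : transportedSmul hG μ q (f - g) = 0 := by
    refine hσ.transportedSmul_eq_zero ?_
    filter_upwards [hfg] with x hx
    exact sub_eq_zero.2 hx
  rwa [map_sub, sub_eq_zero] at h

/-- An isomorphism of Lie algebras of sections is local along the map of base points. -/
theorem Covers.apply_eq_zero (hσ : Covers hF hG μ σ) {q : N} {X : ckSections K m F L k}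
    (hX : ∀ᶠ x in 𝓝 (σ q), X.1 x = 0) : (μ X).1 q = 0 := by
  obtain ⟨b, hb1, hb0⟩ := exists_ckFunctions_bump (K := K) (m := m) k (σ q) hX
  have h1 : smulOp F L k b X = 0 := Subtype.ext (funext fun x => by
    change b.1 x • X.1 x = 0
    by_cases hx : X.1 x = 0
    · rw [hx, smul_zero]
    · rw [hb0 x hx, zero_smul])
  have h2 := transportedSmul_apply (hG := hG) (μ := μ) q b X
  rw [h1, map_zero] at h2
  obtain ⟨U, hU⟩ := hσ.isUnit_transportedSmul (f := b) (q := q)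
    (by rw [hb1.self_of_nhds]; exact one_ne_zero)
  have h3 : (U⁻¹.1 * U.1) ((μ X).1 q) = 0 := by
    rw [Module.End.mul_apply, hU, h2]
    exact map_zero _
  rwa [Units.inv_mul] at h3

theorem Covers.apply_congr (hσ : Covers hF hG μ σ) {q : N} {X Y : ckSections K m F L k}
    (hXY : ∀ᶠ x in 𝓝 (σ q), X.1 x = Y.1 x) : (μ X).1 q = (μ Y).1 q := by
  have h : (μ (X - Y)).1 q = 0 := by
    refine hσ.apply_eq_zero ?_
    filter_upwards [hXY] with x hx
    exact sub_eq_zero.2 hx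
  rw [map_sub] at h
  exact sub_eq_zero.1 h

/-- The pullback `f ∘ σ` is a residue function on `N`, and these are of class `C^l`. -/
theorem Covers.comp_mem_ckFunctions (hσ : Covers hF hG μ σ) (f : ckFunctions K m M k) :
    (fun q => f.1 (σ q)) ∈ ckFunctions K n N l := by
  have h := hG.residueAt_mem_ckFunctions (lieCentroidEquiv μ (smulCentroid F L k f))
  convert h using 2 with q
  rw [hσ, hF.residueAt_smulCentroid]

theorem Covers.continuous (hσ : Covers hF hG μ σ) : Continuous σ := by
  refine continuous_iff_continuousAt.2 fun q V hV => ?_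
  obtain ⟨b, hb1, hb0⟩ := exists_ckFunctions_bump (K := K) (m := m) k (σ q) hV
  have h1 := (mem_ckFunctions.1 (hσ.comp_mem_ckFunctions b)).continuous
  have h2 : ∀ᶠ y in 𝓝 q, b.1 (σ y) ≠ 0 :=
    h1.continuousAt.eventually_ne (by rw [hb1.self_of_nhds]; exact one_ne_zero)
  change ∀ᶠ y in 𝓝 q, σ y ∈ V
  filter_upwards [h2] with y hy
  by_contra hyV
  exact hy (hb0 _ hyV)

/-- Functions of class `C^k` near `σ q` pull back to functions of class `C^l` near `q`. -/
theorem Covers.comp_contMDiffAt (hσ : Covers hF hG μ σ) {q : N} {f : M → ℝ} {V : Set M}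
    (hV : V ∈ 𝓝 (σ q)) (hf : ContMDiffOn (𝓡 m) 𝓘(ℝ, ℝ) k f V) :
    ContMDiffAt (𝓡 n) 𝓘(ℝ, ℝ) l (fun y => f (σ y)) q := by
  have hf' : ContMDiffOn (𝓡 m) 𝓘(ℝ, K) k (fun x => (f x : K)) V := fun x hx =>
    contMDiffWithinAt_linear (Algebra.linearMap ℝ K) (hf x hx)
  obtain ⟨g, hg⟩ := exists_ckFunctions_eventuallyEq hV hf'
  have h1 : ContMDiffAt (𝓡 n) 𝓘(ℝ, ℝ) l (fun y => RCLike.reLm (g.1 (σ y))) q :=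
    contMDiffWithinAt_linear (RCLike.reLm (K := K)) (hσ.comp_mem_ckFunctions g q)
  refine h1.congr_of_eventuallyEq ?_
  filter_upwards [hσ.continuous.continuousAt hg] with y hy
  have hy' : g.1 (σ y) = f (σ y) := hy
  rw [hy', RCLike.reLm_coe, RCLike.ofReal_re]

theorem Covers.contMDiff (hσ : Covers hF hG μ σ) : ContMDiff (𝓡 n) (𝓡 m) l σ := by
  intro q
  rw [contMDiffAt_iff_target]
  refine ⟨hσ.continuous.continuousAt, contMDiffAt_euclidean_of_forall_apply fun i => ?_⟩
  exact hσ.comp_contMDiffAt (V := (chartAt (EuclideanSpace ℝ (Fin m)) (σ q)).source)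
    (chart_source_mem_nhds _ (σ q))
    ((contMDiffOn_coord (IsManifold.chart_mem_maximalAtlas (σ q)) i).of_le (mod_cast le_top))

end Covers

/-! ### Differentiability classes are detected by the algebra of functions -/

section Regularity

open Topology Filter

variable {m : ℕ} {M : Type*} [TopologicalSpace M] [ChartedSpace (EuclideanSpace ℝ (Fin m)) M]
  [IsManifold (𝓡 m) ∞ M]

theorem contMDiffAt_chartAt_symm (p : M) :
    ContMDiffAt 𝓘(ℝ, EuclideanSpace ℝ (Fin m)) (𝓡 m) ∞
      (chartAt (EuclideanSpace ℝ (Fin m)) p).symm (chartAt (EuclideanSpace ℝ (Fin m)) p p) :=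
  contMDiffAt_symm_of_mem_maximalAtlas (IsManifold.chart_mem_maximalAtlas p)
    ((chartAt _ p).map_source (mem_chart_source _ p))

/-- The one-variable obstruction, applied along a line in a chart on which `g` is not critical. -/
theorem not_contMDiffAt_abs_mul_pow {j : ℕ} {g h : M → ℝ} {p : M}
    (hg : ContMDiffAt (𝓡 m) 𝓘(ℝ, ℝ) (j + 1 : ℕ) g p)
    (hh : ContMDiffAt (𝓡 m) 𝓘(ℝ, ℝ) (j + 1 : ℕ) h p) (hg0 : g p = 0)
    (hg' : mfderiv (𝓡 m) 𝓘(ℝ, ℝ) g p ≠ 0)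
    (hgh : ∀ᶠ x in 𝓝 p, g x ≠ 0 → h x = |g x| * g x ^ j) : False := by
  set η := chartAt (EuclideanSpace ℝ (Fin m)) p with hη
  have hηp : η.symm (η p) = p := η.left_inv (mem_chart_source _ p)
  have hsymm : ContMDiffAt 𝓘(ℝ, EuclideanSpace ℝ (Fin m)) (𝓡 m) (j + 1 : ℕ) η.symm (η p) :=
    (contMDiffAt_chartAt_symm p).of_le (mod_cast le_top)
  have hcomp : ∀ {u : M → ℝ}, ContMDiffAt (𝓡 m) 𝓘(ℝ, ℝ) (j + 1 : ℕ) u p →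
      ContDiffAt ℝ (j + 1 : ℕ) (fun s => u (η.symm s)) (η p) := fun hu =>
    contMDiffAt_iff_contDiffAt.1 (ContMDiffAt.comp (η p) (by rwa [hηp]) hsymm)
  have hj : ((j + 1 : ℕ) : ℕ∞ω) ≠ 0 := by exact_mod_cast Nat.succ_ne_zero j
  -- a direction in which the derivative of `g` does not vanish
  obtain ⟨w, hw⟩ : ∃ w : EuclideanSpace ℝ (Fin m), fderiv ℝ (fun s => g (η.symm s)) (η p) w ≠ 0 := by
    by_contra! hcon
    have h0 : HasFDerivAt (fun s : EuclideanSpace ℝ (Fin m) => g (η.symm s))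
        (0 : EuclideanSpace ℝ (Fin m) →L[ℝ] ℝ) (η p) := by
      have h1 := ((hcomp hg).differentiableAt hj).hasFDerivAt
      rwa [show fderiv ℝ (fun s => g (η.symm s)) (η p) = 0 from
        ContinuousLinearMap.ext hcon] at h1
    have h1 := (h0.hasMFDerivAt).comp p
      (((contMDiffOn_chart (I := 𝓡 m) (n := ∞) (x := p) p (mem_chart_source _ p)).contMDiffAt
        (chart_source_mem_nhds _ p)).mdifferentiableAt (by simp)).hasMFDerivAt
    have h2 : g =ᶠ[𝓝 p] (fun s => g (η.symm s)) ∘ η := by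
      filter_upwards [chart_source_mem_nhds (EuclideanSpace ℝ (Fin m)) p] with x hx
      exact (congrArg g (η.left_inv hx)).symm
    have h3 := (h1.congr_of_eventuallyEq h2).mfderiv
    exact hg' (h3.trans (ContinuousLinearMap.zero_comp _))
  have ha : ContDiff ℝ (j + 1 : ℕ) fun t : ℝ => η p + t • w := by fun_prop
  have ha0 : η p + (0 : ℝ) • w = η p := by simp
  have hcurve : ∀ {u : M → ℝ}, ContMDiffAt (𝓡 m) 𝓘(ℝ, ℝ) (j + 1 : ℕ) u p →
      ContDiffAt ℝ (j + 1 : ℕ) (fun t : ℝ => u (η.symm (η p + t • w))) 0 := fun {u} hu =>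
    ContDiffAt.comp (g := fun s => u (η.symm s)) (0 : ℝ) (by rw [ha0]; exact hcomp hu)
      ha.contDiffAt
  have hderiv : HasDerivAt (fun t : ℝ => g (η.symm (η p + t • w)))
      (fderiv ℝ (fun s => g (η.symm s)) (η p) w) 0 := by
    have h1 : HasFDerivAt (fun s => g (η.symm s)) (fderiv ℝ (fun s => g (η.symm s)) (η p))
        (η p + (0 : ℝ) • w) := by
      rw [ha0]
      exact ((hcomp hg).differentiableAt hj).hasFDerivAt
    have h2 : HasDerivAt (fun t : ℝ => η p + t • w) w 0 := by
      simpa using ((hasDerivAt_id (0 : ℝ)).smul_const w).const_add (η p)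
    exact h1.comp_hasDerivAt (0 : ℝ) h2
  have hγ0 : g (η.symm (η p + (0 : ℝ) • w)) = 0 := by rw [ha0, hηp, hg0]
  refine not_contDiffAt_abs_mul_pow j (by exact_mod_cast hcurve hg) (by exact_mod_cast hcurve hh)
    hγ0 (by rw [hderiv.deriv]; exact hw) ?_
  have hγ : Tendsto (fun t : ℝ => η.symm (η p + t • w)) (𝓝 0) (𝓝 p) := by
    have h1 : ContinuousAt (fun t : ℝ => η.symm (η p + t • w)) 0 :=
      ContinuousAt.comp (g := η.symm) (by rw [ha0]; exact hsymm.continuousAt)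
        ha.continuous.continuousAt
    have h2 := h1.tendsto
    rwa [ha0, hηp] at h2
  have hne := hderiv.eventually_ne (c := 0) hw
  filter_upwards [(hγ.eventually hgh).filter_mono nhdsWithin_le_nhds, hne] with t h1 h2
  exact h1 h2

/-- The `i`-th coordinate of a chart, centered at `p`. -/
noncomputable def centeredCoord (ξ : OpenPartialHomeomorph M (EuclideanSpace ℝ (Fin m))) (p : M)
    (i : Fin m) : M → ℝ := fun x => ξ x i - ξ p i

theorem contMDiffOn_centeredCoord {ξ : OpenPartialHomeomorph M (EuclideanSpace ℝ (Fin m))}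
    (hξ : ξ ∈ IsManifold.maximalAtlas (𝓡 m) ∞ M) (p : M) (i : Fin m) :
    ContMDiffOn (𝓡 m) 𝓘(ℝ, ℝ) ∞ (centeredCoord ξ p i) ξ.source :=
  (contMDiffOn_coord hξ i).sub contMDiffOn_const

theorem mfderiv_centeredCoord_ne_zero (p : M) (i : Fin m) :
    mfderiv (𝓡 m) 𝓘(ℝ, ℝ) (centeredCoord (chartAt (EuclideanSpace ℝ (Fin m)) p) p i) p ≠ 0 := by
  intro h0
  set η := chartAt (EuclideanSpace ℝ (Fin m)) p with hη
  have hηp : η.symm (η p) = p := η.left_inv (mem_chart_source _ p)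
  have h1 : MDifferentiableAt (𝓡 m) 𝓘(ℝ, ℝ) (centeredCoord η p i) p :=
    ((contMDiffOn_centeredCoord (IsManifold.chart_mem_maximalAtlas p) p i p
      (mem_chart_source _ p)).contMDiffAt (chart_source_mem_nhds _ p)).mdifferentiableAt (by simp)
  have h2 := h1.hasMFDerivAt
  rw [h0] at h2
  have h3 := HasMFDerivAt.comp (η p) (by rw [hηp]; exact h2)
    ((contMDiffAt_chartAt_symm p).mdifferentiableAt (by simp)).hasMFDerivAt
  have h4 : HasFDerivAt (centeredCoord η p i ∘ η.symm)
      (EuclideanSpace.proj i : EuclideanSpace ℝ (Fin m) →L[ℝ] ℝ) (η p) := by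
    have h5 : HasFDerivAt (fun s : EuclideanSpace ℝ (Fin m) => s i - η p i)
      (EuclideanSpace.proj i : EuclideanSpace ℝ (Fin m) →L[ℝ] ℝ) (η p) :=
      (EuclideanSpace.proj i : EuclideanSpace ℝ (Fin m) →L[ℝ] ℝ).hasFDerivAt.sub_const _
    refine h5.congr_of_eventuallyEq ?_
    filter_upwards [η.open_target.mem_nhds (η.map_source (mem_chart_source _ p))] with s hs
    simp only [Function.comp_apply, centeredCoord, η.right_inv hs]
  have h6 := h3.mfderiv.symm.trans h4.hasMFDerivAt.mfderiv
  have h7 := congrArg (fun T : EuclideanSpace ℝ (Fin m) →L[ℝ] ℝ =>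
    T (EuclideanSpace.single i (1 : ℝ))) h6
  have h8 : (0 : ℝ) = (EuclideanSpace.proj i : EuclideanSpace ℝ (Fin m) →L[ℝ] ℝ)
    (EuclideanSpace.single i (1 : ℝ)) := h7
  simp at h8

end Regularity

section Order

open Topology Filter

variable {K : Type*} [RCLike K] {m n : ℕ}
  {M : Type*} [TopologicalSpace M] [ChartedSpace (EuclideanSpace ℝ (Fin m)) M]
  {N : Type*} [TopologicalSpace N] [ChartedSpace (EuclideanSpace ℝ (Fin n)) N]
  {F : Type*} [NormedLieRing F] [NormedSpace ℝ F] [LieAlgebra K F] [IsScalarTower ℝ K F]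
  [FiniteDimensional K F]
  {L : M → Type*} [∀ x, LieRing (L x)] [∀ x, LieAlgebra K (L x)] [∀ x, Module ℝ (L x)]
  [∀ x, IsScalarTower ℝ K (L x)]
  [∀ x, TopologicalSpace (L x)] [TopologicalSpace (TotalSpace F L)]
  [FiberBundle F L] [VectorBundle ℝ F L] [ContMDiffVectorBundle ∞ F L (𝓡 m)]
  [IsLieAlgebraBundle K F L]
  {G : Type*} [NormedLieRing G] [NormedSpace ℝ G] [LieAlgebra K G] [IsScalarTower ℝ K G]
  [FiniteDimensional K G]
  {E : N → Type*} [∀ y, LieRing (E y)] [∀ y, LieAlgebra K (E y)] [∀ y, Module ℝ (E y)]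
  [∀ y, IsScalarTower ℝ K (E y)]
  [∀ y, TopologicalSpace (E y)] [TopologicalSpace (TotalSpace G E)]
  [FiberBundle G E] [VectorBundle ℝ G E] [ContMDiffVectorBundle ∞ G E (𝓡 n)]
  [IsLieAlgebraBundle K G E]
  [IsManifold (𝓡 m) ∞ M] [T2Space M] [SigmaCompactSpace M] [Nontrivial F]
  [IsManifold (𝓡 n) ∞ N] [T2Space N] [SigmaCompactSpace N] [Nontrivial G]
  {k l : ℕ∞} {hF : HasLocalCentroid K F} {hG : HasLocalCentroid K G}
  {μ : ckSections K m F L k ≃ₗ⁅K⁆ ckSections K n G E l} {σ : N → M} {τ : M → N}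

/-- Pulling back `|t| tᵏ`, with `t` a coordinate, shows that the class of differentiability cannot
increase. -/
theorem Covers.le_of_ne_zero [Nonempty N] (hσ : Covers hF hG μ σ) (hτ : Covers hG hF μ.symm τ)
    (hm : 0 < m) (hk : k ≠ 0) : l ≤ k := by
  by_contra! hlt
  obtain ⟨j, rfl⟩ : ∃ j : ℕ, k = j := ⟨k.toNat, (ENat.natCast_toNat hlt.ne_top).symm⟩
  obtain ⟨q⟩ := ‹Nonempty N›
  have hjl : ((j + 1 : ℕ) : ℕ∞) ≤ l := by
    push_cast
    exact Order.add_one_le_of_lt hlt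
  have hjl' : ((j + 1 : ℕ) : ℕ∞ω) ≤ (l : ℕ∞ω) := by exact_mod_cast hjl
  set ξ := chartAt (EuclideanSpace ℝ (Fin m)) (σ q) with hξ_def
  have hξ : ξ ∈ IsManifold.maximalAtlas (𝓡 m) ∞ M := IsManifold.chart_mem_maximalAtlas (σ q)
  have hV := chart_source_mem_nhds (EuclideanSpace ℝ (Fin m)) (σ q)
  let x₁ : M → ℝ := centeredCoord ξ (σ q) ⟨0, hm⟩
  have hx₁ : ContMDiffOn (𝓡 m) 𝓘(ℝ, ℝ) j x₁ ξ.source :=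
    (contMDiffOn_centeredCoord hξ _ _).of_le (mod_cast le_top)
  have hφ : ContMDiffOn (𝓡 m) 𝓘(ℝ, ℝ) j (fun x => |x₁ x| * x₁ x ^ j) ξ.source := fun x hx =>
    (contDiff_abs_mul_pow j).contDiffAt.contMDiffAt.comp_contMDiffWithinAt x (hx₁ x hx)
  have h1 := (hσ.comp_contMDiffAt hV hx₁).of_le hjl'
  have h2 := (hσ.comp_contMDiffAt hV hφ).of_le hjl'
  refine not_contMDiffAt_abs_mul_pow h1 h2 (by simp [x₁, centeredCoord]) ?_
    (Eventually.of_forall fun _ _ => rfl)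
  intro h0
  have hj1 : ((j : ℕ∞) : ℕ∞ω) ≠ 0 := by exact_mod_cast hk
  have hτσ : τ (σ q) = q := hσ.comp_eq hτ q
  have h3 := ((h1.mdifferentiableAt (by simp)).hasMFDerivAt)
  rw [h0] at h3
  have h4 := HasMFDerivAt.comp (σ q) (by rw [hτσ]; exact h3)
    ((hτ.contMDiff (σ q)).mdifferentiableAt hj1).hasMFDerivAt
  have h5 : (fun y => x₁ (σ y)) ∘ τ = x₁ := funext fun x => congrArg x₁ (hτ.comp_eq hσ x)
  rw [h5] at h4
  exact mfderiv_centeredCoord_ne_zero (σ q) ⟨0, hm⟩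
    (h4.mfderiv.trans (ContinuousLinearMap.zero_comp _))

end Order

/-! ### Derivations of the algebra of functions of finite differentiability class -/

section Derivations

open Topology Filter

variable {K : Type*} [RCLike K] {m : ℕ} {M : Type*} [TopologicalSpace M]
  [ChartedSpace (EuclideanSpace ℝ (Fin m)) M] [IsManifold (𝓡 m) ∞ M] [T2Space M] {k : ℕ∞}

/-- Derivations are local operators. -/
theorem derivation_apply_congr
    (δ : Derivation K (ckFunctions K m M k) (ckFunctions K m M k)) {f g : ckFunctions K m M k}
    {p : M} (hfg : ∀ᶠ x in 𝓝 p, f.1 x = g.1 x) : (δ f).1 p = (δ g).1 p := by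
  obtain ⟨b, hb1, hb0⟩ := exists_ckFunctions_bump (K := K) (m := m) k p hfg
  have h1 : b * (f - g) = 0 := Subtype.ext (funext fun x => by
    change b.1 x * (f.1 x - g.1 x) = 0
    by_cases hx : f.1 x = g.1 x
    · rw [hx, sub_self, mul_zero]
    · rw [hb0 x hx, zero_mul])
  have h2 := congrArg (fun u : ckFunctions K m M k => u.1 p) (congrArg δ h1)
  rw [Derivation.leibniz, map_zero, map_sub] at h2
  have h3 : b.1 p * ((δ f).1 p - (δ g).1 p) + (f.1 p - g.1 p) * (δ b).1 p = 0 := h2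
  rw [hb1.self_of_nhds, hfg.self_of_nhds, sub_self, zero_mul, one_mul, add_zero] at h3
  exact sub_eq_zero.1 h3

/-- A real function as an element of the algebra of `K`-valued functions. -/
def realCkFunction (K : Type*) [RCLike K] (f : M → ℝ) (hf : ContMDiff (𝓡 m) 𝓘(ℝ, ℝ) k f) :
    ckFunctions K m M k :=
  ⟨fun x => (f x : K), ofReal_comp_mem_ckFunctions hf⟩

/-- Either the real or the imaginary part of `f` has nonzero derivation. -/
theorem exists_real_derivation_ne_zero
    (δ : Derivation K (ckFunctions K m M k) (ckFunctions K m M k)) {f : ckFunctions K m M k} {p : M}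
    (hf : (δ f).1 p ≠ 0) : ∃ (u : M → ℝ) (hu : ContMDiff (𝓡 m) 𝓘(ℝ, ℝ) k u),
      (δ (realCkFunction K u hu)).1 p ≠ 0 := by
  have hre : ContMDiff (𝓡 m) 𝓘(ℝ, ℝ) k fun x => RCLike.reLm (f.1 x) := fun x =>
    contMDiffWithinAt_linear (RCLike.reLm (K := K)) (f.2 x)
  have him : ContMDiff (𝓡 m) 𝓘(ℝ, ℝ) k fun x => RCLike.imLm (f.1 x) := fun x =>
    contMDiffWithinAt_linear (RCLike.imLm (K := K)) (f.2 x)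
  by_contra! hcon
  have h1 : f = realCkFunction K _ hre + (RCLike.I : K) • realCkFunction K _ him :=
    Subtype.ext (funext fun x => by
      change f.1 x = (RCLike.re (f.1 x) : K) + RCLike.I * (RCLike.im (f.1 x) : K)
      rw [mul_comm, RCLike.re_add_im])
  apply hf
  rw [h1, map_add, Derivation.map_smul]
  change (δ (realCkFunction K _ hre)).1 p + RCLike.I * (δ (realCkFunction K _ him)).1 p = 0
  rw [hcon _ hre, hcon _ him, mul_zero, add_zero]

/-- If the function at hand is critical at `p`, a coordinate or its sum with a coordinate will do. -/
theorem exists_real_derivation_ne_zero_of_mfderiv_ne_zero (hm : 0 < m) (hk : k ≠ 0)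
    (δ : Derivation K (ckFunctions K m M k) (ckFunctions K m M k)) {f : ckFunctions K m M k} {p : M}
    (hf : (δ f).1 p ≠ 0) : ∃ (u : M → ℝ) (hu : ContMDiff (𝓡 m) 𝓘(ℝ, ℝ) k u),
      (δ (realCkFunction K u hu)).1 p ≠ 0 ∧ mfderiv (𝓡 m) 𝓘(ℝ, ℝ) u p ≠ 0 := by
  obtain ⟨u, hu, hδu⟩ := exists_real_derivation_ne_zero δ hf
  by_cases hu' : mfderiv (𝓡 m) 𝓘(ℝ, ℝ) u p ≠ 0
  · exact ⟨u, hu, hδu, hu'⟩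
  rw [not_not] at hu'
  obtain ⟨g, hg, hgx⟩ := exists_contMDiff_eventuallyEq (k := k)
    (chart_source_mem_nhds (EuclideanSpace ℝ (Fin m)) p)
    ((contMDiffOn_centeredCoord (IsManifold.chart_mem_maximalAtlas p) p ⟨0, hm⟩).of_le
      (mod_cast le_top))
  have hg' : mfderiv (𝓡 m) 𝓘(ℝ, ℝ) g p ≠ 0 := by
    rw [Filter.EventuallyEq.mfderiv_eq hgx]
    exact mfderiv_centeredCoord_ne_zero p ⟨0, hm⟩
  by_cases hδg : (δ (realCkFunction K g hg)).1 p = 0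
  · refine ⟨u + g, hu.add hg, ?_, ?_⟩
    · have h1 : realCkFunction K (u + g) (hu.add hg) =
          realCkFunction K u hu + realCkFunction K g hg :=
        Subtype.ext (funext fun x => RCLike.ofReal_add _ _)
      rw [h1, map_add]
      change (δ (realCkFunction K u hu)).1 p + (δ (realCkFunction K g hg)).1 p ≠ 0
      rwa [hδg, add_zero]
    · have hk' : ((k : ℕ∞) : ℕ∞ω) ≠ 0 := by exact_mod_cast hk
      have h1 := ((hu p).mdifferentiableAt hk').hasMFDerivAt.add
        ((hg p).mdifferentiableAt hk').hasMFDerivAt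
      intro h0
      have h2 := h1.mfderiv.symm.trans h0
      rw [hu'] at h2
      exact hg' ((zero_add _).symm.trans h2)
  · exact ⟨g, hg, hδg, hg'⟩

/-- There are no derivations in finite differentiability: otherwise one with `δ u ≠ 0` and
`du ≠ 0` at `p`, for `u` vanishing at `p`, applied to `|u| uᵏ` would give that `|u| uᵏ⁻¹` is `C^k`. -/
theorem derivation_eq_zero (hm : 0 < m) (hk : k ≠ 0) (hk' : k ≠ ⊤)
    (δ : Derivation K (ckFunctions K m M k) (ckFunctions K m M k)) : δ = 0 := by
  refine Derivation.ext fun f => Subtype.ext (funext fun p => ?_)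
  change (δ f).1 p = 0
  by_contra hf
  obtain ⟨u, hu, hδu, hu'⟩ := exists_real_derivation_ne_zero_of_mfderiv_ne_zero hm hk δ hf
  obtain ⟨j, rfl⟩ : ∃ j : ℕ, k = (j + 1 : ℕ) := by
    obtain ⟨i, rfl⟩ : ∃ i : ℕ, k = i := ⟨k.toNat, (ENat.natCast_toNat hk').symm⟩
    obtain ⟨j, rfl⟩ := Nat.exists_eq_succ_of_ne_zero (fun h : i = 0 => hk (by simp [h]))
    exact ⟨j, rfl⟩
  let g : M → ℝ := fun x => u x - u p
  have hg : ContMDiff (𝓡 m) 𝓘(ℝ, ℝ) (j + 1 : ℕ) g := hu.sub contMDiff_const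
  have hφ : ContMDiff (𝓡 m) 𝓘(ℝ, ℝ) (j + 1 : ℕ) fun x => |g x| * g x ^ (j + 1) := fun x =>
    (contDiff_abs_mul_pow (j + 1)).contDiffAt.contMDiffAt.comp x (hg x)
  set g' : ckFunctions K m M (j + 1 : ℕ) := realCkFunction K g hg with hg'_def
  set P : ckFunctions K m M (j + 1 : ℕ) := realCkFunction K _ hφ with hP_def
  have hδg : δ g' = δ (realCkFunction K u hu) := by
    have h1 : g' = realCkFunction K u hu - algebraMap K _ (u p : K) :=
      Subtype.ext (funext fun x => RCLike.ofReal_sub _ _)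
    rw [h1, map_sub, Derivation.map_algebraMap, sub_zero]
  have hP : ∀ x, g x ≠ 0 →
      (δ P).1 x = ((j + 2 : ℕ) : K) * ((|g x| * g x ^ j : ℝ) : K) * (δ g').1 x := by
    intro x hx
    obtain ⟨s, hs⟩ : ∃ s : ℝ, ∀ᶠ y in 𝓝 x, |g y| = s * g y := by
      rcases lt_or_gt_of_ne hx with h | h
      · refine ⟨-1, ?_⟩
        filter_upwards [hg.continuous.continuousAt.eventually_lt continuousAt_const h] with y hy
        rw [abs_of_neg hy, neg_one_mul]
      · refine ⟨1, ?_⟩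
        filter_upwards [continuousAt_const.eventually_lt hg.continuous.continuousAt h] with y hy
        rw [abs_of_pos hy, one_mul]
    have h1 : ∀ᶠ y in 𝓝 x, P.1 y = ((s : K) • g' ^ (j + 2)).1 y := by
      filter_upwards [hs] with y hy
      change ((|g y| * g y ^ (j + 1) : ℝ) : K) = (s : K) * (g y : K) ^ (j + 2)
      rw [hy]
      push_cast
      ring
    rw [derivation_apply_congr δ h1, Derivation.map_smul, Derivation.leibniz_pow, hs.self_of_nhds]
    have h2 : ((s : K) • (j + 2) • g' ^ (j + 2 - 1) • δ g').1 x =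
        (s : K) * ((j + 2 : ℕ) • ((g x : K) ^ (j + 1) * (δ g').1 x)) := rfl
    rw [h2, nsmul_eq_mul]
    push_cast
    ring
  have hδgp : (δ g').1 p ≠ 0 := by rwa [hδg]
  refine not_contMDiffAt_abs_mul_pow (j := j) (g := g) (p := p)
    (h := fun x => RCLike.reLm (((δ P).1 x * ((δ g').1 x)⁻¹) * ((j + 2 : ℕ) : K)⁻¹))
    (hg p) ?_ (sub_self _) ?_ ?_
  · refine contMDiffWithinAt_linear (RCLike.reLm (K := K)) ?_
    refine contMDiffWithinAt_bilinear (LinearMap.mul ℝ K) ?_ contMDiffWithinAt_const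
    refine contMDiffWithinAt_bilinear (LinearMap.mul ℝ K) ((δ P).2 p) ?_
    exact ((contDiffAt_inv ℝ hδgp).contMDiffAt).comp p ((δ g').2 p)
  · have hk1 : ((j + 1 : ℕ) : ℕ∞ω) ≠ 0 := by exact_mod_cast Nat.succ_ne_zero j
    have h1 := ((hu p).mdifferentiableAt hk1).hasMFDerivAt.sub
      (hasMFDerivAt_const (u p) p : HasMFDerivAt (𝓡 m) 𝓘(ℝ, ℝ) (fun _ : M => u p) p _)
    intro h0
    exact hu' ((sub_zero _).symm.trans (h1.mfderiv.symm.trans h0))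
  · have hne : ∀ᶠ x in 𝓝 p, (δ g').1 x ≠ 0 :=
      (mem_ckFunctions.1 (δ g').2).continuous.continuousAt.eventually_ne hδgp
    filter_upwards [hne] with x hx hgx
    have h1 : (δ P).1 x * ((δ g').1 x)⁻¹ * ((j + 2 : ℕ) : K)⁻¹ = ((|g x| * g x ^ j : ℝ) : K) := by
      rw [hP x hgx]
      have h2 : ((j + 2 : ℕ) : K) ≠ 0 := by exact_mod_cast Nat.succ_ne_zero (j + 1)
      field_simp
    rw [h1]
    simp

end Derivations

/-! ### Local decomposition of sections -/

section Decomposition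

open Topology Filter

variable {K : Type*} [RCLike K] {m n : ℕ}
  {M : Type*} [TopologicalSpace M] [ChartedSpace (EuclideanSpace ℝ (Fin m)) M]
  {N : Type*} [TopologicalSpace N] [ChartedSpace (EuclideanSpace ℝ (Fin n)) N]
  {F : Type*} [NormedLieRing F] [NormedSpace ℝ F] [LieAlgebra K F] [IsScalarTower ℝ K F]
  [FiniteDimensional K F]
  {L : M → Type*} [∀ x, LieRing (L x)] [∀ x, LieAlgebra K (L x)] [∀ x, Module ℝ (L x)]
  [∀ x, IsScalarTower ℝ K (L x)]
  [∀ x, TopologicalSpace (L x)] [TopologicalSpace (TotalSpace F L)]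
  [FiberBundle F L] [VectorBundle ℝ F L] [ContMDiffVectorBundle ∞ F L (𝓡 m)]
  [IsLieAlgebraBundle K F L]
  {G : Type*} [NormedLieRing G] [NormedSpace ℝ G] [LieAlgebra K G] [IsScalarTower ℝ K G]
  [FiniteDimensional K G]
  {E : N → Type*} [∀ y, LieRing (E y)] [∀ y, LieAlgebra K (E y)] [∀ y, Module ℝ (E y)]
  [∀ y, IsScalarTower ℝ K (E y)]
  [∀ y, TopologicalSpace (E y)] [TopologicalSpace (TotalSpace G E)]
  [FiberBundle G E] [VectorBundle ℝ G E] [ContMDiffVectorBundle ∞ G E (𝓡 n)]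
  [IsLieAlgebraBundle K G E]
  [IsManifold (𝓡 m) ∞ M] [T2Space M] {k : ℕ∞}

/-- A section with values in a subspace `P` near `p` is, near `p`, a combination with functions as
coefficients of sections that are constant with values in `P`. -/
theorem exists_eventually_eq_sum_smulOp
    {e : Trivialization F (TotalSpace.proj : TotalSpace F L → M)}
    (he : e ∈ FiberBundle.trivializationAtlas F L) {p : M} (hp : p ∈ e.baseSet) (P : Submodule K F)
    {X : ckSections K m F L k} (hX : ∀ᶠ x in 𝓝 p, localForm e X.1 x ∈ P) :
    ∃ (r : ℕ) (f : Fin r → ckFunctions K m M k) (C : Fin r → ckSections K m F L k) (c : Fin r → F),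
      (∀ i, c i ∈ P) ∧ (∀ i, ∀ᶠ x in 𝓝 p, localForm e (C i).1 x = c i) ∧
      (∀ᶠ x in 𝓝 p, X.1 x = (∑ i, smulOp F L k (f i) (C i)).1 x) ∧
      (X.1 p = 0 → ∀ i, (f i).1 p = 0) := by
  have : FiniteDimensional ℝ F := finiteDimensional_real K F
  let b := Module.finBasis K P
  choose C hC using fun i => exists_section_eventuallyEq_const (K := K) (m := m) k he hp (b i : F)
  choose w h_ker using fun i => LinearMap.exists_extend (b.coord i)
  have hf : ∀ i, ContMDiffOn (𝓡 m) 𝓘(ℝ, K) k (fun x => w i (localForm e X.1 x)) e.baseSet :=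
    fun i x hx => contMDiffWithinAt_linear ((w i).restrictScalars ℝ) (contMDiffOn_localForm X he x hx)
  choose f hfx using fun i => exists_ckFunctions_eventuallyEq (e.open_baseSet.mem_nhds hp) (hf i)
  refine ⟨_, f, C, fun i => b i, fun i => (b i).2, hC, ?_, ?_⟩
  · filter_upwards [hX, eventually_all.2 hC, eventually_all.2 hfx, e.open_baseSet.mem_nhds hp]
      with x hxP hxC hxf hxe
    apply (chartLieEquiv K e he hxe).injective
    change chartLieEquiv K e he hxe _ = chartLieEquiv K e he hxe (evalAt m F k x _)
    rw [map_sum, map_sum]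
    have h1 : ∀ i, chartLieEquiv K e he hxe (evalAt m F k x (smulOp F L k (f i) (C i))) =
        b.coord i ⟨_, hxP⟩ • (b i : F) := fun i => by
      rw [evalAt_apply, smulOp_apply, map_smul, ← localForm_eq he hxe, hxC, hxf, ← h_ker]
      rfl
    simp only [h1]
    rw [← localForm_eq he hxe]
    have h2 := congrArg (P.subtype) (b.sum_repr ⟨_, hxP⟩)
    rw [map_sum] at h2
    exact h2.symm
  · intro h0 i
    rw [(hfx i).self_of_nhds, localForm_eq he hp (K := K), h0, map_zero, map_zero]

end Decomposition

/-! ### Sections of finite differentiability class -/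

section FiniteClass

open Topology Filter

variable {K : Type*} [RCLike K] {m n : ℕ}
  {M : Type*} [TopologicalSpace M] [ChartedSpace (EuclideanSpace ℝ (Fin m)) M]
  {N : Type*} [TopologicalSpace N] [ChartedSpace (EuclideanSpace ℝ (Fin n)) N]
  {F : Type*} [NormedLieRing F] [NormedSpace ℝ F] [LieAlgebra K F] [IsScalarTower ℝ K F]
  [FiniteDimensional K F]
  {L : M → Type*} [∀ x, LieRing (L x)] [∀ x, LieAlgebra K (L x)] [∀ x, Module ℝ (L x)]
  [∀ x, IsScalarTower ℝ K (L x)]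
  [∀ x, TopologicalSpace (L x)] [TopologicalSpace (TotalSpace F L)]
  [FiberBundle F L] [VectorBundle ℝ F L] [ContMDiffVectorBundle ∞ F L (𝓡 m)]
  [IsLieAlgebraBundle K F L]
  {G : Type*} [NormedLieRing G] [NormedSpace ℝ G] [LieAlgebra K G] [IsScalarTower ℝ K G]
  [FiniteDimensional K G]
  {E : N → Type*} [∀ y, LieRing (E y)] [∀ y, LieAlgebra K (E y)] [∀ y, Module ℝ (E y)]
  [∀ y, IsScalarTower ℝ K (E y)]
  [∀ y, TopologicalSpace (E y)] [TopologicalSpace (TotalSpace G E)]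
  [FiberBundle G E] [VectorBundle ℝ G E] [ContMDiffVectorBundle ∞ G E (𝓡 n)]
  [IsLieAlgebraBundle K G E]
  [IsManifold (𝓡 m) ∞ M] [T2Space M] [SigmaCompactSpace M] [Nontrivial F]
  [IsManifold (𝓡 n) ∞ N] [T2Space N] [SigmaCompactSpace N] [Nontrivial G]
  {k l : ℕ∞} {hF : HasLocalCentroid K F} {hG : HasLocalCentroid K G}
  {μ : ckSections K m F L k ≃ₗ⁅K⁆ ckSections K n G E l} {σ : N → M} {τ : M → N}

theorem mem_nilFiltration_iff_localForm
    {e : Trivialization F (TotalSpace.proj : TotalSpace F L → M)}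
    (he : e ∈ FiberBundle.trivializationAtlas F L) {x : M} (hx : x ∈ e.baseSet) {v : L x} {r : ℕ} :
    v ∈ nilFiltration K (L x) r ↔ chartLieEquiv K e he hx v ∈ nilFiltration K F r := by
  refine ⟨fun h => equiv_mem_nilFiltration _ h, fun h => ?_⟩
  have h1 := equiv_mem_nilFiltration (chartLieEquiv K e he hx).symm h
  rwa [LieEquiv.symm_apply_apply] at h1

/-- The nilpotent part of the action of the function `f` on the fiber over `q`. -/
noncomputable def symbolDefect (hG : HasLocalCentroid K G)
    (μ : ckSections K m F L k ≃ₗ⁅K⁆ ckSections K n G E l) (σ : N → M) (q : N) :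
    ckFunctions K m M k →ₗ[K] Module.End K (E q) where
  toFun f := transportedSmul hG μ q f - f.1 (σ q) • 1
  map_add' f g := by
    rw [map_add]
    change _ - (f.1 (σ q) + g.1 (σ q)) • _ = _
    rw [add_smul, add_sub_add_comm]
  map_smul' c f := by
    rw [map_smul]
    change _ - (c * f.1 (σ q)) • _ = c • _
    rw [mul_smul, smul_sub]

/-- A twisted Leibniz rule: up to the product of the two nilpotent parts, `f ↦ symbolDefect f` is a
derivation along the evaluation at `σ q`. -/
theorem symbolDefect_mul (q : N) (f g : ckFunctions K m M k) :
    symbolDefect hG μ σ q (f * g) = symbolDefect hG μ σ q f * symbolDefect hG μ σ q g +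
      (f.1 (σ q) • symbolDefect hG μ σ q g + g.1 (σ q) • symbolDefect hG μ σ q f) := by
  change transportedSmul hG μ q (f * g) - (f.1 (σ q) * g.1 (σ q)) • 1 =
    (transportedSmul hG μ q f - f.1 (σ q) • 1) * (transportedSmul hG μ q g - g.1 (σ q) • 1) +
    (f.1 (σ q) • (transportedSmul hG μ q g - g.1 (σ q) • 1) +
      g.1 (σ q) • (transportedSmul hG μ q f - f.1 (σ q) • 1))
  rw [map_mul]
  simp only [sub_mul, mul_sub, smul_mul_assoc, mul_smul_comm, one_mul, mul_one, smul_sub, mul_smul,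
    smul_comm (g.1 (σ q)) (f.1 (σ q))]
  abel

theorem Covers.symbolDefect_mem (hσ : Covers hF hG μ σ) (q : N) (f : ckFunctions K m M k) :
    symbolDefect hG μ σ q f ∈ nilpotentCentroid K (E q) :=
  hσ.transportedSmul_sub_mem q f

/-- The nilpotent parts of the actions of `f` on the fibers come from a centroid element. -/
theorem Covers.exists_symbolDefect_eq (hσ : Covers hF hG μ σ) (f : ckFunctions K m M k) :
    ∃ S : Module.End K (ckSections K n G E l), ∀ Y q, symbolDefect hG μ σ q f (Y.1 q) = (S Y).1 q := by
  refine ⟨(lieCentroidEquiv μ (smulCentroid F L k f)).1 -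
    smulOp G E l ⟨_, hσ.comp_mem_ckFunctions f⟩, fun Y q => ?_⟩
  change transportedSmul hG μ q f (Y.1 q) - f.1 (σ q) • Y.1 q = _ - f.1 (σ q) • Y.1 q
  congr 1
  exact hG.fiberHom_apply q _ Y

/-- A function supported in the domain `V` of a `C^k` function, times that function. -/
theorem smul_mem_ckFunctions_of_tsupport {b : M → ℝ} (hb : ContMDiff (𝓡 m) 𝓘(ℝ, ℝ) ∞ b) {V : Set M}
    (hV : IsOpen V) (hbV : tsupport b ⊆ V) {h : M → K} (hh : ContMDiffOn (𝓡 m) 𝓘(ℝ, K) k h V) :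
    (fun x => b x • h x) ∈ ckFunctions K m M k := by
  refine contMDiff_of_tsupport fun x hx => ?_
  have hxV : x ∈ V := hbV (tsupport_smul_subset_left b h hx)
  exact ((hb x).of_le (mod_cast le_top)).smul ((hh x hxV).contMDiffAt (hV.mem_nhds hxV))

/-- In finite differentiability the nilpotent parts lower the filtration arbitrarily much, because
modulo a deeper step of the filtration they are derivations of the algebra of functions. -/
theorem Covers.symbolDefect_apply_mem {μ : ckSections K m F L k ≃ₗ⁅K⁆ ckSections K n G E k}
    (hσ : Covers hF hG μ σ)
    (hτ : Covers hG hF μ.symm τ) (hm : 0 < m) (hk : k ≠ 0) (hk' : k ≠ ⊤) (r : ℕ) :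
    ∀ (q : N) (f : ckFunctions K m M k) (s : ℕ), ∀ u ∈ nilFiltration K (E q) s,
      symbolDefect hG μ σ q f u ∈ nilFiltration K (E q) (s + (r + 1)) := by
  induction r with
  | zero => exact fun q f s u hu => apply_mem_nilFiltration_succ (hσ.symbolDefect_mem q f) hu
  | succ r ih =>
    intro q f s u hu
    set e := trivializationAt G E q with he_def
    have hq : q ∈ e.baseSet := FiberBundle.mem_baseSet_trivializationAt G E q
    have he : e ∈ FiberBundle.trivializationAtlas G E := FiberBundle.trivialization_mem_atlas G E q
    rw [mem_nilFiltration_iff_localForm he hq]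
    by_contra hcon
    obtain ⟨w, h_ker, h_kerQ⟩ := Submodule.exists_le_ker_of_notMem hcon
    set c := chartLieEquiv K e he hq u with hc
    have hcs : c ∈ nilFiltration K G s := (mem_nilFiltration_iff_localForm he hq).1 hu
    obtain ⟨X, hX⟩ := exists_section_eventuallyEq_const (K := K) (m := n) k he hq c
    obtain ⟨V, hVX, hVo, hqV⟩ := eventually_nhds_iff.1 (hX.and (e.open_baseSet.mem_nhds hq))
    obtain ⟨b, hb, hb1, hbV⟩ := exists_bump (m := n) q (hVo.mem_nhds hqV)
    have hb0 : ∀ y ∉ V, b y = 0 := fun y hy => image_eq_zero_of_notMem_tsupport fun h => hy (hbV h)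
    -- the functional `w`, applied to the action of functions on `X` near `q`
    let θ : ckFunctions K m M k → N → K := fun g y =>
      b y • w (e ⟨y, symbolDefect hG μ σ y g (X.1 y)⟩).2
    have hθV : ∀ g, ∀ y (hy : y ∈ V), θ g y =
        b y • w (chartLieEquiv K e he (hVX y hy).2 (symbolDefect hG μ σ y g (X.1 y))) :=
      fun g y hy => rfl
    have hθ0 : ∀ g, ∀ y ∉ V, θ g y = 0 := fun g y hy => by
      change b y • _ = _
      rw [hb0 y hy, zero_smul]
    have hθ : ∀ g, θ g ∈ ckFunctions K n N k := by
      intro g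
      obtain ⟨S, hS⟩ := hσ.exists_symbolDefect_eq g
      refine smul_mem_ckFunctions_of_tsupport hb hVo hbV fun y hy => ?_
      have : FiniteDimensional ℝ G := finiteDimensional_real K G
      refine contMDiffWithinAt_linear (w.restrictScalars ℝ) ?_
      simp only [hS]
      exact (contMDiffOn_localForm (S X) he).mono (fun y hy => (hVX y hy).2) y hy
    have hadd : ∀ g h, θ (g + h) = θ g + θ h := fun g h => funext fun y => by
      by_cases hy : y ∈ V
      · simp only [hθV _ y hy, Pi.add_apply, map_add, LinearMap.add_apply, smul_add]
      · simp only [hθ0 _ y hy, Pi.add_apply, add_zero]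
    have hsmul : ∀ (a : K) g, θ (a • g) = a • θ g := fun a g => funext fun y => by
      by_cases hy : y ∈ V
      · simp only [hθV _ y hy, Pi.smul_apply, map_smul, LinearMap.smul_apply]
        rw [smul_comm]
      · simp only [hθ0 _ y hy, Pi.smul_apply, smul_zero]
    have hmul : ∀ g h y, θ (g * h) y = g.1 (σ y) * θ h y + h.1 (σ y) * θ g y := fun g h y => by
      by_cases hy : y ∈ V
      · simp only [hθV _ y hy]
        have hXy : X.1 y ∈ nilFiltration K (E y) s := by
          rw [mem_nilFiltration_iff_localForm he (hVX y hy).2, ← localForm_eq he, (hVX y hy).1]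
          exact hcs
        have h1 : w (chartLieEquiv K e he (hVX y hy).2
            (symbolDefect hG μ σ y g (symbolDefect hG μ σ y h (X.1 y)))) = 0 := by
          refine h_kerQ ?_
          rw [← mem_nilFiltration_iff_localForm]
          exact nilFiltration_antitone (by omega) (ih y g _ _ (ih y h s _ hXy))
        rw [symbolDefect_mul, LinearMap.add_apply, Module.End.mul_apply, map_add, map_add, h1,
          zero_add, LinearMap.add_apply, LinearMap.smul_apply, LinearMap.smul_apply, map_add,
          map_add, map_smul, map_smul, map_smul, map_smul, smul_add, smul_eq_mul, smul_eq_mul,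
          mul_smul_comm, mul_smul_comm]
      · simp only [hθ0 _ y hy, mul_zero, add_zero]
    have hτσ : ∀ x, σ (τ x) = x := hτ.comp_eq hσ
    let δ : Derivation K (ckFunctions K m M k) (ckFunctions K m M k) := Derivation.mk'
      { toFun := fun g => ⟨_, hτ.comp_mem_ckFunctions ⟨_, hθ g⟩⟩
        map_add' := fun g h => Subtype.ext (funext fun x => congrFun (hadd g h) (τ x))
        map_smul' := fun a g => Subtype.ext (funext fun x => congrFun (hsmul a g) (τ x)) }
      (fun g h => Subtype.ext (funext fun x => by
        have h1 := hmul g h (τ x)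
        rw [hτσ x] at h1
        exact h1))
    have h1 := congrArg (fun D : Derivation K (ckFunctions K m M k) (ckFunctions K m M k) =>
      (D f).1 (σ q)) (derivation_eq_zero hm hk hk' δ)
    have h2 : θ f (τ (σ q)) = 0 := h1
    rw [hσ.comp_eq hτ, hθV _ _ hqV, hb1.self_of_nhds, one_smul] at h2
    have h3 : X.1 q = u := (chartLieEquiv K e he hq).injective hX.self_of_nhds
    rw [h3] at h2
    exact h_ker h2

/-- In finite differentiability, `μ` is linear over the algebras of functions, along `σ`. -/
theorem Covers.transportedSmul_eq {μ : ckSections K m F L k ≃ₗ⁅K⁆ ckSections K n G E k}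
    (hσ : Covers hF hG μ σ)
    (hτ : Covers hG hF μ.symm τ) (hm : 0 < m) (hk : k ≠ 0) (hk' : k ≠ ⊤) (q : N)
    (f : ckFunctions K m M k) : transportedSmul hG μ q f = f.1 (σ q) • 1 := by
  refine sub_eq_zero.1 (LinearMap.ext fun u => ?_)
  have h1 := hσ.symbolDefect_apply_mem hτ hm hk hk' (Module.finrank K (E q)) q f 0 u trivial
  have := fiber_finiteDimensional K G (L := E) q
  rw [(hG.fiber q).nilFiltration_eq_bot (by omega)] at h1
  exact (Submodule.mem_bot K).1 h1

/-- In finite differentiability, isomorphisms of Lie algebras of sections act pointwise. -/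
theorem Covers.apply_eq_zero_of_apply_eq_zero
    {μ : ckSections K m F L k ≃ₗ⁅K⁆ ckSections K n G E k} (hσ : Covers hF hG μ σ)
    (hτ : Covers hG hF μ.symm τ) (hm : 0 < m) (hk : k ≠ 0) (hk' : k ≠ ⊤) {q : N}
    {X : ckSections K m F L k} (hX : X.1 (σ q) = 0) : (μ X).1 q = 0 := by
  obtain ⟨r, f, C, c, -, -, hX', hf⟩ := exists_eventually_eq_sum_smulOp (P := ⊤) (X := X)
    (FiberBundle.trivialization_mem_atlas F L (σ q))
    (FiberBundle.mem_baseSet_trivializationAt F L (σ q)) (Eventually.of_forall fun _ => trivial)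
  rw [hσ.apply_congr hX', map_sum]
  change evalAt n G k q _ = 0
  rw [map_sum]
  refine Finset.sum_eq_zero fun i _ => ?_
  rw [evalAt_apply, ← transportedSmul_apply (hG := hG), hσ.transportedSmul_eq hτ hm hk hk',
    hf hX i, zero_smul, LinearMap.zero_apply]

end FiniteClass

/-! ### Isomorphisms of bundles from pointwise operators -/

section Pointwise

open Topology Filter

variable {K : Type*} [RCLike K] {m n : ℕ}
  {M : Type*} [TopologicalSpace M] [ChartedSpace (EuclideanSpace ℝ (Fin m)) M]
  {N : Type*} [TopologicalSpace N] [ChartedSpace (EuclideanSpace ℝ (Fin n)) N]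
  {F : Type*} [NormedLieRing F] [NormedSpace ℝ F] [LieAlgebra K F] [IsScalarTower ℝ K F]
  [FiniteDimensional K F]
  {L : M → Type*} [∀ x, LieRing (L x)] [∀ x, LieAlgebra K (L x)] [∀ x, Module ℝ (L x)]
  [∀ x, IsScalarTower ℝ K (L x)]
  [∀ x, TopologicalSpace (L x)] [TopologicalSpace (TotalSpace F L)]
  [FiberBundle F L] [VectorBundle ℝ F L] [ContMDiffVectorBundle ∞ F L (𝓡 m)]
  [IsLieAlgebraBundle K F L]
  {G : Type*} [NormedLieRing G] [NormedSpace ℝ G] [LieAlgebra K G] [IsScalarTower ℝ K G]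
  [FiniteDimensional K G]
  {E : N → Type*} [∀ y, LieRing (E y)] [∀ y, LieAlgebra K (E y)] [∀ y, Module ℝ (E y)]
  [∀ y, IsScalarTower ℝ K (E y)]
  [∀ y, TopologicalSpace (E y)] [TopologicalSpace (TotalSpace G E)]
  [FiberBundle G E] [VectorBundle ℝ G E] [ContMDiffVectorBundle ∞ G E (𝓡 n)]
  [IsLieAlgebraBundle K G E]
  [IsManifold (𝓡 m) ∞ M] [T2Space M] [IsManifold (𝓡 n) ∞ N] [T2Space N] {k : ℕ∞}

/-- The map of fibers `L x → E (τ x)` induced by an operator `T` such that `T X` at `τ x` depends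
only on `X` at `x`. -/
noncomputable def pointMap (T : ckSections K m F L k →ₗ[K] ckSections K n G E k) (τ : M → N)
    (x : M) : L x →ₗ[K] E (τ x) :=
  evalAt n G k (τ x) ∘ₗ T ∘ₗ
    Classical.choose (LinearMap.exists_rightInverse_of_surjective _ (range_evalAt k x))

variable {T : ckSections K m F L k →ₗ[K] ckSections K n G E k} {τ : M → N}

theorem pointMap_apply (hT : ∀ X x, X.1 x = 0 → (T X).1 (τ x) = 0) (X : ckSections K m F L k)
    (x : M) : pointMap T τ x (X.1 x) = (T X).1 (τ x) := by
  have hr := Classical.choose_spec (LinearMap.exists_rightInverse_of_surjective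
    (evalAt m F k x : ckSections K m F L k →ₗ[K] L x) (range_evalAt k x))
  set R := Classical.choose (LinearMap.exists_rightInverse_of_surjective
    (evalAt m F k x : ckSections K m F L k →ₗ[K] L x) (range_evalAt k x))
  change (T (R (X.1 x))).1 (τ x) = (T X).1 (τ x)
  have h2 := hT (R (X.1 x) - X) x (sub_eq_zero.2 (LinearMap.congr_fun hr (X.1 x)))
  rw [map_sub] at h2
  exact sub_eq_zero.1 h2

theorem contMDiff_pointMap (hT : ∀ X x, X.1 x = 0 → (T X).1 (τ x) = 0)
    (hτ : ContMDiff (𝓡 m) (𝓡 n) k τ) :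
    ContMDiff ((𝓡 m).prod 𝓘(ℝ, F)) ((𝓡 n).prod 𝓘(ℝ, G)) k
      fun p : TotalSpace F L => TotalSpace.mk' G (τ p.1) (pointMap T τ p.1 p.2) := by
  have : ContMDiffVectorBundle k F L (𝓡 m) := .of_le (n := ∞) (mod_cast le_top)
  have : ContMDiffVectorBundle k G E (𝓡 n) := .of_le (n := ∞) (mod_cast le_top)
  have : FiniteDimensional ℝ F := finiteDimensional_real K F
  have : FiniteDimensional ℝ G := finiteDimensional_real K G
  intro p₀
  have hproj : ContMDiffAt ((𝓡 m).prod 𝓘(ℝ, F)) (𝓡 m) k (TotalSpace.proj (F := F) (E := L)) p₀ :=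
    contMDiff_proj L p₀
  rw [contMDiffAt_totalSpace]
  refine ⟨(hτ p₀.1).comp p₀ hproj, ?_⟩
  set e := trivializationAt F L p₀.1 with he_def
  set e' := trivializationAt G E (τ p₀.1) with he'_def
  have he : e ∈ FiberBundle.trivializationAtlas F L := FiberBundle.trivialization_mem_atlas F L p₀.1
  have he' : e' ∈ FiberBundle.trivializationAtlas G E :=
    FiberBundle.trivialization_mem_atlas G E (τ p₀.1)
  have hp : p₀.1 ∈ e.baseSet := FiberBundle.mem_baseSet_trivializationAt F L p₀.1
  have hp' : τ p₀.1 ∈ e'.baseSet := FiberBundle.mem_baseSet_trivializationAt G E (τ p₀.1)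
  -- express the vectors near `p₀` in a frame of sections that are constant in a chart
  let b := Module.finBasis K F
  choose C hC using fun i => exists_section_eventuallyEq_const (K := K) (m := m) k he hp (b i)
  have hsnd : ContMDiffAt ((𝓡 m).prod 𝓘(ℝ, F)) 𝓘(ℝ, F) k (fun p : TotalSpace F L => (e p).2) p₀ :=
    (contMDiffAt_totalSpace.1 (contMDiffAt_id (x := p₀))).2
  have hcoord : ∀ i, ContMDiffAt ((𝓡 m).prod 𝓘(ℝ, F)) 𝓘(ℝ, K) k
      (fun p : TotalSpace F L => b.coord i (e p).2) p₀ := fun i =>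
    ((LinearMap.toContinuousLinearMap ((b.coord i).restrictScalars ℝ)).contDiff.contDiffAt.contMDiffAt
      ).comp p₀ hsnd
  have himg : ∀ i, ContMDiffAt ((𝓡 m).prod 𝓘(ℝ, F)) 𝓘(ℝ, G) k
      (fun p : TotalSpace F L => localForm e' (T (C i)).1 (τ p.1)) p₀ := fun i =>
    ContMDiffAt.comp (g := localForm e' (T (C i)).1) p₀
      ((contMDiffAt_section_iff_localForm he' hp').1 ((T (C i)).2 _)) ((hτ p₀.1).comp p₀ hproj)
  have hsmul : ContDiff ℝ k fun q : K × G => realSMul K G q.1 q.2 :=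
    (LinearMap.toContinuousLinearMap ((LinearMap.toContinuousLinearMap :
      (G →ₗ[ℝ] G) ≃ₗ[ℝ] (G →L[ℝ] G)).toLinearMap ∘ₗ realSMul K G)).isBoundedBilinearMap.contDiff
  have hsum : ContMDiffAt ((𝓡 m).prod 𝓘(ℝ, F)) 𝓘(ℝ, G) k
      (fun p : TotalSpace F L => ∑ i, b.coord i (e p).2 • localForm e' (T (C i)).1 (τ p.1)) p₀ :=
    ContMDiffAt.sum fun i _ => hsmul.contDiffAt.contMDiffAt.comp p₀
      ((hcoord i).prodMk_space (himg i))
  refine hsum.congr_of_eventuallyEq ?_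
  have hev : ∀ᶠ x in 𝓝 p₀.1, (∀ i, localForm e (C i).1 x = b i) ∧ x ∈ e.baseSet ∧
      τ x ∈ e'.baseSet :=
    (eventually_all.2 hC).and ((e.open_baseSet.eventually_mem hp).and
      (hτ.continuous.continuousAt (e'.open_baseSet.mem_nhds hp')))
  filter_upwards [hproj.continuousAt.eventually hev] with p hpx
  obtain ⟨h1, h2, h3⟩ := hpx
  have h4 : p.2 = ∑ i, b.coord i (e p).2 • (C i).1 p.1 := by
    apply (chartLieEquiv K e he h2).injective
    change chartLieEquiv K e he h2 _ = chartLieEquiv K e he h2 _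
    rw [map_sum]
    simp only [map_smul, ← localForm_eq he h2, h1]
    exact (b.sum_repr _).symm
  change chartLieEquiv K e' he' h3 (pointMap T τ p.1 p.2) = _
  conv_lhs => rw [h4]
  rw [map_sum, map_sum]
  simp only [map_smul, pointMap_apply hT]
  rfl

end Pointwise

section BundleIso

open Topology Filter

variable {K : Type*} [RCLike K] {m n : ℕ}
  {M : Type*} [TopologicalSpace M] [ChartedSpace (EuclideanSpace ℝ (Fin m)) M]
  {N : Type*} [TopologicalSpace N] [ChartedSpace (EuclideanSpace ℝ (Fin n)) N]
  {F : Type*} [NormedLieRing F] [NormedSpace ℝ F] [LieAlgebra K F] [IsScalarTower ℝ K F]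
  [FiniteDimensional K F]
  {L : M → Type*} [∀ x, LieRing (L x)] [∀ x, LieAlgebra K (L x)] [∀ x, Module ℝ (L x)]
  [∀ x, IsScalarTower ℝ K (L x)]
  [∀ x, TopologicalSpace (L x)] [TopologicalSpace (TotalSpace F L)]
  [FiberBundle F L] [VectorBundle ℝ F L] [ContMDiffVectorBundle ∞ F L (𝓡 m)]
  [IsLieAlgebraBundle K F L]
  {G : Type*} [NormedLieRing G] [NormedSpace ℝ G] [LieAlgebra K G] [IsScalarTower ℝ K G]
  [FiniteDimensional K G]
  {E : N → Type*} [∀ y, LieRing (E y)] [∀ y, LieAlgebra K (E y)] [∀ y, Module ℝ (E y)]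
  [∀ y, IsScalarTower ℝ K (E y)]
  [∀ y, TopologicalSpace (E y)] [TopologicalSpace (TotalSpace G E)]
  [FiberBundle G E] [VectorBundle ℝ G E] [ContMDiffVectorBundle ∞ G E (𝓡 n)]
  [IsLieAlgebraBundle K G E]
  [IsManifold (𝓡 m) ∞ M] [T2Space M] [SigmaCompactSpace M] [Nontrivial F]
  [IsManifold (𝓡 n) ∞ N] [T2Space N] [SigmaCompactSpace N] [Nontrivial G]
  {k : ℕ∞} {hF : HasLocalCentroid K F} {hG : HasLocalCentroid K G}
  {μ : ckSections K m F L k ≃ₗ⁅K⁆ ckSections K n G E k} {σ : N → M} {τ : M → N}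

/-- The diffeomorphism of base manifolds covered by an isomorphism of Lie algebras of sections. -/
def Covers.diffeomorph (hσ : Covers hF hG μ σ) (hτ : Covers hG hF μ.symm τ) :
    Diffeomorph (𝓡 m) (𝓡 n) M N k where
  toFun := τ
  invFun := σ
  left_inv := hτ.comp_eq hσ
  right_inv := hσ.comp_eq hτ
  contMDiff_toFun := hτ.contMDiff
  contMDiff_invFun := hσ.contMDiff

/-- In finite differentiability, `μ` is the push-forward by an isomorphism of bundles of Lie algebras. -/
theorem Covers.exists_bundleIso (hσ : Covers hF hG μ σ) (hτ : Covers hG hF μ.symm τ) (hm : 0 < m)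
    (hn : 0 < n) (hk : k ≠ 0) (hk' : k ≠ ⊤) :
    ∃ κ : CkVectorBundleIso K m n F L G E k,
      (∀ (X : ckSections K m F L k) (y : N), TotalSpace.mk' G y ((μ X).1 y) =
        κ.total (TotalSpace.mk' F (κ.base.symm y) (X.1 (κ.base.symm y)))) ∧
      ∀ x v w, κ.fiber x ⁅v, w⁆ = ⁅κ.fiber x v, κ.fiber x w⁆ := by
  have hτσ : ∀ x, σ (τ x) = x := hτ.comp_eq hσ
  have hστ : ∀ y, τ (σ y) = y := hσ.comp_eq hτ
  let T : ckSections K m F L k →ₗ[K] ckSections K n G E k := μ.toLinearEquiv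
  let T' : ckSections K n G E k →ₗ[K] ckSections K m F L k := μ.symm.toLinearEquiv
  have hT : ∀ X x, X.1 x = 0 → (T X).1 (τ x) = 0 := fun X x hX =>
    hσ.apply_eq_zero_of_apply_eq_zero hτ hm hk hk' (by rwa [hτσ])
  have hT' : ∀ Y y, Y.1 y = 0 → (T' Y).1 (σ y) = 0 := fun Y y hY =>
    hτ.apply_eq_zero_of_apply_eq_zero (μ := μ.symm) hσ hn hk hk' (by rwa [hστ])
  have hT'T : ∀ X, T' (T X) = X := fun X => μ.symm_apply_apply X
  have hTT' : ∀ Y, T (T' Y) = Y := fun Y => μ.apply_symm_apply Y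
  have hmk : ∀ (X : ckSections K m F L k) x,
      TotalSpace.mk' F (σ (τ x)) (X.1 (σ (τ x))) = TotalSpace.mk' F x (X.1 x) := fun X x =>
    congrArg (fun z => TotalSpace.mk' F z (X.1 z)) (hτσ x)
  have hmk' : ∀ (Y : ckSections K n G E k) y,
      TotalSpace.mk' G (τ (σ y)) (Y.1 (τ (σ y))) = TotalSpace.mk' G y (Y.1 y) := fun Y y =>
    congrArg (fun z => TotalSpace.mk' G z (Y.1 z)) (hστ y)
  have hbij : ∀ x, Function.Bijective (pointMap T τ x) := by
    intro x
    constructor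
    · refine (injective_iff_map_eq_zero _).2 fun v hv => ?_
      obtain ⟨X, rfl⟩ := exists_section_apply_eq K m F k x v
      rw [pointMap_apply hT] at hv
      have h1 := hT' (T X) (τ x) hv
      rw [hT'T, hτσ] at h1
      exact h1
    · intro w
      obtain ⟨Y, rfl⟩ := exists_section_apply_eq K n G k (τ x) w
      exact ⟨(T' Y).1 x, by rw [pointMap_apply hT, hTT']⟩
  let Φ : TotalSpace F L ≃ TotalSpace G E :=
    { toFun := fun p => TotalSpace.mk' G (τ p.1) (pointMap T τ p.1 p.2)
      invFun := fun p => TotalSpace.mk' F (σ p.1) (pointMap T' σ p.1 p.2)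
      left_inv := by
        rintro ⟨x, v⟩
        obtain ⟨X, rfl⟩ := exists_section_apply_eq K m F k x v
        change TotalSpace.mk' F (σ (τ x)) (pointMap T' σ (τ x) (pointMap T τ x (X.1 x))) = _
        rw [pointMap_apply hT, pointMap_apply hT', hT'T]
        exact hmk X x
      right_inv := by
        rintro ⟨y, w⟩
        obtain ⟨Y, rfl⟩ := exists_section_apply_eq K n G k y w
        change TotalSpace.mk' G (τ (σ y)) (pointMap T τ (σ y) (pointMap T' σ y (Y.1 y))) = _
        rw [pointMap_apply hT', pointMap_apply hT, hTT']
        exact hmk' Y y }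
  refine ⟨⟨hσ.diffeomorph hτ, ⟨Φ, contMDiff_pointMap hT hτ.contMDiff,
    contMDiff_pointMap hT' hσ.contMDiff⟩, fun x => LinearEquiv.ofBijective _ (hbij x),
    fun x v => rfl⟩, fun X y => ?_, fun x v w => ?_⟩
  · change _ = TotalSpace.mk' G (τ (σ y)) (pointMap T τ (σ y) (X.1 (σ y)))
    rw [pointMap_apply hT]
    exact (hmk' (T X) y).symm
  · change pointMap T τ x ⁅v, w⁆ = ⁅pointMap T τ x v, pointMap T τ x w⁆
    obtain ⟨X, rfl⟩ := exists_section_apply_eq K m F k x v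
    obtain ⟨Y, rfl⟩ := exists_section_apply_eq K m F k x w
    rw [← lie_apply_section, pointMap_apply hT, pointMap_apply hT, pointMap_apply hT]
    have h1 : T ⁅X, Y⁆ = ⁅T X, T Y⁆ := μ.map_lie X Y
    rw [h1]
    rfl

/-- A fiberwise isomorphism of Lie algebras gives one of the typical fibers. -/
theorem nonempty_typicalFiber_equiv {x : M} {y : N} (κ : L x ≃ₗ[K] E y)
    (hκ : ∀ v w, κ ⁅v, w⁆ = ⁅κ v, κ w⁆) : Nonempty (F ≃ₗ⁅K⁆ G) :=
  let κ' : L x ≃ₗ⁅K⁆ E y := { κ with map_lie' := hκ _ _ }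
  ⟨((chartLieEquiv K _ (FiberBundle.trivialization_mem_atlas F L x)
    (FiberBundle.mem_baseSet_trivializationAt F L x)).symm.trans κ').trans
    (chartLieEquiv K _ (FiberBundle.trivialization_mem_atlas G E y)
    (FiberBundle.mem_baseSet_trivializationAt G E y))⟩

end BundleIso

/-! ### Powers with multi-indices -/

section MultiPow

theorem multiPow_zero_left {R : Type*} [Monoid R] (N : Fin 0 → R) (α : Fin 0 → ℕ) :
    multiPow N α = 1 := by
  simp [multiPow]

theorem multiPow_succ {R : Type*} [Monoid R] {m : ℕ} (N : Fin (m + 1) → R) (α : Fin (m + 1) → ℕ) :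
    multiPow N α = N 0 ^ α 0 * multiPow (fun i => N i.succ) fun i => α i.succ := by
  simp [multiPow, List.ofFn_succ]

theorem multiPow_zero {R : Type*} [Monoid R] {m : ℕ} (N : Fin m → R) :
    multiPow N (0 : Fin m → ℕ) = 1 := by
  induction m with
  | zero => exact multiPow_zero_left _ _
  | succ m ih =>
    rw [multiPow_succ, Pi.zero_apply, pow_zero, one_mul]
    exact ih _

theorem commute_multiPow {R : Type*} [Monoid R] {m : ℕ} {N : Fin m → R} {u : R}
    (h : ∀ i, Commute (N i) u) (α : Fin m → ℕ) : Commute (multiPow N α) u := by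
  induction m with
  | zero => rw [multiPow_zero_left]; exact Commute.one_left u
  | succ m ih =>
    rw [multiPow_succ]
    exact ((h 0).pow_left _).mul_left (ih (fun i => h i.succ) _)

/-- The commutation rule of `Dᵅ` with an operator `u` that commutes with all the `Dⱼ`, except for
`[Dᵢ, u] = 1`. -/
theorem multiPow_mul_of_commutator {R : Type*} [Ring R] {m : ℕ} {D : Fin m → R} {u : R} {i : Fin m}
    (hi : D i * u = u * D i + 1) (hj : ∀ j, j ≠ i → Commute (D j) u) (α : Fin m → ℕ) :
    multiPow D α * u = u * multiPow D α + α i • multiPow D (α - Pi.single i 1) := by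
  induction m with
  | zero => exact i.elim0
  | succ m ih =>
    rw [multiPow_succ D α, multiPow_succ D (α - _)]
    induction i using Fin.cases with
    | zero =>
      have h1 : Commute (multiPow (fun i => D i.succ) fun i => α i.succ) u :=
        commute_multiPow (fun j => hj j.succ (Fin.succ_ne_zero j)) _
      have h2 : ∀ a : ℕ, D 0 ^ a * u = u * D 0 ^ a + a • D 0 ^ (a - 1) := by
        intro a
        induction a with
        | zero => simp
        | succ a iha =>
          rcases a with _ | a
          · simpa using hi
          · rw [pow_succ', mul_assoc, iha, mul_add, ← mul_assoc, hi, add_mul, one_mul, mul_assoc,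
              ← pow_succ', add_assoc, mul_smul_comm, ← pow_succ', succ_nsmul (n := a + 1)]
            congr 1
            rw [add_comm]
            rfl
      have h3 : (fun i : Fin m => (α - Pi.single 0 1 : Fin (m + 1) → ℕ) i.succ) = fun i => α i.succ :=
        funext fun i => by simp
      rw [mul_assoc, h1.eq, ← mul_assoc, h2, add_mul, mul_assoc, h3, smul_mul_assoc]
      simp
    | succ i =>
      have h1 : Commute (D 0 ^ α 0) u := (hj 0 (Fin.succ_ne_zero i).symm).pow_left _
      have h3 : (fun j : Fin m => (α - Pi.single i.succ 1 : Fin (m + 1) → ℕ) j.succ) =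
          (fun j => α j.succ) - Pi.single i 1 := funext fun j => by
        simp [Pi.single_apply]
      have h4 : (α - Pi.single i.succ 1 : Fin (m + 1) → ℕ) 0 = α 0 := by
        simp
      rw [mul_assoc, ih (D := fun j => D j.succ) hi
        (fun j hji => hj j.succ fun h => hji (Fin.succ_injective _ h)), mul_add, ← mul_assoc, h1.eq,
        mul_assoc, h3, h4, mul_smul_comm]

theorem multiPow_add_single {R : Type*} [Monoid R] {m : ℕ} {N : Fin m → R}
    (hN : ∀ i j, Commute (N i) (N j)) (α : Fin m → ℕ) (i : Fin m) :
    multiPow N (α + Pi.single i 1) = N i * multiPow N α := by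
  induction m with
  | zero => exact i.elim0
  | succ m ih =>
    rw [multiPow_succ N α, multiPow_succ N (α + _)]
    induction i using Fin.cases with
    | zero =>
      have h3 : (fun i : Fin m => (α + Pi.single 0 1 : Fin (m + 1) → ℕ) i.succ) = fun i => α i.succ :=
        funext fun i => by simp
      rw [h3, ← mul_assoc, ← pow_succ']
      simp
    | succ i =>
      have h3 : (fun j : Fin m => (α + Pi.single i.succ 1 : Fin (m + 1) → ℕ) j.succ) =
          (fun j => α j.succ) + Pi.single i 1 := funext fun j => by
        simp [Pi.single_apply]
      have h4 : (α + Pi.single i.succ 1 : Fin (m + 1) → ℕ) 0 = α 0 := by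
        simp
      rw [h3, h4, ih (N := fun j => N j.succ) (fun i j => hN i.succ j.succ), ← mul_assoc,
        ((hN 0 i.succ).pow_left (α 0)).eq, mul_assoc]

theorem multiFactorial_add_single {m : ℕ} (α : Fin m → ℕ) (i : Fin m) :
    multiFactorial (α + Pi.single i 1) = (α i + 1) * multiFactorial α := by
  have h1 : ∀ j, ((α + Pi.single i 1 : Fin m → ℕ) j).factorial =
      (if j = i then α i + 1 else 1) * (α j).factorial := by
    intro j
    by_cases h : j = i
    · subst h
      simp [Nat.factorial_succ]
    · simp [h]
  simp only [multiFactorial, h1]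
  rw [Finset.prod_mul_distrib, Finset.prod_ite_eq' Finset.univ i (fun _ => α i + 1)]
  simp

theorem multiFactorial_ne_zero {m : ℕ} (α : Fin m → ℕ) : multiFactorial α ≠ 0 :=
  Finset.prod_ne_zero_iff.2 fun _ _ => Nat.factorial_ne_zero _

end MultiPow

section NilpotentPow

variable {K V : Type*} [Field K] [LieRing V] [LieAlgebra K V]

theorem pow_apply_mem_nilFiltration {T : Module.End K V} (hT : T ∈ nilpotentCentroid K V) (a : ℕ)
    {s : ℕ} {v : V} (hv : v ∈ nilFiltration K V s) : (T ^ a) v ∈ nilFiltration K V (a + s) := by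
  induction a with
  | zero => simpa using hv
  | succ a ih =>
    rw [pow_succ', add_right_comm]
    exact apply_mem_nilFiltration_succ hT ih

theorem multiPow_apply_mem_nilFiltration {m : ℕ} {N : Fin m → Module.End K V}
    (hN : ∀ i, N i ∈ nilpotentCentroid K V) (α : Fin m → ℕ) (v : V) :
    multiPow N α v ∈ nilFiltration K V (∑ i, α i) := by
  induction m with
  | zero => simp [nilFiltration]
  | succ m ih =>
    rw [multiPow_succ, Fin.sum_univ_succ]
    exact pow_apply_mem_nilFiltration (hN 0) _ (ih (fun i => hN i.succ) fun i => α i.succ)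

/-- Reindexing `α = β + eᵢ` in a truncated exponential series: the terms that are cut off vanish. -/
theorem HasLocalCentroid.sum_multiIndices_smul_eq [CharZero K] [FiniteDimensional K V]
    (hV : HasLocalCentroid K V) {m d : ℕ} (hd : Module.finrank K V ≤ d)
    {N : Fin m → Module.End K V} (hN : ∀ i, N i ∈ nilpotentCentroid K V) (i : Fin m)
    (v : (Fin m → ℕ) → V) :
    ∑ α ∈ multiIndices m d, (multiFactorial α : K)⁻¹ • multiPow N α (α i • v (α - Pi.single i 1)) =
      N i (∑ β ∈ multiIndices m d, (multiFactorial β : K)⁻¹ • multiPow N β (v β)) := by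
  have hcomm : ∀ i j, Commute (N i) (N j) := fun i j => hV.commute (hN i).1 (hN j).1
  rw [map_sum]
  symm
  have hterm : ∀ β : Fin m → ℕ, N i ((multiFactorial β : K)⁻¹ • multiPow N β (v β)) =
      (multiFactorial β : K)⁻¹ • multiPow N (β + Pi.single i 1) (v β) := fun β => by
    rw [map_smul, multiPow_add_single hcomm]
    rfl
  refine Finset.sum_bij_ne_zero (fun β _ _ => β + Pi.single i 1) ?_ ?_ ?_ ?_
  · intro β hβ hne
    rw [mem_multiIndices]
    by_contra! hle
    apply hne
    have h1 := multiPow_apply_mem_nilFiltration hN (β + Pi.single i 1) (v β)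
    rw [hV.nilFiltration_eq_bot (hd.trans hle), Submodule.mem_bot] at h1
    rw [hterm, h1, smul_zero]
  · intro β _ _ γ _ _ h
    exact add_right_cancel h
  · intro α hα hne
    have hαi : α i ≠ 0 := fun h => hne (by rw [h, zero_smul, map_zero, smul_zero])
    have h1 : α - Pi.single i 1 + Pi.single i 1 = α := funext fun j => by
      by_cases h : j = i
      · subst h; simp; omega
      · simp [h]
    have hα' : α - Pi.single i 1 ∈ multiIndices m d := by
      rw [mem_multiIndices] at hα ⊢
      exact (Finset.sum_le_sum fun j _ => Nat.sub_le _ _).trans_lt hα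
    refine ⟨α - Pi.single i 1, hα', ?_, h1⟩
    rw [hterm, h1]
    intro h0
    apply hne
    rw [smul_eq_zero] at h0
    rcases h0 with h0 | h0
    · exact absurd h0 (inv_ne_zero (by exact_mod_cast multiFactorial_ne_zero _))
    · rw [map_nsmul, h0, smul_zero, smul_zero]
  · intro β hβ hne
    have h1 : β + Pi.single i 1 - Pi.single i 1 = β := add_tsub_cancel_right _ _
    rw [hterm, h1, multiFactorial_add_single, map_nsmul, ← Nat.cast_smul_eq_nsmul K, smul_smul]
    congr 1
    have h2 : ((β i + 1 : ℕ) : K) ≠ 0 := by exact_mod_cast Nat.succ_ne_zero (β i)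
    simp only [Pi.add_apply, Pi.single_eq_same]
    push_cast at h2 ⊢
    rw [mul_inv, mul_assoc, mul_comm, mul_assoc, mul_inv_cancel₀ h2, mul_one]

end NilpotentPow

/-! ### Partial derivatives of smooth functions -/

section Jets

open Topology Filter

variable (m : ℕ) (V : Type*) [NormedAddCommGroup V] [NormedSpace ℝ V]

/-- The space of smooth `V`-valued functions on the Euclidean space. -/
def smoothFunctions : Submodule ℝ (EuclideanSpace ℝ (Fin m) → V) where
  carrier := {h | ContDiff ℝ ∞ h}
  add_mem' {f g} h₁ h₂ := by
    change ContDiff ℝ ∞ f at h₁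
    change ContDiff ℝ ∞ g at h₂
    exact h₁.add h₂
  zero_mem' := by
    change ContDiff ℝ ∞ fun _ => (0 : V)
    exact contDiff_const
  smul_mem' c f h := by
    change ContDiff ℝ ∞ f at h
    exact contDiff_const.smul h

variable {m V}

theorem mem_smoothFunctions {h : EuclideanSpace ℝ (Fin m) → V} :
    h ∈ smoothFunctions m V ↔ ContDiff ℝ ∞ h := Iff.rfl

theorem smoothFunctions_differentiable (h : smoothFunctions m V) : Differentiable ℝ h.1 :=
  (mem_smoothFunctions.1 h.2).differentiable (by simp)

/-- The partial derivative in the `i`-th direction. -/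
noncomputable def partialDeriv (i : Fin m) : Module.End ℝ (smoothFunctions m V) where
  toFun h := ⟨fun p => fderiv ℝ h.1 p (EuclideanSpace.single i (1 : ℝ)), by
    have h1 : ContDiff ℝ ∞ (fderiv ℝ h.1) := (mem_smoothFunctions.1 h.2).fderiv_right (by simp)
    exact mem_smoothFunctions.2 (h1.clm_apply contDiff_const)⟩
  map_add' h g := Subtype.ext (funext fun p => by
    change fderiv ℝ (h.1 + g.1) p _ = _
    rw [fderiv_add (smoothFunctions_differentiable h p) (smoothFunctions_differentiable g p)]
    rfl)
  map_smul' c h := Subtype.ext (funext fun p => by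
    change fderiv ℝ (c • h.1) p _ = _
    rw [fderiv_const_smul (smoothFunctions_differentiable h p)]
    rfl)

theorem partialDeriv_apply (i : Fin m) (h : smoothFunctions m V) (p : EuclideanSpace ℝ (Fin m)) :
    (partialDeriv i h).1 p = fderiv ℝ h.1 p (EuclideanSpace.single i (1 : ℝ)) := rfl

/-- The multiplication with the coordinate `y i - a i`. -/
noncomputable def coordMul (a : EuclideanSpace ℝ (Fin m)) (i : Fin m) :
    Module.End ℝ (smoothFunctions m V) where
  toFun h := ⟨fun p => (p i - a i) • h.1 p, by
    have h1 : ContDiff ℝ ∞ fun p : EuclideanSpace ℝ (Fin m) => p i - a i :=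
      (EuclideanSpace.proj i : EuclideanSpace ℝ (Fin m) →L[ℝ] ℝ).contDiff.sub contDiff_const
    exact mem_smoothFunctions.2 (h1.smul (mem_smoothFunctions.1 h.2))⟩
  map_add' h g := Subtype.ext (funext fun p => smul_add _ _ _)
  map_smul' c h := Subtype.ext (funext fun p => smul_comm _ _ _)

theorem partialDeriv_coordMul_apply (a : EuclideanSpace ℝ (Fin m)) (i j : Fin m)
    (h : smoothFunctions m V) (p : EuclideanSpace ℝ (Fin m)) :
    (partialDeriv j (coordMul a i h)).1 p =
      (p i - a i) • (partialDeriv j h).1 p + (if j = i then (1 : ℝ) else 0) • h.1 p := by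
  have h1 : HasFDerivAt (fun p : EuclideanSpace ℝ (Fin m) => p i - a i)
      (EuclideanSpace.proj i : EuclideanSpace ℝ (Fin m) →L[ℝ] ℝ) p :=
    (EuclideanSpace.proj i : EuclideanSpace ℝ (Fin m) →L[ℝ] ℝ).hasFDerivAt.sub_const _
  have h2 := h1.smul (smoothFunctions_differentiable h p).hasFDerivAt
  rw [partialDeriv_apply]
  change fderiv ℝ (fun p => (p i - a i) • h.1 p) p _ = _
  have h3 := congrArg (fun T : EuclideanSpace ℝ (Fin m) →L[ℝ] V =>
    T (EuclideanSpace.single j (1 : ℝ))) h2.fderiv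
  refine h3.trans ?_
  simp [partialDeriv_apply, eq_comm]

theorem multiPow_partialDeriv_coordMul (a : EuclideanSpace ℝ (Fin m)) (i : Fin m)
    (α : Fin m → ℕ) (h : smoothFunctions m V) :
    (multiPow partialDeriv α (coordMul a i h)).1 a =
      α i • (multiPow partialDeriv (α - Pi.single i 1) h).1 a := by
  have h1 := multiPow_mul_of_commutator (D := partialDeriv (V := V)) (u := coordMul a i) (i := i)
    (LinearMap.ext fun h => Subtype.ext (funext fun p => by
      have := partialDeriv_coordMul_apply a i i h p
      rw [if_pos rfl, one_smul] at this
      exact this))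
    (fun j hj => LinearMap.ext fun h => Subtype.ext (funext fun p => by
      have := partialDeriv_coordMul_apply a i j h p
      rw [if_neg hj, zero_smul, add_zero] at this
      exact this)) α
  have h2 := congrArg (fun T : Module.End ℝ (smoothFunctions m V) => (T h).1 a) h1
  refine h2.trans ?_
  change (a i - a i) • (multiPow partialDeriv α h).1 a + _ = _
  rw [sub_self, zero_smul, zero_add]
  rfl

theorem multiPow_partialDeriv_const {α : Fin m → ℕ} (hα : α ≠ 0) (h : smoothFunctions m V) {c : V}
    (hc : ∀ p, h.1 p = c) : multiPow partialDeriv α h = 0 := by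
  have h0 : ∀ i : Fin m, partialDeriv i h = 0 := fun i => Subtype.ext (funext fun p => by
    rw [partialDeriv_apply, show h.1 = fun _ => c from funext hc, fderiv_fun_const]
    rfl)
  -- the last nontrivial factor annihilates the constant
  have key : ∀ {r : ℕ} (D : Fin r → Module.End ℝ (smoothFunctions m V)) (β : Fin r → ℕ),
      (∀ i, D i h = 0) → β ≠ 0 → multiPow D β h = 0 := by
    intro r
    induction r with
    | zero => exact fun D β _ hβ => absurd (Subsingleton.elim β 0) hβ
    | succ r ih =>
      intro D β hD hβ
      rw [multiPow_succ, Module.End.mul_apply]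
      by_cases hβ' : (fun i : Fin r => β i.succ) = 0
      · rw [hβ', multiPow_zero, Module.End.one_apply]
        have hβ0 : β 0 ≠ 0 := fun h => hβ (funext fun i => by
          induction i using Fin.cases with
          | zero => exact h
          | succ i => exact congrFun hβ' i)
        obtain ⟨b, hb⟩ := Nat.exists_eq_succ_of_ne_zero hβ0
        rw [hb, Nat.succ_eq_add_one, pow_succ, Module.End.mul_apply, hD, map_zero]
      · rw [ih _ _ (fun i => hD i.succ) hβ', map_zero]
  exact key _ α h0 hα

/-- Hadamard's lemma as an identity between smooth functions. -/
theorem exists_smoothFunctions_eq_add_sum [CompleteSpace V] (h : smoothFunctions m V)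
    (a : EuclideanSpace ℝ (Fin m)) : ∃ (c : smoothFunctions m V) (g : Fin m → smoothFunctions m V),
      (∀ p, c.1 p = h.1 a) ∧ h = c + ∑ i, coordMul a i (g i) := by
  obtain ⟨g, hg, hga⟩ := exists_eq_add_sum_sub_smul (mem_smoothFunctions.1 h.2) a
  refine ⟨⟨fun _ => h.1 a, mem_smoothFunctions.2 contDiff_const⟩, fun i => ⟨g i, hg i⟩, fun p => rfl,
    Subtype.ext (funext fun p => ?_)⟩
  change h.1 p = h.1 a + (∑ i, coordMul a i ⟨g i, hg i⟩ : smoothFunctions m V).1 p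
  rw [AddSubmonoidClass.coe_finsetSum, Finset.sum_apply]
  exact hga p

variable {M : Type*} [TopologicalSpace M] {ξ : OpenPartialHomeomorph M (EuclideanSpace ℝ (Fin m))}

theorem chartPartial_eventuallyEq {f : M → V} {h : smoothFunctions m V} {x : M}
    (hx : x ∈ ξ.source) (hf : ∀ᶠ z in 𝓝 x, f z = h.1 (ξ z)) (i : Fin m) :
    ∀ᶠ z in 𝓝 x, chartPartial ξ i f z = (partialDeriv i h).1 (ξ z) := by
  filter_upwards [eventually_eventually_nhds.2 hf, ξ.open_source.mem_nhds hx] with z hz hzs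
  have h1 : (fun p => f (ξ.symm p)) =ᶠ[𝓝 (ξ z)] h.1 := by
    have h2 : Tendsto ξ.symm (𝓝 (ξ z)) (𝓝 z) := ξ.tendsto_symm hzs
    filter_upwards [h2.eventually hz, ξ.open_target.mem_nhds (ξ.map_source hzs)] with p hp hpt
    rw [hp, ξ.right_inv hpt]
  rw [chartPartial, h1.lineDeriv_eq,
    (smoothFunctions_differentiable h (ξ z)).lineDeriv_eq_fderiv]
  rfl

/-- The partial derivatives in a chart are those of a representative in the chart. -/
theorem chartMultiPartial_eventuallyEq {f : M → V} {h : smoothFunctions m V} {x : M}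
    (hx : x ∈ ξ.source) (hf : ∀ᶠ z in 𝓝 x, f z = h.1 (ξ z)) (α : Fin m → ℕ) :
    ∀ᶠ z in 𝓝 x, chartMultiPartial ξ α f z = (multiPow partialDeriv α h).1 (ξ z) := by
  let R : (M → V) → smoothFunctions m V → Prop := fun f h => ∀ᶠ z in 𝓝 x, f z = h.1 (ξ z)
  have key : ∀ {r : ℕ} (P : Fin r → (M → V) → (M → V))
      (D : Fin r → Module.End ℝ (smoothFunctions m V)) (β : Fin r → ℕ),
      (∀ i f h, R f h → R (P i f) (D i h)) → ∀ f h, R f h →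
        R ((List.ofFn fun i => (P i)^[β i]).foldr (fun D g => D g) f) (multiPow D β h) := by
    intro r
    induction r with
    | zero =>
      intro P D β _ f h hfh
      rw [multiPow_zero_left]
      simpa using hfh
    | succ r ih =>
      intro P D β hPD f h hfh
      have h1 := ih (fun i => P i.succ) (fun i => D i.succ) (fun i => β i.succ)
        (fun i => hPD i.succ) f h hfh
      rw [multiPow_succ, List.ofFn_succ, List.foldr_cons, Module.End.mul_apply]
      generalize β 0 = b
      induction b with
      | zero => exact h1
      | succ b ihb =>
        rw [Function.iterate_succ_apply', pow_succ', Module.End.mul_apply]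
        exact hPD 0 _ _ ihb
  exact key _ _ α (fun i f h hfh => chartPartial_eventuallyEq hx hfh i) f h hf

end Jets

/-! ### The nilpotent filtration of the Lie algebra of sections -/

section SectionFiltration

open Topology Filter

variable {K : Type*} [RCLike K] {m : ℕ} {M : Type*} [TopologicalSpace M]
  [ChartedSpace (EuclideanSpace ℝ (Fin m)) M]
  {F : Type*} [NormedLieRing F] [NormedSpace ℝ F] [LieAlgebra K F] [IsScalarTower ℝ K F]
  [FiniteDimensional K F]
  {L : M → Type*} [∀ x, LieRing (L x)] [∀ x, LieAlgebra K (L x)] [∀ x, Module ℝ (L x)]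
  [∀ x, IsScalarTower ℝ K (L x)]
  [∀ x, TopologicalSpace (L x)] [TopologicalSpace (TotalSpace F L)]
  [FiberBundle F L] [VectorBundle ℝ F L] [ContMDiffVectorBundle ∞ F L (𝓡 m)]
  [IsLieAlgebraBundle K F L]
  [IsManifold (𝓡 m) ∞ M] [T2Space M] [SigmaCompactSpace M] [Nontrivial F]
  {k : ℕ∞}

theorem localForm_add {e : Trivialization F (TotalSpace.proj : TotalSpace F L → M)}
    (he : e ∈ FiberBundle.trivializationAtlas F L) {x : M} (hx : x ∈ e.baseSet)
    (X Y : ckSections K m F L k) :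
    localForm e (X + Y).1 x = localForm e X.1 x + localForm e Y.1 x :=
  map_add (chartLieEquiv K e he hx) (X.1 x) (Y.1 x)

theorem localForm_smul {e : Trivialization F (TotalSpace.proj : TotalSpace F L → M)}
    (he : e ∈ FiberBundle.trivializationAtlas F L) {x : M} (hx : x ∈ e.baseSet) (c : K)
    (X : ckSections K m F L k) : localForm e (c • X).1 x = c • localForm e X.1 x :=
  map_smul (chartLieEquiv K e he hx) c (X.1 x)

theorem localForm_lie {e : Trivialization F (TotalSpace.proj : TotalSpace F L → M)}
    (he : e ∈ FiberBundle.trivializationAtlas F L) {x : M} (hx : x ∈ e.baseSet)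
    (X Y : ckSections K m F L k) :
    localForm e ⁅X, Y⁆.1 x = ⁅localForm e X.1 x, localForm e Y.1 x⁆ :=
  LieEquiv.map_lie (chartLieEquiv K e he hx) (X.1 x) (Y.1 x)

theorem localForm_zero {e : Trivialization F (TotalSpace.proj : TotalSpace F L → M)}
    (he : e ∈ FiberBundle.trivializationAtlas F L) {x : M} (hx : x ∈ e.baseSet) :
    localForm e (0 : ckSections K m F L k).1 x = 0 :=
  map_zero (chartLieEquiv K e he hx)

/-- A nilpotent element of the centroid of the typical fiber, viewed in a chart and cut off, extends
to a nilpotent element of the centroid of the Lie algebra of sections. -/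
theorem exists_nilpotentCentroid_localForm (k : ℕ∞)
    {e : Trivialization F (TotalSpace.proj : TotalSpace F L → M)}
    (he : e ∈ FiberBundle.trivializationAtlas F L) {x : M} (hx : x ∈ e.baseSet)
    {T : Module.End K F} (hT : T ∈ nilpotentCentroid K F) :
    ∃ S ∈ nilpotentCentroid K (ckSections K m F L k), ∀ X : ckSections K m F L k,
      ∀ᶠ y in 𝓝 x, localForm e (S X).1 y = T (localForm e X.1 y) := by
  classical
  have : FiniteDimensional ℝ F := finiteDimensional_real K F
  obtain ⟨b, hb, hb1, hbV⟩ := exists_bump (m := m) x (e.open_baseSet.mem_nhds hx)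
  have hb0 : ∀ y ∉ e.baseSet, ∀ᶠ z in 𝓝 y, b z = 0 := fun y hy => by
    filter_upwards [(isClosed_tsupport b).isOpen_compl.mem_nhds fun h => hy (hbV h)] with z hz
    exact image_eq_zero_of_notMem_tsupport hz
  -- the endomorphism `T` on the fibers of the chart domain
  let t : ∀ y, Module.End K (L y) := fun y =>
    if h : y ∈ e.baseSet then (chartLieEquiv K e he h).symm.toLinearEquiv.conj T else 0
  have ht : ∀ y (h : y ∈ e.baseSet) v,
      chartLieEquiv K e he h (t y v) = T (chartLieEquiv K e he h v) := fun y h v => by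
    simp only [t, dif_pos h]
    change chartLieEquiv K e he h ((chartLieEquiv K e he h).symm (T (chartLieEquiv K e he h v))) = _
    rw [LieEquiv.apply_symm_apply]
  have htN : ∀ y, t y ∈ lieCentroid K (L y) := fun y => by
    by_cases h : y ∈ e.baseSet
    · simp only [t, dif_pos h]
      exact conj_mem_lieCentroid _ hT.1
    · simp only [t, dif_neg h]
      exact zero_mem _
  have hmem : ∀ X : ckSections K m F L k, (fun y => (b y : K) • t y (X.1 y)) ∈ ckSections K m F L k := by
    intro X y
    by_cases hy : y ∈ e.baseSet
    · rw [contMDiffAt_section_iff_localForm he hy]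
      have h1 : ContMDiffAt (𝓡 m) 𝓘(ℝ, F) k (fun z => (b z : K) • T (localForm e X.1 z)) y := by
        refine contMDiffWithinAt_real_smul (contMDiffWithinAt_linear (Algebra.linearMap ℝ K)
          ((hb y).of_le (mod_cast le_top))) ?_
        exact contMDiffWithinAt_linear (T.restrictScalars ℝ)
          ((contMDiffAt_section_iff_localForm he hy).1 (X.2 y))
      refine h1.congr_of_eventuallyEq ?_
      filter_upwards [e.open_baseSet.mem_nhds hy] with z hz
      rw [localForm_eq he hz (K := K), map_smul, ht z hz, ← localForm_eq he hz]
    · refine ContMDiffAt.congr_of_eventuallyEq ((0 : ckSections K m F L k).2 y) ?_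
      filter_upwards [hb0 y hy] with z hz
      rw [hz, RCLike.ofReal_zero, zero_smul]
      rfl
  let S : Module.End K (ckSections K m F L k) :=
    { toFun := fun X => ⟨_, hmem X⟩
      map_add' := fun X Y => Subtype.ext (funext fun y => by
        change (b y : K) • t y (X.1 y + Y.1 y) = (b y : K) • t y (X.1 y) + (b y : K) • t y (Y.1 y)
        rw [map_add, smul_add])
      map_smul' := fun c X => Subtype.ext (funext fun y => by
        change (b y : K) • t y (c • X.1 y) = c • (b y : K) • t y (X.1 y)
        rw [map_smul, smul_comm]) }
  have hS : ∀ X y, (S X).1 y = (b y : K) • t y (X.1 y) := fun X y => rfl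
  refine ⟨S, ⟨fun X Y => Subtype.ext (funext fun y => ?_), ?_⟩, fun X => ?_⟩
  · change (b y : K) • t y ⁅X.1 y, Y.1 y⁆ = ⁅X.1 y, (b y : K) • t y (Y.1 y)⁆
    rw [mem_lieCentroid.1 (htN y), lie_smul]
  · obtain ⟨r, hr⟩ := hT.2
    have hpow : ∀ (a : ℕ) X y (h : y ∈ e.baseSet), chartLieEquiv K e he h (((S ^ a) X).1 y) =
        (b y : K) ^ a • (T ^ a) (chartLieEquiv K e he h (X.1 y)) := by
      intro a
      induction a with
      | zero => intro X y h; simp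
      | succ a ih =>
        intro X y h
        rw [pow_succ', Module.End.mul_apply, hS, map_smul, ht, ih, map_smul, smul_smul, ← pow_succ',
          pow_succ' T, Module.End.mul_apply]
    refine ⟨r + 1, LinearMap.ext fun X => Subtype.ext (funext fun y => ?_)⟩
    change ((S ^ (r + 1)) X).1 y = 0
    by_cases h : y ∈ e.baseSet
    · apply (chartLieEquiv K e he h).injective
      change chartLieEquiv K e he h _ = chartLieEquiv K e he h _
      rw [hpow, pow_succ T, hr, zero_mul, LinearMap.zero_apply, smul_zero, map_zero]
    · rw [pow_succ', Module.End.mul_apply, hS, (hb0 y h).self_of_nhds, RCLike.ofReal_zero, zero_smul]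
  · filter_upwards [hb1, e.open_baseSet.mem_nhds hx] with y hy hye
    rw [localForm_eq he hye (K := K), hS, hy, RCLike.ofReal_one, one_smul, ht, ← localForm_eq he hye]

/-- Elements of the fiber that are deep in the filtration extend to sections that are equally deep in
the filtration of the Lie algebra of sections. The latter is preserved by `μ`, although `μ` does not
act pointwise. -/
theorem exists_nilFiltration_localForm (k : ℕ∞)
    {e : Trivialization F (TotalSpace.proj : TotalSpace F L → M)}
    (he : e ∈ FiberBundle.trivializationAtlas F L) {x : M} (hx : x ∈ e.baseSet) (r : ℕ) :
    ∀ v ∈ nilFiltration K F r, ∃ X ∈ nilFiltration K (ckSections K m F L k) r,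
      ∀ᶠ y in 𝓝 x, localForm e X.1 y = v := by
  induction r with
  | zero =>
    intro v _
    obtain ⟨X, hX⟩ := exists_section_eventuallyEq_const (K := K) (m := m) k he hx v
    exact ⟨X, trivial, hX⟩
  | succ r ih =>
    intro v hv
    rw [nilFiltration] at hv
    induction hv using Submodule.span_induction with
    | mem w hw =>
      obtain ⟨T, hT, v, hv, rfl⟩ := hw
      obtain ⟨X, hX, hXv⟩ := ih v hv
      obtain ⟨S, hS, hST⟩ := exists_nilpotentCentroid_localForm (m := m) k he hx hT
      refine ⟨S X, apply_mem_nilFiltration_succ hS hX, ?_⟩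
      filter_upwards [hXv, hST X] with y hy hy'
      rw [hy', hy]
    | zero =>
      refine ⟨0, zero_mem _, ?_⟩
      filter_upwards [e.open_baseSet.mem_nhds hx] with y hy
      exact localForm_zero he hy
    | add v w _ _ hv hw =>
      obtain ⟨X, hX, hXv⟩ := hv
      obtain ⟨Y, hY, hYw⟩ := hw
      refine ⟨X + Y, add_mem hX hY, ?_⟩
      filter_upwards [hXv, hYw, e.open_baseSet.mem_nhds hx] with y h1 h2 hy
      rw [localForm_add he hy, h1, h2]
    | smul c v _ hv =>
      obtain ⟨X, hX, hXv⟩ := hv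
      refine ⟨c • X, Submodule.smul_mem _ _ hX, ?_⟩
      filter_upwards [hXv, e.open_baseSet.mem_nhds hx] with y h1 hy
      rw [localForm_smul he hy, h1]

theorem HasLocalCentroid.apply_mem_nilFiltration (hF : HasLocalCentroid K F) {r : ℕ}
    {X : ckSections K m F L k} (hX : X ∈ nilFiltration K (ckSections K m F L k) r) (x : M) :
    X.1 x ∈ nilFiltration K (L x) r :=
  map_mem_nilFiltration (evalAt m F k x)
    (fun T hT => by
      obtain ⟨a, ha⟩ := hT.2
      have h1 : (⟨T, hT.1⟩ : lieCentroid K (ckSections K m F L k)) ^ a = 0 := Subtype.ext ha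
      refine ⟨hF.fiberHom k x ⟨T, hT.1⟩, ⟨hF.fiberHom_mem_lieCentroid x _, a, ?_⟩,
        fun X => (hF.fiberHom_apply x ⟨T, hT.1⟩ X).symm⟩
      rw [← map_pow, h1, map_zero]) r X hX

end SectionFiltration

/-! ### The isomorphism on locally constant sections -/

section ConstMap

open Topology Filter

variable {K : Type*} [RCLike K] {m n : ℕ}
  {M : Type*} [TopologicalSpace M] [ChartedSpace (EuclideanSpace ℝ (Fin m)) M]
  {N : Type*} [TopologicalSpace N] [ChartedSpace (EuclideanSpace ℝ (Fin n)) N]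
  {F : Type*} [NormedLieRing F] [NormedSpace ℝ F] [LieAlgebra K F] [IsScalarTower ℝ K F]
  [FiniteDimensional K F]
  {L : M → Type*} [∀ x, LieRing (L x)] [∀ x, LieAlgebra K (L x)] [∀ x, Module ℝ (L x)]
  [∀ x, IsScalarTower ℝ K (L x)]
  [∀ x, TopologicalSpace (L x)] [TopologicalSpace (TotalSpace F L)]
  [FiberBundle F L] [VectorBundle ℝ F L] [ContMDiffVectorBundle ∞ F L (𝓡 m)]
  [IsLieAlgebraBundle K F L]
  {G : Type*} [NormedLieRing G] [NormedSpace ℝ G] [LieAlgebra K G] [IsScalarTower ℝ K G]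
  [FiniteDimensional K G]
  {E : N → Type*} [∀ y, LieRing (E y)] [∀ y, LieAlgebra K (E y)] [∀ y, Module ℝ (E y)]
  [∀ y, IsScalarTower ℝ K (E y)]
  [∀ y, TopologicalSpace (E y)] [TopologicalSpace (TotalSpace G E)]
  [FiberBundle G E] [VectorBundle ℝ G E] [ContMDiffVectorBundle ∞ G E (𝓡 n)]
  [IsLieAlgebraBundle K G E]
  [IsManifold (𝓡 m) ∞ M] [T2Space M] [SigmaCompactSpace M] [Nontrivial F]
  [IsManifold (𝓡 n) ∞ N] [T2Space N] [SigmaCompactSpace N] [Nontrivial G]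
  {k l : ℕ∞} {hF : HasLocalCentroid K F} {hG : HasLocalCentroid K G}
  {μ : ckSections K m F L k ≃ₗ⁅K⁆ ckSections K n G E l} {σ : N → M} {τ : M → N}
  {e : Trivialization F (TotalSpace.proj : TotalSpace F L → M)}
  {e' : Trivialization G (TotalSpace.proj : TotalSpace G E → N)}

/-- In bundle charts, the values at `q` of the images of sections that are constant near `σ q`
depend on the constant through a homomorphism of Lie algebras. -/
theorem Covers.exists_constMap (hσ : Covers hF hG μ σ)
    (he : e ∈ FiberBundle.trivializationAtlas F L) (he' : e' ∈ FiberBundle.trivializationAtlas G E)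
    {q : N} (hq : σ q ∈ e.baseSet) (hq' : q ∈ e'.baseSet) :
    ∃ ν : F →ₗ⁅K⁆ G, ∀ (v : F) (X : ckSections K m F L k),
      (∀ᶠ y in 𝓝 (σ q), localForm e X.1 y = v) → localForm e' (μ X).1 q = ν v := by
  choose C hC using fun v => exists_section_eventuallyEq_const (K := K) (m := m) k he hq v
  have hcongr : ∀ (v : F) (X : ckSections K m F L k),
      (∀ᶠ y in 𝓝 (σ q), localForm e X.1 y = v) → (μ X).1 q = (μ (C v)).1 q := fun v X hX => by
    refine hσ.apply_congr ((eventually_eq_iff_localForm he hq).2 ?_)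
    filter_upwards [hX, hC v] with y h1 h2
    rw [h1, h2]
  have hmem := e.open_baseSet.mem_nhds hq
  have hadd : ∀ v w, (μ (C (v + w))).1 q = (μ (C v)).1 q + (μ (C w)).1 q := fun v w => by
    rw [← hcongr (v + w) (C v + C w), map_add]
    · rfl
    · filter_upwards [hC v, hC w, hmem] with y h1 h2 hy
      rw [localForm_add he hy, h1, h2]
  have hsmul : ∀ (c : K) v, (μ (C (c • v))).1 q = c • (μ (C v)).1 q := fun c v => by
    rw [← hcongr (c • v) (c • C v), map_smul]
    · rfl
    · filter_upwards [hC v, hmem] with y h1 hy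
      rw [localForm_smul he hy, h1]
  have hlie : ∀ v w, (μ (C ⁅v, w⁆)).1 q = ⁅(μ (C v)).1 q, (μ (C w)).1 q⁆ := fun v w => by
    rw [← hcongr ⁅v, w⁆ ⁅C v, C w⁆, LieEquiv.map_lie]
    · rfl
    · filter_upwards [hC v, hC w, hmem] with y h1 h2 hy
      rw [localForm_lie he hy, h1, h2]
  refine ⟨{ toFun := fun v => chartLieEquiv K e' he' hq' ((μ (C v)).1 q)
            map_add' := fun v w => by rw [hadd, map_add]
            map_smul' := fun c v => by rw [hsmul, map_smul]; rfl
            map_lie' := fun {v w} => by rw [hlie, LieEquiv.map_lie] }, fun v X hX => ?_⟩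
  rw [localForm_eq he' hq' (K := K), hcongr v X hX]
  rfl

/-- The map on constants is surjective, since it is so on the graded pieces of the nilpotent
filtration. -/
theorem Covers.constMap_surjective (hσ : Covers hF hG μ σ)
    (he : e ∈ FiberBundle.trivializationAtlas F L) (he' : e' ∈ FiberBundle.trivializationAtlas G E)
    {q : N} (hq : σ q ∈ e.baseSet) (hq' : q ∈ e'.baseSet) {ν : F →ₗ⁅K⁆ G}
    (hν : ∀ (v : F) (X : ckSections K m F L k),
      (∀ᶠ y in 𝓝 (σ q), localForm e X.1 y = v) → localForm e' (μ X).1 q = ν v) :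
    Function.Surjective ν := by
  let I : Submodule K G := LinearMap.range (ν : F →ₗ[K] G)
  have hstep : ∀ r, nilFiltration K G r ≤ I ⊔ nilFiltration K G (r + 1) := by
    intro r w hw
    obtain ⟨Y, hY, hYw⟩ := exists_nilFiltration_localForm (K := K) (m := n) l he' hq' r w hw
    set X := μ.symm Y with hX_def
    have hX : X ∈ nilFiltration K (ckSections K m F L k) r := equiv_mem_nilFiltration μ.symm hY
    obtain ⟨a, f, C, c, hc, hCc, hXC, -⟩ := exists_eventually_eq_sum_smulOp he hq
      (nilFiltration K F r) (X := X) (by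
        filter_upwards [e.open_baseSet.mem_nhds hq] with y hy
        exact (mem_nilFiltration_iff_localForm he hy).1 (hF.apply_mem_nilFiltration hX y))
    have h1 : (μ X).1 q = ∑ i, transportedSmul hG μ q (f i) ((μ (C i)).1 q) := by
      rw [hσ.apply_congr hXC, map_sum]
      change evalAt n G l q _ = _
      rw [map_sum]
      exact Finset.sum_congr rfl fun i _ => (transportedSmul_apply q (f i) (C i)).symm
    have h2 : w = ∑ i, chartLieEquiv K e' he' hq'
        (transportedSmul hG μ q (f i) ((μ (C i)).1 q)) := by
      rw [← map_sum, ← h1, hX_def, LieEquiv.apply_symm_apply, ← localForm_eq he' hq',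
        hYw.self_of_nhds]
    rw [h2]
    refine Submodule.sum_mem _ fun i _ => ?_
    have h3 : transportedSmul hG μ q (f i) ((μ (C i)).1 q) =
        (f i).1 (σ q) • (μ (C i)).1 q + symbolDefect hG μ σ q (f i) ((μ (C i)).1 q) :=
      (add_sub_cancel _ _).symm
    rw [h3, map_add, map_smul]
    refine Submodule.add_mem_sup (Submodule.smul_mem _ _ ?_) ?_
    · rw [← localForm_eq he' hq', hν (c i) (C i) (hCc i)]
      exact ⟨c i, rfl⟩
    · obtain ⟨C', hC', hCC'⟩ := exists_nilFiltration_localForm (K := K) (m := m) k he hq r _ (hc i)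
      have h4 : (μ (C i)).1 q = (μ C').1 q := by
        refine hσ.apply_congr ((eventually_eq_iff_localForm he hq).2 ?_)
        filter_upwards [hCc i, hCC'] with y h1 h2
        rw [h1, h2]
      rw [h4, ← mem_nilFiltration_iff_localForm]
      exact apply_mem_nilFiltration_succ (hσ.symbolDefect_mem q (f i))
        (hG.apply_mem_nilFiltration (equiv_mem_nilFiltration μ hC') q)
  have htop : ∀ r, (⊤ : Submodule K G) ≤ I ⊔ nilFiltration K G r := by
    intro r
    induction r with
    | zero => exact le_sup_right
    | succ r ih => exact ih.trans (sup_le le_sup_left (hstep r))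
  have h1 := htop (Module.finrank K G)
  rw [hG.nilFiltration_eq_bot le_rfl, sup_bot_eq] at h1
  intro w
  exact h1 (Submodule.mem_top (x := w))

/-- The fibers of `E` are quotients of the fibers of `L`, by the map on locally constant sections. -/
theorem Covers.finrank_le (hσ : Covers hF hG μ σ) [Nonempty N] :
    Module.finrank K G ≤ Module.finrank K F := by
  obtain ⟨q⟩ := ‹Nonempty N›
  have he := FiberBundle.trivialization_mem_atlas F L (σ q)
  have he' := FiberBundle.trivialization_mem_atlas G E q
  have hq := FiberBundle.mem_baseSet_trivializationAt F L (σ q)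
  have hq' := FiberBundle.mem_baseSet_trivializationAt G E q
  obtain ⟨ν, hν⟩ := hσ.exists_constMap he he' hq hq'
  exact LinearMap.finrank_le_finrank_of_surjective (f := (ν : F →ₗ[K] G))
    (hσ.constMap_surjective he he' hq hq' hν)

theorem Covers.exists_constEquiv (hσ : Covers hF hG μ σ) (hτ : Covers hG hF μ.symm τ)
    (he : e ∈ FiberBundle.trivializationAtlas F L) (he' : e' ∈ FiberBundle.trivializationAtlas G E)
    {q : N} (hq : σ q ∈ e.baseSet) (hq' : q ∈ e'.baseSet) :
    ∃ ν : F ≃ₗ⁅K⁆ G, ∀ (v : F) (X : ckSections K m F L k),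
      (∀ᶠ y in 𝓝 (σ q), localForm e X.1 y = v) → localForm e' (μ X).1 q = ν v := by
  obtain ⟨ν, hν⟩ := hσ.exists_constMap he he' hq hq'
  have hsurj := hσ.constMap_surjective he he' hq hq' hν
  have : Nonempty N := ⟨q⟩
  have : Nonempty M := ⟨σ q⟩
  have hrank : Module.finrank K F = Module.finrank K G := le_antisymm hτ.finrank_le hσ.finrank_le
  have hinj : Function.Injective ν :=
    (LinearMap.injective_iff_surjective_of_finrank_eq_finrank (f := (ν : F →ₗ[K] G)) hrank).2 hsurj
  exact ⟨LieEquiv.ofBijective ν ⟨hinj, hsurj⟩, hν⟩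

end ConstMap

/-! ### Smooth families of linear maps -/

section Families

variable {K : Type*} [RCLike K] {m : ℕ} {M : Type*} [TopologicalSpace M]
  [ChartedSpace (EuclideanSpace ℝ (Fin m)) M]
  {F : Type*} [NormedLieRing F] [NormedSpace ℝ F] [LieAlgebra K F] [IsScalarTower ℝ K F]
  [FiniteDimensional K F]
  {G : Type*} [NormedLieRing G] [NormedSpace ℝ G] [LieAlgebra K G] [IsScalarTower ℝ K G]
  [FiniteDimensional K G] {U : Set M}

theorem SmoothFamilyOn.apply {T : M → F →ₗ[K] G} (hT : SmoothFamilyOn m U fun x => (T x : F → G))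
    {w : M → F} (hw : ContMDiffOn (𝓡 m) 𝓘(ℝ, F) ∞ w U) :
    ContMDiffOn (𝓡 m) 𝓘(ℝ, G) ∞ (fun x => T x (w x)) U := by
  have : FiniteDimensional ℝ F := finiteDimensional_real K F
  have : FiniteDimensional ℝ G := finiteDimensional_real K G
  let b := Module.finBasis K F
  have h1 : (fun x => T x (w x)) = fun x => ∑ i, b.coord i (w x) • T x (b i) := funext fun x => by
    simp only [← map_smul, ← map_sum]
    exact congrArg (T x) (b.sum_repr (w x)).symm
  rw [h1]
  intro x hx
  exact contMDiffWithinAt_finsetSum fun i _ => contMDiffWithinAt_real_smul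
    (contMDiffWithinAt_linear ((b.coord i).restrictScalars ℝ) (hw x hx)) (hT (b i) x hx)

theorem SmoothFamilyOn.pow_apply {T : M → Module.End K G}
    (hT : SmoothFamilyOn m U fun x => (T x : G → G)) {w : M → G}
    (hw : ContMDiffOn (𝓡 m) 𝓘(ℝ, G) ∞ w U) (a : ℕ) :
    ContMDiffOn (𝓡 m) 𝓘(ℝ, G) ∞ (fun x => (T x ^ a) (w x)) U := by
  induction a with
  | zero => simpa using hw
  | succ a ih =>
    simp only [pow_succ', Module.End.mul_apply]
    exact hT.apply ih

theorem SmoothFamilyOn.multiPow_apply {r : ℕ} {T : Fin r → M → Module.End K G}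
    (hT : ∀ i, SmoothFamilyOn m U fun x => (T i x : G → G)) {w : M → G}
    (hw : ContMDiffOn (𝓡 m) 𝓘(ℝ, G) ∞ w U) (α : Fin r → ℕ) :
    ContMDiffOn (𝓡 m) 𝓘(ℝ, G) ∞ (fun x => multiPow (fun i => T i x) α (w x)) U := by
  induction r with
  | zero => simpa [multiPow_zero_left] using hw
  | succ r ih =>
    simp only [multiPow_succ, Module.End.mul_apply]
    exact (hT 0).pow_apply (ih (fun i => hT i.succ) _) _

end Families

/-! ### The normal form of isomorphisms between Lie algebras of smooth sections -/

section NormalForm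

open Topology Filter

variable {K : Type*} [RCLike K] {m n : ℕ}
  {M : Type*} [TopologicalSpace M] [ChartedSpace (EuclideanSpace ℝ (Fin m)) M]
  {N : Type*} [TopologicalSpace N] [ChartedSpace (EuclideanSpace ℝ (Fin n)) N]
  {F : Type*} [NormedLieRing F] [NormedSpace ℝ F] [LieAlgebra K F] [IsScalarTower ℝ K F]
  [FiniteDimensional K F]
  {L : M → Type*} [∀ x, LieRing (L x)] [∀ x, LieAlgebra K (L x)] [∀ x, Module ℝ (L x)]
  [∀ x, IsScalarTower ℝ K (L x)]
  [∀ x, TopologicalSpace (L x)] [TopologicalSpace (TotalSpace F L)]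
  [FiberBundle F L] [VectorBundle ℝ F L] [ContMDiffVectorBundle ∞ F L (𝓡 m)]
  [IsLieAlgebraBundle K F L]
  {G : Type*} [NormedLieRing G] [NormedSpace ℝ G] [LieAlgebra K G] [IsScalarTower ℝ K G]
  [FiniteDimensional K G]
  {E : N → Type*} [∀ y, LieRing (E y)] [∀ y, LieAlgebra K (E y)] [∀ y, Module ℝ (E y)]
  [∀ y, IsScalarTower ℝ K (E y)]
  [∀ y, TopologicalSpace (E y)] [TopologicalSpace (TotalSpace G E)]
  [FiberBundle G E] [VectorBundle ℝ G E] [ContMDiffVectorBundle ∞ G E (𝓡 n)]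
  [IsLieAlgebraBundle K G E]
  [IsManifold (𝓡 m) ∞ M] [T2Space M] [SigmaCompactSpace M] [Nontrivial F]
  [IsManifold (𝓡 n) ∞ N] [T2Space N] [SigmaCompactSpace N] [Nontrivial G]
  {k l : ℕ∞} {hF : HasLocalCentroid K F} {hG : HasLocalCentroid K G}
  {μ : ckSections K m F L k ≃ₗ⁅K⁆ ckSections K n G E l} {σ : N → M} {τ : M → N}
  {e : Trivialization F (TotalSpace.proj : TotalSpace F L → M)}
  {e' : Trivialization G (TotalSpace.proj : TotalSpace G E → N)}
  {ξ : OpenPartialHomeomorph M (EuclideanSpace ℝ (Fin m))}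

theorem exists_ckFunctions_coord (K : Type*) [RCLike K] (k : ℕ∞)
    (hξ : ξ ∈ IsManifold.maximalAtlas (𝓡 m) ∞ M)
    {x : M} (hx : x ∈ ξ.source) (i : Fin m) :
    ∃ f : ckFunctions K m M k, ∀ᶠ y in 𝓝 x, f.1 y = (ξ y i : K) :=
  exists_ckFunctions_eventuallyEq (ξ.open_source.mem_nhds hx) fun y hy =>
    contMDiffWithinAt_linear (Algebra.linearMap ℝ K)
      ((contMDiffOn_coord hξ i).of_le (mod_cast le_top) y hy)

theorem Covers.symbolDefect_congr (hσ : Covers hF hG μ σ) {q : N} {f g : ckFunctions K m M k}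
    (hfg : ∀ᶠ x in 𝓝 (σ q), f.1 x = g.1 x) :
    symbolDefect hG μ σ q f = symbolDefect hG μ σ q g := by
  change transportedSmul hG μ q f - f.1 (σ q) • 1 = transportedSmul hG μ q g - g.1 (σ q) • 1
  rw [hσ.transportedSmul_congr hfg, hfg.self_of_nhds]

/-- The nilpotent part of the action of the `i`-th coordinate, in a bundle chart. -/
theorem Covers.exists_coordDefect (hσ : Covers hF hG μ σ)
    (he' : e' ∈ FiberBundle.trivializationAtlas G E) (hξ : ξ ∈ IsManifold.maximalAtlas (𝓡 m) ∞ M)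
    {q : N} (hq' : q ∈ e'.baseSet) (hqξ : σ q ∈ ξ.source) (i : Fin m) :
    ∃ T ∈ nilpotentCentroid K G, ∀ f : ckFunctions K m M k,
      (∀ᶠ y in 𝓝 (σ q), f.1 y = (ξ y i : K)) → ∀ v : E q,
        chartLieEquiv K e' he' hq' (symbolDefect hG μ σ q f v) = T (chartLieEquiv K e' he' hq' v) := by
  obtain ⟨f₀, hf₀⟩ := exists_ckFunctions_coord K k hξ hqξ i
  refine ⟨_, conj_mem_nilpotentCentroid (chartLieEquiv K e' he' hq') (hσ.symbolDefect_mem q f₀),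
    fun f hf v => ?_⟩
  have h1 : symbolDefect hG μ σ q f = symbolDefect hG μ σ q f₀ := hσ.symbolDefect_congr (by
    filter_upwards [hf, hf₀] with y h1 h2
    rw [h1, h2])
  change _ = chartLieEquiv K e' he' hq' (symbolDefect hG μ σ q f₀
    ((chartLieEquiv K e' he' hq').symm (chartLieEquiv K e' he' hq' v)))
  rw [h1, LieEquiv.symm_apply_apply]

/-- The nilpotent parts of the coordinates depend smoothly on the base point, because they are the
values of a centroid element of the Lie algebra of sections. -/
theorem Covers.smoothFamilyOn_coordDefect {μ : ckSections K m F L ⊤ ≃ₗ⁅K⁆ ckSections K n G E ⊤}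
    (hσ : Covers hF hG μ σ) (hτ : Covers hG hF μ.symm τ)
    (he' : e' ∈ FiberBundle.trivializationAtlas G E) (hξ : ξ ∈ IsManifold.maximalAtlas (𝓡 m) ∞ M)
    {U : Set M} (hUo : IsOpen U) (hU : ∀ x ∈ U, τ x ∈ e'.baseSet) (hUξ : U ⊆ ξ.source) (i : Fin m)
    {T : M → Module.End K G} (hT : ∀ x (hx : x ∈ U), ∀ f : ckFunctions K m M ⊤,
      (∀ᶠ y in 𝓝 (σ (τ x)), f.1 y = (ξ y i : K)) → ∀ v : E (τ x),
        chartLieEquiv K e' he' (hU x hx) (symbolDefect hG μ σ (τ x) f v) =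
          T x (chartLieEquiv K e' he' (hU x hx) v)) :
    SmoothFamilyOn m U fun x => (T x : G → G) := by
  intro w x₀ hx₀
  obtain ⟨f, hf⟩ := exists_ckFunctions_coord K ⊤ hξ (hUξ hx₀) i
  obtain ⟨Y, hY⟩ := exists_section_eventuallyEq_const (K := K) (m := n) ⊤ he' (hU x₀ hx₀) w
  obtain ⟨S, hS⟩ := hσ.exists_symbolDefect_eq f
  have h1 : ContMDiffAt (𝓡 m) 𝓘(ℝ, G) ∞ (fun x => localForm e' (S Y).1 (τ x)) x₀ :=
    ContMDiffAt.comp (g := localForm e' (S Y).1) x₀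
      ((contMDiffAt_section_iff_localForm he' (hU x₀ hx₀)).1 ((S Y).2 _)) (hτ.contMDiff x₀)
  refine (h1.congr_of_eventuallyEq ?_).contMDiffWithinAt
  filter_upwards [eventually_eventually_nhds.2 hf, hτ.continuous.continuousAt.eventually hY,
    hUo.mem_nhds hx₀] with x hfx hYx hxU
  rw [localForm_eq he' (hU x hxU) (K := K), ← hS,
    hT x hxU f (by rw [hτ.comp_eq hσ]; exact hfx), ← localForm_eq he', hYx]

theorem Covers.smoothFamilyOn_constMap {μ : ckSections K m F L ⊤ ≃ₗ⁅K⁆ ckSections K n G E ⊤}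
    (hσ : Covers hF hG μ σ) (hτ : Covers hG hF μ.symm τ)
    (he : e ∈ FiberBundle.trivializationAtlas F L)
    (he' : e' ∈ FiberBundle.trivializationAtlas G E)
    {U : Set M} (hUo : IsOpen U) (hU : ∀ x ∈ U, τ x ∈ e'.baseSet) (hUe : U ⊆ e.baseSet)
    {ν : M → F ≃ₗ⁅K⁆ G} (hν : ∀ x ∈ U, ∀ (v : F) (X : ckSections K m F L ⊤),
      (∀ᶠ y in 𝓝 (σ (τ x)), localForm e X.1 y = v) → localForm e' (μ X).1 (τ x) = ν x v) :
    SmoothFamilyOn m U fun x => (ν x : F → G) := by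
  intro v x₀ hx₀
  obtain ⟨C, hC⟩ := exists_section_eventuallyEq_const (K := K) (m := m) ⊤ he (hUe hx₀) v
  have h1 : ContMDiffAt (𝓡 m) 𝓘(ℝ, G) ∞ (fun x => localForm e' (μ C).1 (τ x)) x₀ :=
    ContMDiffAt.comp (g := localForm e' (μ C).1) x₀
      ((contMDiffAt_section_iff_localForm he' (hU x₀ hx₀)).1 ((μ C).2 _)) (hτ.contMDiff x₀)
  refine (h1.congr_of_eventuallyEq ?_).contMDiffWithinAt
  filter_upwards [eventually_eventually_nhds.2 hC, hUo.mem_nhds hx₀] with x hx hxU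
  exact (hν x hxU v C (by rw [hτ.comp_eq hσ]; exact hx)).symm

/-- The truncated exponential series of a jet: the right-hand side of the normal form. -/
noncomputable def expJet (N : Fin m → Module.End K G) (ν : F ≃ₗ⁅K⁆ G) (a : EuclideanSpace ℝ (Fin m))
    (d : ℕ) : smoothFunctions m F →+ G where
  toFun h := ∑ α ∈ multiIndices m d, (multiFactorial α : K)⁻¹ •
    multiPow N α (ν ((multiPow partialDeriv α h).1 a))
  map_zero' := by simp
  map_add' h g := by
    rw [← Finset.sum_add_distrib]
    refine Finset.sum_congr rfl fun α _ => ?_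
    have h1 : (multiPow partialDeriv α (h + g)).1 a =
        (multiPow partialDeriv α h).1 a + (multiPow partialDeriv α g).1 a := by
      rw [map_add]
      rfl
    rw [h1, map_add, map_add, smul_add]

theorem expJet_apply (N : Fin m → Module.End K G) (ν : F ≃ₗ⁅K⁆ G) (a : EuclideanSpace ℝ (Fin m))
    (d : ℕ) (h : smoothFunctions m F) : expJet N ν a d h =
      ∑ α ∈ multiIndices m d, (multiFactorial α : K)⁻¹ •
        multiPow N α (ν ((multiPow partialDeriv α h).1 a)) := rfl

theorem expJet_const (N : Fin m → Module.End K G) (ν : F ≃ₗ⁅K⁆ G) (a : EuclideanSpace ℝ (Fin m))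
    {d : ℕ} (hd : 0 < d) {h : smoothFunctions m F} {c : F} (hc : ∀ p, h.1 p = c) :
    expJet N ν a d h = ν c := by
  rw [expJet_apply, Finset.sum_eq_single 0]
  · simp [multiFactorial, multiPow_zero, hc]
  · intro α _ hα
    rw [multiPow_partialDeriv_const hα h hc]
    simp
  · intro h0
    exact absurd (mem_multiIndices.2 (by simpa using hd)) h0

/-- The truncated exponential series intertwines multiplication by a coordinate with its nilpotent
part, just as `μ` does. -/
theorem expJet_coordMul (hG : HasLocalCentroid K G) {N : Fin m → Module.End K G}
    (hN : ∀ i, N i ∈ nilpotentCentroid K G) (ν : F ≃ₗ⁅K⁆ G) (a : EuclideanSpace ℝ (Fin m)) {d : ℕ}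
    (hd : Module.finrank K G ≤ d) (i : Fin m) (h : smoothFunctions m F) :
    expJet N ν a d (coordMul a i h) = N i (expJet N ν a d h) := by
  rw [expJet_apply, expJet_apply, ← hG.sum_multiIndices_smul_eq hd hN i
    fun β => ν ((multiPow partialDeriv β h).1 a)]
  refine Finset.sum_congr rfl fun α _ => ?_
  rw [multiPow_partialDeriv_coordMul, map_nsmul]

/-- The normal form at a point: by Hadamard's lemma the difference of both sides lies in all steps
of the nilpotent filtration. -/
theorem Covers.localForm_eq_expJet {μ : ckSections K m F L ⊤ ≃ₗ⁅K⁆ ckSections K n G E l}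
    (hσ : Covers hF hG μ σ) (he : e ∈ FiberBundle.trivializationAtlas F L)
    (he' : e' ∈ FiberBundle.trivializationAtlas G E) (hξ : ξ ∈ IsManifold.maximalAtlas (𝓡 m) ∞ M)
    {q : N} (hq : σ q ∈ e.baseSet) (hq' : q ∈ e'.baseSet) (hqξ : σ q ∈ ξ.source)
    {ν : F ≃ₗ⁅K⁆ G} (hν : ∀ (v : F) (X : ckSections K m F L ⊤),
      (∀ᶠ y in 𝓝 (σ q), localForm e X.1 y = v) → localForm e' (μ X).1 q = ν v)
    {Nil : Fin m → Module.End K G} (hNil : ∀ i, Nil i ∈ nilpotentCentroid K G)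
    (hT : ∀ i, ∀ f : ckFunctions K m M ⊤,
      (∀ᶠ y in 𝓝 (σ q), f.1 y = (ξ y i : K)) → ∀ v : E q,
        chartLieEquiv K e' he' hq' (symbolDefect hG μ σ q f v) =
          Nil i (chartLieEquiv K e' he' hq' v))
    {h : smoothFunctions m F} {A : ckSections K m F L ⊤}
    (hA : ∀ᶠ z in 𝓝 (σ q), localForm e A.1 z = h.1 (ξ z)) :
    localForm e' (μ A).1 q = expJet Nil ν (ξ (σ q)) (Module.finrank K F) h := by
  have : FiniteDimensional ℝ F := finiteDimensional_real K F
  have : CompleteSpace F := FiniteDimensional.complete ℝ F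
  have : Nonempty N := ⟨q⟩
  set a := ξ (σ q) with ha
  have hdpos : 0 < Module.finrank K F := Module.finrank_pos
  choose f hf using fun i => exists_ckFunctions_coord K ⊤ hξ hqξ i
  have hcoord : ∀ i (Y : ckSections K m F L ⊤),
      chartLieEquiv K e' he' hq'
        ((μ (smulOp F L ⊤ (f i - algebraMap K _ (a i : K)) Y)).1 q) =
      Nil i (localForm e' (μ Y).1 q) := fun i Y => by
    have h1 : transportedSmul hG μ q (f i - algebraMap K _ (a i : K)) =
        symbolDefect hG μ σ q (f i) := by
      rw [map_sub, AlgHom.commutes, Algebra.algebraMap_eq_smul_one, ha, ← (hf i).self_of_nhds]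
      rfl
    rw [← transportedSmul_apply (hG := hG), h1, hT i (f i) (hf i), ← localForm_eq he' hq']
  have key : ∀ (s : ℕ) (h : smoothFunctions m F) (A : ckSections K m F L ⊤),
      (∀ᶠ z in 𝓝 (σ q), localForm e A.1 z = h.1 (ξ z)) →
      localForm e' (μ A).1 q - expJet Nil ν a (Module.finrank K F) h ∈ nilFiltration K G s := by
    intro s
    induction s with
    | zero => exact fun _ _ _ => trivial
    | succ s ih =>
      intro h A hA
      obtain ⟨c, g, hc, hcg⟩ := exists_smoothFunctions_eq_add_sum h a
      obtain ⟨C, hC⟩ := exists_section_eventuallyEq_const (K := K) (m := m) ⊤ he hq (h.1 a)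
      have hgξ : ∀ i, ContMDiffOn (𝓡 m) 𝓘(ℝ, F) ∞ (fun z => (g i).1 (ξ z)) ξ.source := fun i z hz =>
        (mem_smoothFunctions.1 (g i).2).contDiffAt.contMDiffAt.comp_contMDiffWithinAt z
          (contMDiffOn_of_mem_maximalAtlas hξ z hz)
      choose B hB using fun i => exists_section_eventuallyEq (K := K) (k := ⊤) he hq
        (ξ.open_source.mem_nhds hqξ) (hgξ i)
      set A' : ckSections K m F L ⊤ :=
        C + ∑ i, smulOp F L ⊤ (f i - algebraMap K _ (a i : K)) (B i) with hA'
      have hAA' : (μ A).1 q = (μ A').1 q := by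
        refine hσ.apply_congr ((eventually_eq_iff_localForm he hq).2 ?_)
        filter_upwards [hA, hC, eventually_all.2 hB, eventually_all.2 hf, e.open_baseSet.mem_nhds hq]
          with z hAz hCz hBz hfz hz
        have h1 : localForm e A'.1 z = localForm e C.1 z +
            ∑ i, ((ξ z i : K) - (a i : K)) • localForm e (B i).1 z := by
          rw [hA', localForm_add he hz]
          congr 1
          change chartLieEquiv K e he hz (evalAt m F ⊤ z _) = _
          rw [map_sum, map_sum]
          refine Finset.sum_congr rfl fun i _ => ?_
          rw [localForm_eq he hz (K := K), ← map_smul, ← hfz i]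
          rfl
        rw [hAz, h1, hCz]
        simp only [hBz]
        conv_lhs => rw [hcg]
        change c.1 (ξ z) + (∑ i, coordMul a i (g i) : smoothFunctions m F).1 (ξ z) = _
        rw [hc, AddSubmonoidClass.coe_finsetSum, Finset.sum_apply]
        congr 1
        refine Finset.sum_congr rfl fun i _ => ?_
        change ((ξ z) i - a i) • (g i).1 (ξ z) = _
        rw [← RCLike.ofReal_sub, ← RCLike.algebraMap_eq_ofReal, algebraMap_smul]
      have hμ : localForm e' (μ A).1 q = ν (h.1 a) + ∑ i, Nil i (localForm e' (μ (B i)).1 q) := by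
        rw [localForm_eq he' hq' (K := K), hAA', ← localForm_eq he' hq', hA', map_add,
          localForm_add he' hq', hν _ C hC, map_sum]
        congr 1
        change chartLieEquiv K e' he' hq' (evalAt n G l q _) = _
        rw [map_sum, map_sum]
        exact Finset.sum_congr rfl fun i _ => hcoord i (B i)
      have hR : expJet Nil ν a (Module.finrank K F) h = ν (h.1 a) +
          ∑ i, Nil i (expJet Nil ν a (Module.finrank K F) (g i)) := by
        conv_lhs => rw [hcg]
        rw [map_add, map_sum, expJet_const _ _ _ hdpos hc]
        congr 1
        exact Finset.sum_congr rfl fun i _ => expJet_coordMul hG hNil ν a hσ.finrank_le i (g i)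
      rw [hμ, hR, add_sub_add_left_eq_sub, ← Finset.sum_sub_distrib]
      refine Submodule.sum_mem _ fun i _ => ?_
      rw [← map_sub]
      exact apply_mem_nilFiltration_succ (hNil i) (ih (g i) (B i) (hB i))
  have h1 := key (Module.finrank K G) h A hA
  rw [hG.nilFiltration_eq_bot le_rfl, Submodule.mem_bot] at h1
  exact sub_eq_zero.1 h1

/-- Near a point, the local form of a section is given in coordinates by a function that is smooth on
the whole Euclidean space. -/
theorem exists_smoothFunctions_localForm (he : e ∈ FiberBundle.trivializationAtlas F L)
    (hξ : ξ ∈ IsManifold.maximalAtlas (𝓡 m) ∞ M) {x : M} (hx : x ∈ e.baseSet) (hxξ : x ∈ ξ.source)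
    (A : ckSections K m F L ⊤) :
    ∃ h : smoothFunctions m F, ∀ᶠ z in 𝓝 x, localForm e A.1 z = h.1 (ξ z) := by
  have h1 : ContMDiffOn 𝓘(ℝ, EuclideanSpace ℝ (Fin m)) 𝓘(ℝ, F) ∞
      (fun p => localForm e A.1 (ξ.symm p)) (ξ.target ∩ ξ.symm ⁻¹' e.baseSet) :=
    (contMDiffOn_localForm A he).comp
      ((contMDiffOn_symm_of_mem_maximalAtlas hξ).mono inter_subset_left) fun p hp => hp.2
  have hopen : ξ.target ∩ ξ.symm ⁻¹' e.baseSet ∈ 𝓝 (ξ x) := by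
    refine (ξ.isOpen_inter_preimage_symm e.open_baseSet).mem_nhds ⟨ξ.map_source hxξ, ?_⟩
    rw [mem_preimage, ξ.left_inv hxξ]
    exact hx
  obtain ⟨h, hh, hhx⟩ := exists_contMDiff_eventuallyEq (m := m) (k := ⊤) hopen h1
  refine ⟨⟨h, mem_smoothFunctions.2 (contMDiff_iff_contDiff.1 hh)⟩, ?_⟩
  filter_upwards [(ξ.continuousAt hxξ).eventually hhx, ξ.open_source.mem_nhds hxξ] with z hz hzs
  rw [hz, ξ.left_inv hzs]

/-- The normal form of an isomorphism of Lie algebras of smooth sections in charts. -/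
theorem Covers.exists_normalForm {μ : ckSections K m F L ⊤ ≃ₗ⁅K⁆ ckSections K n G E ⊤}
    (hσ : Covers hF hG μ σ) (hτ : Covers hG hF μ.symm τ)
    (he : e ∈ FiberBundle.trivializationAtlas F L)
    (he' : e' ∈ FiberBundle.trivializationAtlas G E)
    (hξ : ξ ∈ IsManifold.maximalAtlas (𝓡 m) ∞ M) :
    ∃ (ν : M → F ≃ₗ⁅K⁆ G) (Nil : Fin m → M → Module.End K G),
      SmoothFamilyOn m (e.baseSet ∩ ξ.source ∩ τ ⁻¹' e'.baseSet) (fun x => (ν x : F → G)) ∧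
      (∀ i, SmoothFamilyOn m (e.baseSet ∩ ξ.source ∩ τ ⁻¹' e'.baseSet)
        (fun x => (Nil i x : G → G))) ∧
      (∀ i x, Nil i x ∈ nilpotentCentroid K G) ∧
      ∀ (A : ckSections K m F L ⊤), ∀ x ∈ e.baseSet ∩ ξ.source ∩ τ ⁻¹' e'.baseSet,
        localForm e' (μ A).1 (τ x) = ∑ α ∈ multiIndices m (Module.finrank K F),
          ((multiFactorial α : K)⁻¹) • multiPow (fun i => Nil i x) α
            (ν x (chartMultiPartial ξ α (localForm e A.1) x)) := by
  set U := e.baseSet ∩ ξ.source ∩ τ ⁻¹' e'.baseSet with hU_def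
  have hUo : IsOpen U :=
    (e.open_baseSet.inter ξ.open_source).inter (e'.open_baseSet.preimage hτ.continuous)
  have hτσ : ∀ x, σ (τ x) = x := hτ.comp_eq hσ
  have hU : ∀ x ∈ U, τ x ∈ e'.baseSet := fun x hx => hx.2
  have hUe : ∀ x ∈ U, σ (τ x) ∈ e.baseSet := fun x hx => by rw [hτσ]; exact hx.1.1
  have hUξ : ∀ x ∈ U, σ (τ x) ∈ ξ.source := fun x hx => by rw [hτσ]; exact hx.1.2
  have hν : ∀ x, ∃ ν : F ≃ₗ⁅K⁆ G, x ∈ U → ∀ (v : F) (X : ckSections K m F L ⊤),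
      (∀ᶠ y in 𝓝 (σ (τ x)), localForm e X.1 y = v) → localForm e' (μ X).1 (τ x) = ν v := by
    intro x
    by_cases hx : x ∈ U
    · obtain ⟨ν, hν⟩ := hσ.exists_constEquiv hτ he he' (hUe x hx) (hU x hx)
      exact ⟨ν, fun _ => hν⟩
    · obtain ⟨ν, -⟩ := hσ.exists_constEquiv hτ
        (FiberBundle.trivialization_mem_atlas F L (σ (τ x)))
        (FiberBundle.trivialization_mem_atlas G E (τ x))
        (FiberBundle.mem_baseSet_trivializationAt F L (σ (τ x)))
        (FiberBundle.mem_baseSet_trivializationAt G E (τ x))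
      exact ⟨ν, fun h => absurd h hx⟩
  choose ν hν using hν
  have hT : ∀ i x, ∃ T ∈ nilpotentCentroid K G, ∀ (hx : x ∈ U), ∀ f : ckFunctions K m M ⊤,
      (∀ᶠ y in 𝓝 (σ (τ x)), f.1 y = (ξ y i : K)) → ∀ v : E (τ x),
        chartLieEquiv K e' he' (hU x hx) (symbolDefect hG μ σ (τ x) f v) =
          T (chartLieEquiv K e' he' (hU x hx) v) := by
    intro i x
    by_cases hx : x ∈ U
    · obtain ⟨T, hTN, hT⟩ := hσ.exists_coordDefect he' hξ (hU x hx) (hUξ x hx) i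
      exact ⟨T, hTN, fun _ => hT⟩
    · exact ⟨0, zero_mem_nilpotentCentroid K G, fun h => absurd h hx⟩
  choose Nil hNil hT using hT
  refine ⟨ν, Nil, hσ.smoothFamilyOn_constMap hτ he he' hUo hU (fun x hx => hx.1.1) hν,
    fun i => hσ.smoothFamilyOn_coordDefect hτ he' hξ hUo hU (fun x hx => hx.1.2) i (hT i), hNil,
    fun A x hx => ?_⟩
  obtain ⟨h, hA⟩ := exists_smoothFunctions_localForm he hξ hx.1.1 hx.1.2 A
  rw [hσ.localForm_eq_expJet he he' hξ (hUe x hx) (hU x hx) (hUξ x hx) (hν x hx)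
    (fun i => hNil i x) (fun i => hT i x hx) (h := h) (by rw [hτσ]; exact hA), expJet_apply, hτσ]
  refine Finset.sum_congr rfl fun α _ => ?_
  rw [(chartMultiPartial_eventuallyEq hx.1.2 hA α).self_of_nhds]

end NormalForm

/-! ### Isomorphisms between Lie algebras of sections -/

theorem mainTheorem1 {K : Type*} [RCLike K] {m n : ℕ} (hm : 0 < m) (hn : 0 < n)
    -- the base manifolds
    {M : Type*} [TopologicalSpace M] [ChartedSpace (EuclideanSpace ℝ (Fin m)) M]
    [IsManifold (𝓡 m) ∞ M] [T2Space M] [ParacompactSpace M] [ConnectedSpace M]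
    {N : Type*} [TopologicalSpace N] [ChartedSpace (EuclideanSpace ℝ (Fin n)) N]
    [IsManifold (𝓡 n) ∞ N] [T2Space N] [ParacompactSpace N] [ConnectedSpace N]
    -- the typical fibers
    {𝔨 : Type*} [NormedLieRing 𝔨] [NormedSpace ℝ 𝔨] [LieAlgebra K 𝔨] [IsScalarTower ℝ K 𝔨]
    [FiniteDimensional K 𝔨] [Nontrivial 𝔨]
    {𝔤 : Type*} [NormedLieRing 𝔤] [NormedSpace ℝ 𝔤] [LieAlgebra K 𝔤] [IsScalarTower ℝ K 𝔤]
    [FiniteDimensional K 𝔤]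
    -- the bundles of Lie algebras
    {L : M → Type*} [∀ x, LieRing (L x)] [∀ x, LieAlgebra K (L x)] [∀ x, Module ℝ (L x)]
    [∀ x, IsScalarTower ℝ K (L x)]
    [∀ x, TopologicalSpace (L x)] [TopologicalSpace (TotalSpace 𝔨 L)]
    [FiberBundle 𝔨 L] [VectorBundle ℝ 𝔨 L] [ContMDiffVectorBundle ∞ 𝔨 L (𝓡 m)]
    [IsLieAlgebraBundle K 𝔨 L]
    {E : N → Type*} [∀ y, LieRing (E y)] [∀ y, LieAlgebra K (E y)] [∀ y, Module ℝ (E y)]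
    [∀ y, IsScalarTower ℝ K (E y)]
    [∀ y, TopologicalSpace (E y)] [TopologicalSpace (TotalSpace 𝔤 E)]
    [FiberBundle 𝔤 E] [VectorBundle ℝ 𝔤 E] [ContMDiffVectorBundle ∞ 𝔤 E (𝓡 n)]
    [IsLieAlgebraBundle K 𝔤 E]
    -- the hypotheses on the fibers
    (h𝔨 : HomAbelianizationCenterTrivial K 𝔨) (h𝔤 : HomAbelianizationCenterTrivial K 𝔤)
    (hS𝔨 : semisimpleCentroid K 𝔨 = range fun c : K => c • (1 : Module.End K 𝔨))
    (hS𝔤 : semisimpleCentroid K 𝔤 = range fun c : K => c • (1 : Module.End K 𝔤))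
    -- the isomorphism of Lie algebras of sections
    {k l : ℕ∞} (hk : k ≠ 0) (hl : l ≠ 0)
    (μ : ckSections K m 𝔨 L k ≃ₗ⁅K⁆ ckSections K n 𝔤 E l) :
    k = l ∧
    (k ≠ ⊤ →
      (∃ κ : CkVectorBundleIso K m n 𝔨 L 𝔤 E k, ∀ (X : ckSections K m 𝔨 L k) (y : N),
        TotalSpace.mk' 𝔤 y ((μ X).1 y) =
          κ.total (TotalSpace.mk' 𝔨 (κ.base.symm y) (X.1 (κ.base.symm y)))) ∧
      Nonempty (Diffeomorph (𝓡 m) (𝓡 n) M N k) ∧ Nonempty (𝔨 ≃ₗ⁅K⁆ 𝔤)) ∧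
    (k = ⊤ →
      Nonempty (𝔨 ≃ₗ⁅K⁆ 𝔤) ∧
      ∃ lam : Diffeomorph (𝓡 m) (𝓡 n) M N ∞,
        IsDiffOpAlong K lam μ (Module.finrank K 𝔤 - 1) ∧
        -- for every identification `ι` of the fibers and all charts, the local form of `μ`
        ∀ ι : 𝔨 ≃ₗ⁅K⁆ 𝔤,
        ∀ φ ∈ FiberBundle.trivializationAtlas 𝔨 L, ∀ ψ ∈ FiberBundle.trivializationAtlas 𝔤 E,
        ∀ ξ ∈ IsManifold.maximalAtlas (𝓡 m) ∞ M,
        ∃ (μ₀ : M → (𝔤 ≃ₗ⁅K⁆ 𝔤)) (Nil : Fin m → M → Module.End K 𝔤),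
          SmoothFamilyOn m (φ.baseSet ∩ ξ.source ∩ lam ⁻¹' ψ.baseSet) (fun x => (μ₀ x : 𝔤 → 𝔤)) ∧
          (∀ i, SmoothFamilyOn m (φ.baseSet ∩ ξ.source ∩ lam ⁻¹' ψ.baseSet)
            (fun x => (Nil i x : 𝔤 → 𝔤))) ∧
          (∀ i, ∀ x ∈ φ.baseSet ∩ ξ.source ∩ lam ⁻¹' ψ.baseSet,
            Nil i x ∈ nilpotentCentroid K 𝔤) ∧
          ∀ (A : ckSections K m 𝔨 L k), ∀ x ∈ φ.baseSet ∩ ξ.source ∩ lam ⁻¹' ψ.baseSet,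
            localForm ψ (μ A).1 (lam x) =
              ∑ α ∈ multiIndices m (Module.finrank K 𝔨),
                ((multiFactorial α : K)⁻¹) •
                  multiPow (fun i => Nil i x) α
                    (μ₀ x (ι (chartMultiPartial ξ α (localForm φ A.1) x)))) := by
  have : SigmaCompactSpace M := by
    have : LocallyCompactSpace M := ChartedSpace.locallyCompactSpace (EuclideanSpace ℝ (Fin m)) M
    exact sigmaCompactSpace_of_connected_paracompact M
  have : SigmaCompactSpace N := by
    have : LocallyCompactSpace N := ChartedSpace.locallyCompactSpace (EuclideanSpace ℝ (Fin n)) N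
    exact sigmaCompactSpace_of_connected_paracompact N
  have : Nontrivial 𝔤 := nontrivial_of_section_equiv μ
  have hF : HasLocalCentroid K 𝔨 := .of_hom_trivial h𝔨 hS𝔨
  have hG : HasLocalCentroid K 𝔤 := .of_hom_trivial h𝔤 hS𝔤
  obtain ⟨σ, hσ⟩ := exists_covers hF hG μ
  obtain ⟨τ, hτ⟩ := exists_covers hG hF μ.symm
  obtain rfl : k = l := le_antisymm (hτ.le_of_ne_zero (μ := μ.symm) hσ hn hl)
    (hσ.le_of_ne_zero hτ hm hk)
  refine ⟨rfl, fun hk' => ?_, fun hk' => ?_⟩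
  · obtain ⟨κ, hκ, hlie⟩ := hσ.exists_bundleIso hτ hm hn hk hk'
    obtain ⟨x⟩ : Nonempty M := inferInstance
    exact ⟨⟨κ, hκ⟩, ⟨κ.base⟩, nonempty_typicalFiber_equiv (κ.fiber x) (hlie x)⟩
  · subst hk'
    obtain ⟨x₁⟩ : Nonempty M := inferInstance
    obtain ⟨ν₁, -⟩ := hσ.exists_constEquiv hτ
      (FiberBundle.trivialization_mem_atlas 𝔨 L (σ (τ x₁)))
      (FiberBundle.trivialization_mem_atlas 𝔤 E (τ x₁))
      (FiberBundle.mem_baseSet_trivializationAt 𝔨 L (σ (τ x₁)))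
      (FiberBundle.mem_baseSet_trivializationAt 𝔤 E (τ x₁))
    have hrank : Module.finrank K 𝔨 = Module.finrank K 𝔤 := ν₁.toLinearEquiv.finrank_eq
    refine ⟨⟨ν₁⟩, hσ.diffeomorph hτ, fun x₀ => ?_, fun ι φ hφ ψ hψ ξ hξ => ?_⟩
    · have hφ := FiberBundle.trivialization_mem_atlas 𝔨 L x₀
      have hψ := FiberBundle.trivialization_mem_atlas 𝔤 E (τ x₀)
      have hξ := IsManifold.chart_mem_maximalAtlas (I := 𝓡 m) (n := ∞) x₀
      obtain ⟨ν, Nil, hν, hNil, -, hform⟩ := hσ.exists_normalForm hτ hφ hψ hξ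
      refine ⟨_, ((trivializationAt 𝔨 L x₀).open_baseSet.inter
        (chartAt (EuclideanSpace ℝ (Fin m)) x₀).open_source).inter
        ((trivializationAt 𝔤 E (τ x₀)).open_baseSet.preimage hτ.continuous),
        ⟨⟨FiberBundle.mem_baseSet_trivializationAt 𝔨 L x₀, mem_chart_source _ x₀⟩,
          FiberBundle.mem_baseSet_trivializationAt 𝔤 E (τ x₀)⟩, _, hφ, _, hψ, _, hξ,
        fun x hx => hx.1.1, fun x hx => hx.2, fun x hx => hx.1.2,
        fun α x => (multiFactorial α : K)⁻¹ • (multiPow (fun i => Nil i x) α ∘ₗ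
          (ν x).toLinearEquiv.toLinearMap), fun α v x hx => ?_, fun A x hx => ?_⟩
      · exact contMDiffWithinAt_real_smul contMDiffWithinAt_const (SmoothFamilyOn.multiPow_apply hNil
          (hν v) α x hx)
      · have hd : Module.finrank K 𝔤 - 1 + 1 = Module.finrank K 𝔨 := by
          rw [hrank]
          exact Nat.sub_add_cancel Module.finrank_pos
        rw [hd]
        exact hform A x hx
    · obtain ⟨ν, Nil, hν, hNil, hNilN, hform⟩ := hσ.exists_normalForm hτ hφ hψ hξ
      refine ⟨fun x => ι.symm.trans (ν x), Nil, fun w => hν (ι.symm w), hNil,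
        fun i x _ => hNilN i x, fun A x hx => ?_⟩
      refine (hform A x hx).trans (Finset.sum_congr rfl fun α _ => ?_)
      exact congrArg (fun w => (multiFactorial α : K)⁻¹ • multiPow (fun i => Nil i x) α (ν x w))
        (ι.symm_apply_apply _).symm
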